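/- **Setting.** An *arena* $A$ is a set of moves, each labelled as an $\mathsf O$- or $\mathsf P$-move and as a question or answer, with an enabling relation $\vdash$ such that: initial moves ($\star\vdash m$) are $\mathsf O$-questions and are enabled by no move; answers are enabled only by questions; and if $m\vdash n$ for moves $m,n$, then $m$ and $n$ belong to different players. A *justified sequence* is a finite sequence of moves in which each non-initial move carries a pointer to an earlier move that enables it; moves in such sequences are always compared together with their pointers. The *$\mathsf P$-view* $\ulcorner s\urcorner$ and *$\mathsf O$-view* $\llcorner s\lrcorner$ are given by $\ulcorner\epsilon\urcorner=\epsilon$, $\ulcorner sp\urcorner=\ulcorner s\urcorner p$ ($p$ a $\mathsf P$-move), $\ulcorner si\urcorner=i$ ($i$ initial), $\ulcorner s\,p\,t\,o\urcorner=\ulcorner s\urcorner p\,o$ ($p$ justifies the $\mathsf O$-move $o$), and $\llcorner\epsilon\lrcorner=\epsilon$, $\llcorner so\lrcorner=\llcorner s\lrcorner o$ ($o$ an $\mathsf O$-move), $\llcorner s\,o\,t\,p\lrcorner=\llcorner s\lrcorner o\,p$ ($o$ justifies the $\mathsf P$-move $p$). A *play* on $A$ is an alternating justified sequence in which the justifier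 of each $\mathsf P$-move (non-initial $\mathsf O$-move) lies in the $\mathsf P$-view ($\mathsf O$-view) of the sequence before it. A play may contain several initial moves; it is *single-threaded* if it contains exactly one. A play is *complete* if all its questions are answered, and *well-bracketed* if each answer is justified by the pending (most recent unanswered) question. A *strategy* is a nonempty set of even-length plays that is closed under even-length prefixes and such that $sab,sac\in\sigma$ implies $b=c$. It is *innocent* if its responses depend only on the $\mathsf P$-view (if $sab,t\in\sigma$, $ta$ is a play and $\ulcorner sa\urcorner=\ulcorner ta\urcorner$, then $tab\in\sigma$, with the pointer of $b$ such that $\ulcorner sab\urcorner=\ulcorner tab\urcorner$), and if moreover it is well-bracketed: whenever $sab\in\sigma$ and $b$ is an answer, $b$ is justified by the pending question of $\ulcorner sa\urcorner$. Let $\Sigma$ be the game with an initial $\mathsf O$-question $q$ enabling a $\mathsf P$-answer $a$ and with plays $\epsilon,q,qa$, and let $\top=\{\epsilon,qa\}$. The game $A\to\Sigma$ has the moves of $A$ with the players exchanged together with those of $\Sigma$, where $q$ also enables the initial moves of $A$; its plays are the plays on this arena whose restrictions to $A$ and $\Sigma$ are plays there. For strategies $\sigma$ on $A$ and $\alpha$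 on $A\to\Sigma$ put $\sigma;\alpha=\{u{\restriction}\Sigma : u\in\alpha,\ u{\restriction}A\in\sigma\}$. For innocent $\sigma,\tau$ on $A$ write $\sigma\le_{ib}\tau$ if for every innocent strategy $\alpha$ on $A\to\Sigma$, $\sigma;\alpha=\top$ implies $\tau;\alpha=\top$. An *$\mathsf O$-view over $A$* is a play $s$ with $\llcorner s\lrcorner=s$. A set $S$ of well-bracketed $\mathsf O$-views over $A$ is *$\mathsf O$-deterministic* if $so_1,so_2\in S$ with $o_1,o_2$ $\mathsf O$-moves implies $o_1=o_2$, each $s\in S$ is single-threaded, and all $s\in S$ begin with the same initial move. For such $S$, $\alpha_S$ is the set of plays on $A\to\Sigma$ generated by the $\mathsf P$-view function $$\{(qs,o): so\in S,\ o \text{ an } \mathsf O\text{-move of } A\}\cup\{(qt,a): t\in S,\ t\text{ complete}\},$$ that is, the set of even-length plays $u$ such that for every even-length prefix $u'xy$ of $u$ the pair $(\ulcorner u'x\urcorner,y)$ lies in this set; $\sigma;\alpha_S$ is defined by the same formula as above. **Proposition.** Let $A$ be an arena and let $\sigma,\tau$ be innocent strategies on $A$. Then $\sigma\le_{ib}\tau$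 if and only if, for every $\mathsf O$-deterministic set $S$ on $A$, $\sigma;\alpha_S=\top$ implies $\tau;\alpha_S=\top$. -/

import Mathlib

universe u v

namespace GameSem

/-- The two players: Opponent and Proponent. -/
inductive Player where
  | O
  | P
  deriving DecidableEq

/-- The player with the opposite role. -/
def Player.flip : Player → Player
  | .O => .P
  | .P => .O

/-- Moves are questions or answers. -/
inductive Kind where
  | Q
  | A
  deriving DecidableEq

/-- An arena: labelled moves with an enabling relation. `initial m` is `⋆ ⊢ m`, and
`enables n m` is `n ⊢ m` for a move `n`. -/
structure Arena where
  Move : Type u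
  player : Move → Player
  kind : Move → Kind
  initial : Move → Prop
  enables : Move → Move → Prop
  initial_player : ∀ m, initial m → player m = .O
  initial_kind : ∀ m, initial m → kind m = .Q
  initial_not_enabled : ∀ m, initial m → ∀ n, ¬ enables n m
  answer_enabled : ∀ n m, enables n m → kind m = .A → kind n = .Q
  enables_player : ∀ n m, enables n m → player n ≠ player m

/-- A sequence of move occurrences. The second component of an occurrence is its justification
pointer: the position (counted from `0`) of its justifier in the sequence, `none` if there is
no justifier. -/
abbrev JSeq (M : Type u) := List (M × Option ℕ)

/-- The subsequence of `s` at the (increasing) positions `idx`, with the pointers inherited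
from `s`; a pointer to an occurrence that is not kept is dropped. -/
def JSeq.sub {M : Type u} (s : JSeq M) (idx : List ℕ) : JSeq M :=
  idx.filterMap fun i => (s[i]?).map fun x => (x.1, x.2.bind fun k => idx.idxOf? k)

namespace Arena

/-- The positions of `s` that form the P-view of its prefix of length `n`. -/
def pviewIdx (A : Arena.{u}) (s : JSeq A.Move) : ℕ → List ℕ
  | 0 => []
  | n + 1 =>
    match s[n]? with
    | none => []
    | some (m, ptr) =>
      match A.player m, ptr with
      | .P, _ => pviewIdx A s n ++ [n]
      | .O, none => [n]
      | .O, some k => if k < n then pviewIdx A s k ++ [k, n] else []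

/-- The positions of `s` that form the O-view of its prefix of length `n`. -/
def oviewIdx (A : Arena.{u}) (s : JSeq A.Move) : ℕ → List ℕ
  | 0 => []
  | n + 1 =>
    match s[n]? with
    | none => []
    | some (m, ptr) =>
      match A.player m, ptr with
      | .O, _ => oviewIdx A s n ++ [n]
      | .P, none => []
      | .P, some k => if k < n then oviewIdx A s k ++ [k, n] else []

/-- The P-view of `s`, as a sequence with pointers. -/
def pview (A : Arena.{u}) (s : JSeq A.Move) : JSeq A.Move :=
  s.sub (A.pviewIdx s s.length)

/-- The O-view of `s`, as a sequence with pointers. -/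
def oview (A : Arena.{u}) (s : JSeq A.Move) : JSeq A.Move :=
  s.sub (A.oviewIdx s s.length)

/-- Legal plays: justified sequences that alternate (the first move, being initial, is an
O-move) and satisfy the visibility conditions of both players. -/
structure IsLegal (A : Arena.{u}) (s : JSeq A.Move) : Prop where
  initial_of_none : ∀ (i : ℕ) (m : A.Move), s[i]? = some (m, none) → A.initial m
  justified : ∀ (i : ℕ) (m : A.Move) (k : ℕ), s[i]? = some (m, some k) →
    k < i ∧ ∃ x, s[k]? = some x ∧ A.enables x.1 m
  alternating : ∀ (i : ℕ) (x y : A.Move × Option ℕ), s[i]? = some x →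
    s[i + 1]? = some y → A.player x.1 ≠ A.player y.1
  visible_P : ∀ (i : ℕ) (m : A.Move) (k : ℕ), s[i]? = some (m, some k) →
    A.player m = .P → k ∈ A.pviewIdx s i
  visible_O : ∀ (i : ℕ) (m : A.Move) (k : ℕ), s[i]? = some (m, some k) →
    A.player m = .O → k ∈ A.oviewIdx s i

/-- The plays on an arena. They may contain several initial moves (threads). -/
def plays (A : Arena.{u}) : Set (JSeq A.Move) := {s | A.IsLegal s}

/-- Position `i` of `s` holds a question that no answer in `s` points to. -/
def Unanswered (A : Arena.{u}) (s : JSeq A.Move) (i : ℕ) : Prop :=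
  (∃ x, s[i]? = some x ∧ A.kind x.1 = .Q) ∧
    ∀ (j : ℕ) (y : A.Move × Option ℕ), s[j]? = some y → A.kind y.1 = .A → y.2 ≠ some i

/-- Position `i` is the pending question of `s`: its most recent unanswered question. -/
def IsPending (A : Arena.{u}) (s : JSeq A.Move) (i : ℕ) : Prop :=
  A.Unanswered s i ∧ ∀ j, A.Unanswered s j → j ≤ i

/-- If the last move of `t` is an answer, then it answers the question that was pending. -/
def AnswersPending (A : Arena.{u}) (t : JSeq A.Move) : Prop :=
  ∀ s x, t = s ++ [x] → A.kind x.1 = .A → ∃ k, x.2 = some k ∧ A.IsPending s k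

/-- Well-bracketed sequences: every answer answers the question pending at that point. -/
def WellBracketed (A : Arena.{u}) (s : JSeq A.Move) : Prop :=
  ∀ t, t <+: s → A.AnswersPending t

/-- Complete sequences: every question is answered. -/
def Complete (A : Arena.{u}) (s : JSeq A.Move) : Prop := ∀ i, ¬ A.Unanswered s i

/-- O-views over `A`: the plays that are their own O-view. -/
def IsOView (A : Arena.{u}) (s : JSeq A.Move) : Prop := s ∈ A.plays ∧ A.oview s = s

/-- Single-threaded plays: exactly one occurrence without a justifier, that is, in a play,
exactly one occurrence of an initial move. -/
def SingleThreaded (A : Arena.{u}) (s : JSeq A.Move) : Prop :=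
  s.countP (fun x => x.2.isNone) = 1

/-- Strategies on an arena with `pos` as its set of permitted plays: nonempty sets of permitted
plays of even length, closed under even-length prefixes, and deterministic (moves are
compared with their pointers). -/
structure IsStrategy (A : Arena.{u}) (pos σ : Set (JSeq A.Move)) : Prop where
  nonempty : σ.Nonempty
  mem_pos : ∀ s ∈ σ, s ∈ pos
  even : ∀ s ∈ σ, Even s.length
  closed : ∀ s a b, s ++ [a, b] ∈ σ → s ∈ σ
  deterministic : ∀ s a b c, s ++ [a, b] ∈ σ → s ++ [a, c] ∈ σ → b = c

/-- Innocent strategies (in the well-bracketed sense): the response of Proponent is a function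
of the P-view, and Proponent only answers the pending question of the P-view. -/
structure IsInnocent (A : Arena.{u}) (pos σ : Set (JSeq A.Move)) : Prop
    extends A.IsStrategy pos σ where
  innocent : ∀ s a b t a', s ++ [a, b] ∈ σ → t ∈ σ → t ++ [a'] ∈ pos →
    A.pview (t ++ [a']) = A.pview (s ++ [a]) →
    ∃ b', t ++ [a', b'] ∈ σ ∧ A.pview (t ++ [a', b']) = A.pview (s ++ [a, b])
  bracketed : ∀ s ∈ σ, A.AnswersPending (A.pview s)

/-- The set of plays determined by a P-view function `f`, given by its graph: a pair `(v, m)`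
says that Proponent plays `m` (with pointer into `v`) when the P-view is `v`. -/
def ofViewFunction (A : Arena.{u}) (pos : Set (JSeq A.Move))
    (f : Set (JSeq A.Move × (A.Move × Option ℕ))) : Set (JSeq A.Move) :=
  {s | s ∈ pos ∧ Even s.length ∧ ∀ t a b, Even t.length → t ++ [a, b] <+: s →
    ∃ x ∈ f, A.pview (t ++ [a]) = x.1 ∧ A.pview (t ++ [a, b]) = x.1 ++ [x.2]}

/-- The function space arena `A → B`: the roles in `A` are exchanged, and the initial moves of
`A` are enabled by those of `B`. -/
def arrow (A : Arena.{u}) (B : Arena.{v}) : Arena.{max u v} where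
  Move := A.Move ⊕ B.Move
  player := Sum.elim (fun a => (A.player a).flip) B.player
  kind := Sum.elim A.kind B.kind
  initial := Sum.elim (fun _ => False) B.initial
  enables
    | .inl a, .inl a' => A.enables a a'
    | .inr b, .inr b' => B.enables b b'
    | .inr b, .inl a => B.initial b ∧ A.initial a
    | .inl _, .inr _ => False
  initial_player := by
    rintro (a | b) h
    · exact h.elim
    · exact B.initial_player b h
  initial_kind := by
    rintro (a | b) h
    · exact h.elim
    · exact B.initial_kind b h
  initial_not_enabled := by
    rintro (a | b) h (a' | b') h'
    · exact h
    · exact h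
    · exact h'
    · exact B.initial_not_enabled b h b' h'
  answer_enabled := by
    rintro (a | b) (a' | b') h hk
    · exact A.answer_enabled a a' h hk
    · exact h.elim
    · have := A.initial_kind a' h.2
      simp_all
    · exact B.answer_enabled b b' h hk
  enables_player := by
    rintro (a | b) (a' | b') h
    · have := A.enables_player a a' h
      revert this
      simp only [Sum.elim_inl]
      cases A.player a <;> cases A.player a' <;> simp [Player.flip]
    · exact h.elim
    · simp [A.initial_player a' h.2, B.initial_player b h.1, Player.flip]
    · exact B.enables_player b b' h

/-- The restriction of a sequence on `A → B` to `A`. -/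
def restrictLeft {A : Arena.{u}} {B : Arena.{v}} (s : JSeq (A.arrow B).Move) : JSeq A.Move :=
  let f : A.Move ⊕ B.Move → Option A.Move := Sum.getLeft?
  (s.sub ((List.range s.length).filter fun i => ((s[i]?).bind fun x => f x.1).isSome)).filterMap
    fun x => (f x.1).map fun m => (m, x.2)

/-- The restriction of a sequence on `A → B` to `B`. -/
def restrictRight {A : Arena.{u}} {B : Arena.{v}} (s : JSeq (A.arrow B).Move) : JSeq B.Move :=
  let f : A.Move ⊕ B.Move → Option B.Move := Sum.getRight?
  (s.sub ((List.range s.length).filter fun i => ((s[i]?).bind fun x => f x.1).isSome)).filterMap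
    fun x => (f x.1).map fun m => (m, x.2)

/-- The composite `σ;α` of `σ : A` and `α : A → B`: parallel composition on `A → B`, followed
by hiding of the moves in `A`. -/
def comp {A : Arena.{u}} {B : Arena.{v}} (σ : Set (JSeq A.Move))
    (α : Set (JSeq (A.arrow B).Move)) : Set (JSeq B.Move) :=
  {w | ∃ s ∈ α, restrictLeft s ∈ σ ∧ restrictRight s = w}

end Arena

/-- The moves of the game `Σ`. -/
inductive SigmaMove where
  | q
  | a

/-- The arena of `Σ`: an initial O-question `q` that enables a P-answer `a`. -/
def sigmaArena : Arena.{0} where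
  Move := SigmaMove
  player | .q => .O | .a => .P
  kind | .q => .Q | .a => .A
  initial m := m = .q
  enables m n := m = .q ∧ n = .a
  initial_player := by rintro _ rfl; rfl
  initial_kind := by rintro _ rfl; rfl
  initial_not_enabled := by rintro _ rfl n ⟨-, h⟩; cases h
  answer_enabled := by rintro _ _ ⟨rfl, rfl⟩ _; rfl
  enables_player := by rintro _ _ ⟨rfl, rfl⟩ h; cases h

/-- The plays of the game `Σ`: `ε`, `q` and `qa`. -/
def sigmaPlays : Set (JSeq sigmaArena.Move) :=
  {[], [(SigmaMove.q, none)], [(SigmaMove.q, none), (SigmaMove.a, some 0)]}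

/-- The strategy `⊤ = {ε, qa}` on `Σ`. -/
def sigmaTop : Set (JSeq sigmaArena.Move) :=
  {[], [(SigmaMove.q, none), (SigmaMove.a, some 0)]}

namespace Arena

/-- The arena of `A → Σ`. -/
abbrev testArena (A : Arena.{u}) : Arena.{u} := A.arrow sigmaArena

/-- The plays of the game `A → Σ`. -/
def testPlays (A : Arena.{u}) : Set (JSeq A.testArena.Move) :=
  {s | A.testArena.IsLegal s ∧ restrictLeft s ∈ A.plays ∧ restrictRight s ∈ sigmaPlays}

/-- `σ ≤_ib τ`: every innocent test that `σ` passes is passed by `τ`. -/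
def LeIB (A : Arena.{u}) (σ τ : Set (JSeq A.Move)) : Prop :=
  ∀ α : Set (JSeq A.testArena.Move), A.testArena.IsInnocent A.testPlays α →
    comp σ α = sigmaTop → comp τ α = sigmaTop

/-- O-deterministic sets of well-bracketed O-views. -/
structure IsODeterministic (A : Arena.{u}) (S : Set (JSeq A.Move)) : Prop where
  isOView : ∀ s ∈ S, A.IsOView s
  wellBracketed : ∀ s ∈ S, A.WellBracketed s
  deterministic : ∀ s o₁ o₂, A.player o₁.1 = .O → A.player o₂.1 = .O →
    s ++ [o₁] ∈ S → s ++ [o₂] ∈ S → o₁ = o₂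
  singleThreaded : ∀ s ∈ S, A.SingleThreaded s
  same_initial : ∀ s ∈ S, ∀ t ∈ S, s.head? = t.head?

/-- An occurrence in a play `s` of `A`, as an occurrence in the play `q s` of `A → Σ`:
pointers are shifted by one, and initial moves of `A` are justified by `q`. -/
def embedOcc (A : Arena.{u}) (x : A.Move × Option ℕ) : A.testArena.Move × Option ℕ :=
  (Sum.inl x.1, some (match x.2 with | none => 0 | some k => k + 1))

/-- The sequence `q s` on `A → Σ`, for a sequence `s` on `A`. -/
def embed (A : Arena.{u}) (s : JSeq A.Move) : JSeq A.testArena.Move :=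
  (Sum.inr SigmaMove.q, none) :: s.map A.embedOcc

/-- The P-view function
`{(q s, o) : s o ∈ S} ∪ {(q t, a) : t ∈ S complete}` on `A → Σ`, where `o` is a P-move of
`A → Σ`, that is, an O-move of `A`. -/
def alphaViewFunction (A : Arena.{u}) (S : Set (JSeq A.Move)) :
    Set (JSeq A.testArena.Move × (A.testArena.Move × Option ℕ)) :=
  {x | ∃ s o, s ++ [o] ∈ S ∧ A.player o.1 = .O ∧ x = (A.embed s, A.embedOcc o)} ∪
    {x | ∃ t ∈ S, A.Complete t ∧ x = (A.embed t, (Sum.inr SigmaMove.a, some 0))}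

/-- The test `α_S : A → Σ`. -/
def alpha (A : Arena.{u}) (S : Set (JSeq A.Move)) : Set (JSeq A.testArena.Move) :=
  A.testArena.ofViewFunction A.testPlays (A.alphaViewFunction S)

end Arena

end GameSem

namespace GameSem

/-! ### Sorted index lists -/

/-! Innocent tests are at least as strong as the sets `S`. In general `α_S` is not deterministic: a
view may be complete, so that the test may answer, and also be extended within `S`. Letting the test
answer at the first complete view gives an innocent strategy contained in `α_S`
(`isInnocent_first`), and a play that passes `α_S` has a prefix that passes this smaller test
(`exists_first`). This yields `LeIB.alpha`.

For the converse, a test is passed exactly when some play `s` of the strategy leads it to its answer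
(`comp_eq_sigmaTop_iff`). Such an `s` may have many threads, while a set `S` only describes one. The
threads are therefore replaced one at a time, from the one that starts last to the one that starts
first: in `Mixed α σ τ r` the threads that start before position `r` are played by `σ` and the
others by `τ`, and `Mixed.pred` lowers `r` by one. Going backwards matters, since replacing a thread
may change everything that happens after its start.

For one replacement, moves are coloured by comparing the start of their thread with `r`; the thread
to be replaced has colour `eq`. The test and all the other threads form its environment. Being
composed of innocent strategies, the environment reacts to a view of its own, called the F-view: it
jumps to the justifier at the P-moves of colour `eq`, which are the inputs of the environment, and
goes back by one position everywhere else. Runs with equal F-views continue alike as long as the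
environment is to move (`IsRun.exists_step`, `IsRun.step`).

In an answered run the O-views of the thread determine the F-views (`IsRun.vseq_inpF_of_tview`).
Hence these O-views form an O-deterministic set `S` (`IsRun.isODeterministic`), and the thread
passes `α_S` (`IsRun.embed_thread_mem`). By hypothesis the other strategy has a play `t` that passes
`α_S` too. A new run is then assembled (`Follows`): moves of the environment are copied from the old
run at a position with the same F-view, P-moves of the thread are copied from `t`. Since `t` passes
`α_S`, each F-view that arises is an F-view of the old run, so the new run ends with an answer as
well (`Follows.exists_answered`, `IsRun.exchange`). -/

theorem idxOf?_eq_some_of_nodup {L : List ℕ} (hL : L.Nodup) {k i : ℕ} :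
    L.idxOf? k = some i ↔ L[i]? = some k := by
  rw [List.idxOf?_eq_some_iff, List.getElem?_eq_some_iff]
  constructor
  · rintro ⟨h, h1, -⟩
    exact ⟨h, h1⟩
  · rintro ⟨h, h1⟩
    refine ⟨h, h1, fun j hj h2 => ?_⟩
    have := (hL.getElem_inj_iff (hi := by omega) (hj := h)).1 (h2.trans h1.symm)
    omega

theorem nodup_of_sorted {L : List ℕ} (hL : L.Pairwise (· < ·)) : L.Nodup :=
  hL.imp (fun h => Nat.ne_of_lt h)

theorem lt_of_sorted {L : List ℕ} (hL : L.Pairwise (· < ·)) {i j m n : ℕ}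
    (hi : L[i]? = some m) (hj : L[j]? = some n) (h : i < j) : m < n := by
  obtain ⟨h1, rfl⟩ := List.getElem?_eq_some_iff.1 hi
  obtain ⟨h2, rfl⟩ := List.getElem?_eq_some_iff.1 hj
  exact List.pairwise_iff_getElem.1 hL _ _ _ _ h

theorem idx_lt_of_sorted {L : List ℕ} (hL : L.Pairwise (· < ·)) {i j m n : ℕ}
    (hi : L[i]? = some m) (hj : L[j]? = some n) (h : m < n) : i < j := by
  rcases lt_trichotomy i j with h' | rfl | h'
  · exact h'
  · rw [hi] at hj; simp at hj; omega
  · have := lt_of_sorted hL hj hi h'; omega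

theorem idx_eq_of_sorted {L : List ℕ} (hL : L.Pairwise (· < ·)) {i j n : ℕ}
    (hi : L[i]? = some n) (hj : L[j]? = some n) : i = j := by
  rcases lt_trichotomy i j with h' | rfl | h'
  · have := lt_of_sorted hL hi hj h'; omega
  · rfl
  · have := lt_of_sorted hL hj hi h'; omega

theorem exists_getElem?_of_mem {L : List ℕ} {n : ℕ} (h : n ∈ L) : ∃ i : ℕ, L[i]? = some n :=
  List.mem_iff_getElem?.1 h

/-- Consecutive elements of a sorted list: if `n` and `n + 1` both occur, they are adjacent. -/
theorem adjacent_of_sorted {L : List ℕ} (hL : L.Pairwise (· < ·)) {i j n : ℕ}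
    (hi : L[i]? = some n) (hj : L[j]? = some (n + 1)) : j = i + 1 := by
  have h := idx_lt_of_sorted hL hi hj (by omega)
  by_contra hne
  obtain ⟨hlt, _⟩ := List.getElem?_eq_some_iff.1 hj
  have h3 : L[i + 1]? = some L[i + 1] := List.getElem?_eq_getElem (by omega)
  have h1 := lt_of_sorted hL hi h3 (by omega)
  have h2 := lt_of_sorted hL h3 hj (by omega)
  omega

/-! ### Chains -/

/-- The list of positions reached from `n - 1` by iterating a predecessor function, given by the
length of the remaining prefix. -/
def chain (pr : ℕ → ℕ) : ℕ → List ℕ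
  | 0 => []
  | n + 1 => chain pr (min (pr n) n) ++ [n]
termination_by n => n
decreasing_by omega

@[simp] theorem chain_zero (pr : ℕ → ℕ) : chain pr 0 = [] := by rw [chain]

theorem chain_succ' (pr : ℕ → ℕ) (n : ℕ) : chain pr (n + 1) = chain pr (min (pr n) n) ++ [n] := by
  rw [chain]

theorem chain_succ {pr : ℕ → ℕ} {n : ℕ} (h : pr n ≤ n) :
    chain pr (n + 1) = chain pr (pr n) ++ [n] := by
  rw [chain_succ', min_eq_left h]

theorem lt_of_mem_chain {pr : ℕ → ℕ} {n x : ℕ} (h : x ∈ chain pr n) : x < n := by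
  induction n using Nat.strong_induction_on with
  | _ n ih =>
    cases n with
    | zero => simp at h
    | succ n =>
      rw [chain_succ', List.mem_append, List.mem_singleton] at h
      rcases h with h | rfl
      · have := ih _ (by omega) h; omega
      · omega

theorem chain_sorted (pr : ℕ → ℕ) (n : ℕ) : (chain pr n).Pairwise (· < ·) := by
  induction n using Nat.strong_induction_on with
  | _ n ih =>
    cases n with
    | zero => simp
    | succ n =>
      rw [chain_succ', List.pairwise_append]
      refine ⟨ih _ (by omega), by simp, fun a ha b hb => ?_⟩
      have := lt_of_mem_chain ha
      simp at hb
      omega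

/-- A chain is built backwards from its last element, so what precedes an element is the chain
started at that element. The closure properties of views are reduced to this. -/
theorem chain_prefix {pr : ℕ → ℕ} {n x : ℕ} (h : x ∈ chain pr n) :
    chain pr (x + 1) <+: chain pr n := by
  induction n using Nat.strong_induction_on with
  | _ n ih =>
    cases n with
    | zero => simp at h
    | succ n =>
      have h' := h
      rw [chain_succ', List.mem_append, List.mem_singleton] at h
      rcases h with h | rfl
      · rw [chain_succ' pr n]
        exact (ih _ (by omega) h).trans (List.prefix_append _ _)
      · exact List.prefix_rfl

theorem chain_congr {pr pr' : ℕ → ℕ} {n : ℕ} (h : ∀ j < n, pr j = pr' j) :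
    chain pr n = chain pr' n := by
  induction n using Nat.strong_induction_on with
  | _ n ih =>
    cases n with
    | zero => simp
    | succ n =>
      rw [chain_succ', chain_succ', h n (by omega), ih _ (by omega)]
      intro j hj
      exact h j (by omega)

theorem mem_chain_self (pr : ℕ → ℕ) (n : ℕ) : n ∈ chain pr (n + 1) := by
  rw [chain_succ']; simp

theorem length_chain_succ_pos (pr : ℕ → ℕ) (n : ℕ) : 0 < (chain pr (n + 1)).length := by
  rw [chain_succ']; simp

theorem getElem?_chain_last (pr : ℕ → ℕ) (n : ℕ) :
    (chain pr (n + 1))[(chain pr (n + 1)).length - 1]? = some n := by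
  rw [chain_succ']; simp

theorem mem_chain_trans {pr : ℕ → ℕ} {n x y : ℕ} (h : x ∈ chain pr n)
    (hy : y ∈ chain pr (x + 1)) : y ∈ chain pr n := (chain_prefix h).subset hy

/-- Every element of a chain but the first is reached from its predecessor. -/
theorem chain_pred_mem {pr : ℕ → ℕ} {n x m : ℕ} (h : x ∈ chain pr n) (hm : pr x = m + 1)
    (hmx : m < x) : m ∈ chain pr n := by
  refine mem_chain_trans h ?_
  rw [chain_succ', hm, min_eq_left (by omega)]
  exact List.mem_append_left _ (mem_chain_self pr m)

theorem getElem?_chain_prefix {pr : ℕ → ℕ} {n x j : ℕ} (h : (chain pr n)[j]? = some x) :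
    chain pr (x + 1) = (chain pr n).take (j + 1) := by
  have hx := List.mem_of_getElem? h
  have hp := chain_prefix hx
  have h1 : (chain pr n)[(chain pr (x + 1)).length - 1]? = some x := by
    have := getElem?_chain_last pr x
    have hl := length_chain_succ_pos pr x
    obtain ⟨t, ht⟩ := hp
    rw [← ht, List.getElem?_append_left (by omega)]
    exact this
  have h2 := idx_eq_of_sorted (chain_sorted pr n) h h1
  have hl := length_chain_succ_pos pr x
  rw [List.prefix_iff_eq_take.1 hp, h2]
  congr 1
  omega

/-- Chains for predecessor functions that correspond along an index list correspond. -/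
theorem chain_eq_map (L : List ℕ) (pr prw : ℕ → ℕ) (Q : ℕ → Prop)
    (h : ∀ j n, L[j]? = some n → Q n → (pr n = 0 ∧ prw j = 0) ∨
      ∃ i m, i < j ∧ m < n ∧ L[i]? = some m ∧ Q m ∧ pr n = m + 1 ∧ prw j = i + 1) :
    ∀ j n, L[j]? = some n → Q n →
      chain pr (n + 1) = (chain prw (j + 1)).map (L.getD · 0) := by
  intro j
  induction j using Nat.strong_induction_on with
  | _ j ih =>
    intro n hj hQ
    rcases h j n hj hQ with ⟨h1, h2⟩ | ⟨i, m, hij, hmn, hi, hm, h1, h2⟩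
    · rw [chain_succ', chain_succ', h1, h2]
      simp [List.getD, hj]
    · rw [chain_succ', chain_succ', h1, h2, min_eq_left (by omega), min_eq_left (by omega),
        List.map_append, ← ih i hij m hi hm]
      simp [List.getD, hj]

/-- For the passage from `s` to `q s`: positions move up by one, and a predecessor `0` becomes `1`,
the prefix consisting of `q` alone. This is the source of the extra head `0`. -/
theorem chain_shift {pr pr' : ℕ → ℕ} {n : ℕ} (h : ∀ j < n, pr' (j + 1) = pr j + 1) :
    chain pr' (n + 1) = 0 :: (chain pr n).map (· + 1) := by
  induction n using Nat.strong_induction_on with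
  | _ n ih =>
    cases n with
    | zero => rw [chain_succ']; simp
    | succ n =>
      rw [chain_succ', chain_succ', h n (by omega),
        show min (pr n + 1) (n + 1) = min (pr n) n + 1 by omega,
        ih _ (by omega) (fun j hj => h j (by omega))]
      simp

theorem chain_eq_range {pr : ℕ → ℕ} {n : ℕ} (h : ∀ j < n, pr j = j) :
    chain pr n = List.range n := by
  induction n with
  | zero => simp
  | succ n ih =>
    rw [chain_succ (h n (by omega)).le, h n (by omega), ih (fun j hj => h j (by omega)),
      List.range_succ]

/-! ### Subsequences -/

section Sub
variable {M : Type u} {N : Type v}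

theorem getElem?_filterMap_of_isSome {α β : Type*} (f : α → Option β) (L : List α)
    (h : ∀ i ∈ L, (f i).isSome) (j : ℕ) : (L.filterMap f)[j]? = L[j]?.bind f := by
  induction L generalizing j with
  | nil => simp
  | cons a L ih =>
    obtain ⟨b, hb⟩ := Option.isSome_iff_exists.1 (h a (by simp))
    rw [List.filterMap_cons_some hb]
    cases j with
    | zero => simp [hb]
    | succ j => simpa using ih (fun i hi => h i (by simp [hi])) j

theorem JSeq.getElem?_sub {s : JSeq M} {L : List ℕ} (h : ∀ i ∈ L, i < s.length) (j : ℕ) :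
    (s.sub L)[j]? =
      L[j]?.bind fun i => (s[i]?).map fun x => (x.1, x.2.bind fun k => L.idxOf? k) := by
  apply getElem?_filterMap_of_isSome
  intro i hi
  simp [h i hi]

theorem JSeq.getElem?_sub_of {s : JSeq M} {L : List ℕ} (h : ∀ i ∈ L, i < s.length) {j n : ℕ}
    {m : M} {p : Option ℕ} (hj : L[j]? = some n) (hn : s[n]? = some (m, p)) :
    (s.sub L)[j]? = some (m, p.bind fun k => L.idxOf? k) := by
  simp [JSeq.getElem?_sub h, hj, hn]

theorem JSeq.exists_of_getElem?_sub {s : JSeq M} {L : List ℕ} (h : ∀ i ∈ L, i < s.length)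
    {j : ℕ} {m : M} {q : Option ℕ} (hj : (s.sub L)[j]? = some (m, q)) :
    ∃ n p, L[j]? = some n ∧ s[n]? = some (m, p) ∧ q = p.bind fun k => L.idxOf? k := by
  rw [JSeq.getElem?_sub h] at hj
  simp only [Option.bind_eq_some_iff, Option.map_eq_some_iff] at hj
  obtain ⟨n, hn, ⟨m', p⟩, hx, he⟩ := hj
  simp only [Prod.mk.injEq] at he
  obtain ⟨rfl, rfl⟩ := he
  exact ⟨n, p, hn, hx, rfl⟩

theorem JSeq.length_sub {s : JSeq M} {L : List ℕ} (h : ∀ i ∈ L, i < s.length) :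
    (s.sub L).length = L.length := by
  unfold JSeq.sub
  induction L with
  | nil => simp
  | cons a L ih =>
    rw [List.length_filterMap_eq_countP, List.countP_eq_length]
    intro i hi
    simp [h i hi]

/-- Dropping pointers in two stages loses nothing: a target that survives both selections has an
index in `L`, and that index has an index in `J`. Distinctness of the entries of `L` makes the two
lookups agree with the single one. -/
theorem JSeq.sub_map {s : JSeq M} {L J : List ℕ} (h : ∀ i ∈ L, i < s.length) (hL : L.Nodup)
    (hJ : ∀ j ∈ J, j < L.length) : s.sub (J.map (L.getD · 0)) = (s.sub L).sub J := by
  have hget : ∀ j ∈ J, L[j]? = some (L.getD j 0) := by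
    intro j hj
    simp [List.getD, hJ j hj]
  have h1 : ∀ i ∈ J.map (L.getD · 0), i < s.length := by
    intro i hi
    obtain ⟨j, hj, rfl⟩ := List.mem_map.1 hi
    exact h _ (List.mem_of_getElem? (hget j hj))
  have h2 : ∀ i ∈ J, i < (s.sub L).length := by
    rw [JSeq.length_sub h]; exact hJ
  have key : ∀ k, (J.map (L.getD · 0)).idxOf? k = (L.idxOf? k).bind fun i => J.idxOf? i := by
    intro k
    clear h1 h2
    induction J with
    | nil => cases L.idxOf? k <;> simp
    | cons a J ih =>
      rw [List.map_cons, List.idxOf?_cons, ih (fun j hj => hJ j (by simp [hj]))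
        (fun j hj => hget j (by simp [hj]))]
      have ha := hget a (by simp)
      by_cases hk : L.getD a 0 = k
      · subst hk
        rw [(idxOf?_eq_some_of_nodup hL).2 ha]
        simp [List.idxOf?_cons]
      · cases hi : L.idxOf? k with
        | none =>
          simp only [Option.bind_none, beq_iff_eq, hk, if_false]
          rfl
        | some i =>
          have hi' := (idxOf?_eq_some_of_nodup hL).1 hi
          have : a ≠ i := by
            rintro rfl
            rw [ha] at hi'
            exact hk (by simpa using hi')
          simp only [beq_iff_eq, hk, if_false, Option.bind_some, List.idxOf?_cons, this]
  apply List.ext_getElem?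
  intro j
  rw [JSeq.getElem?_sub h1, JSeq.getElem?_sub h2, List.getElem?_map]
  cases hj : J[j]? with
  | none => simp
  | some i =>
    simp only [Option.map_some, Option.bind_some]
    have hi := hget i (List.mem_of_getElem? hj)
    rw [JSeq.getElem?_sub h, hi]
    simp only [Option.bind_some, Option.map_map]
    congr 1
    funext x
    simp only [Function.comp, Prod.mk.injEq, true_and]
    cases x.2 with
    | none => simp
    | some k => simpa using key k

theorem JSeq.sub_append_left {s t : JSeq M} {L : List ℕ} (h : ∀ i ∈ L, i < s.length) :
    JSeq.sub (s ++ t) L = s.sub L := by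
  unfold JSeq.sub
  apply List.filterMap_congr
  intro i hi
  rw [List.getElem?_append_left (h i hi)]

theorem JSeq.sub_take {s : JSeq M} {L : List ℕ} {n : ℕ} (h : ∀ i ∈ L, i < n) :
    JSeq.sub (s.take n) L = s.sub L := by
  unfold JSeq.sub
  apply List.filterMap_congr
  intro i hi
  rw [List.getElem?_take_of_lt (h i hi)]

theorem JSeq.map_sub {s : JSeq M} (f : M → N) {L : List ℕ} :
    JSeq.sub (s.map (Prod.map f id)) L = (s.sub L).map (Prod.map f id) := by
  unfold JSeq.sub
  rw [List.map_filterMap]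
  apply List.filterMap_congr
  intro i hi
  simp only [List.getElem?_map, Option.map_map]
  rfl

theorem idxOf?_append_of_ne {L : List ℕ} {k n : ℕ} (h : k ≠ n) :
    (L ++ [n]).idxOf? k = L.idxOf? k := by
  induction L with
  | nil => simp [List.idxOf?_cons, Ne.symm h]
  | cons a L ih => rw [List.cons_append, List.idxOf?_cons, List.idxOf?_cons, ih]

/-- In a sequence all pointers point backwards. -/
def JSeq.Backward (s : JSeq M) : Prop := ∀ (i : ℕ) (m : M) (k : ℕ), s[i]? = some (m, some k) → k < i

/-- Pointers go backwards, so no earlier occurrence, nor the last one itself, can point at the added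
position; the pointers already computed stay as they are. -/
theorem JSeq.sub_concat {s : JSeq M} (hs : s.Backward) {L : List ℕ} {n : ℕ}
    (hL : ∀ i ∈ L, i < n) {m : M} {p : Option ℕ} (hn : s[n]? = some (m, p)) :
    s.sub (L ++ [n]) = s.sub L ++ [(m, p.bind fun k => L.idxOf? k)] := by
  unfold JSeq.sub
  rw [List.filterMap_append]
  congr 1
  · apply List.filterMap_congr
    intro i hi
    cases hx : s[i]? with
    | none => rfl
    | some x =>
      obtain ⟨m', p'⟩ := x
      cases p' with
      | none => rfl
      | some k =>
        have := hs i m' k hx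
        have := hL i hi
        simp [idxOf?_append_of_ne (show k ≠ n by omega)]
  · rw [List.filterMap_cons_some (b := (m, p.bind fun k => L.idxOf? k))]
    · rfl
    · rw [hn]
      cases p with
      | none => rfl
      | some k =>
        have := hs n m k hn
        simp [idxOf?_append_of_ne (show k ≠ n by omega)]

theorem JSeq.sub_range {s : JSeq M} (hs : s.Backward) {n : ℕ} (hn : n ≤ s.length) :
    s.sub (List.range n) = s.take n := by
  have hr : ∀ i ∈ List.range n, i < s.length := by
    intro i hi; simp at hi; omega
  apply List.ext_getElem?
  intro j
  rw [JSeq.getElem?_sub hr]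
  by_cases hj : j < n
  · rw [List.getElem?_range hj, List.getElem?_take_of_lt hj]
    cases hx : s[j]? with
    | none => simp [hx]
    | some x =>
      obtain ⟨m, p⟩ := x
      cases p with
      | none => simp [hx]
      | some k =>
        have := hs j m k hx
        simp only [Option.bind_some, hx, Option.map_some]
        congr 2
        rw [idxOf?_eq_some_of_nodup List.nodup_range, List.getElem?_range (by omega)]
  · rw [List.getElem?_eq_none (by simp; omega), List.getElem?_eq_none (by simp; omega)]
    rfl

theorem JSeq.Backward.take {s : JSeq M} (hs : s.Backward) (n : ℕ) : JSeq.Backward (s.take n) := by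
  intro i m k h
  rw [List.getElem?_take] at h
  split at h
  · exact hs i m k h
  · simp at h

/-! ### Views -/

/-- Length of the prefix from which a view continues below position `n`: occurrences satisfying
`inp` continue below their justifier, the others at the preceding occurrence. -/
def prd (inp : M → Bool) (s : JSeq M) (n : ℕ) : ℕ :=
  match s[n]? with
  | none => 0
  | some (m, p) => if inp m then (match p with | none => 0 | some k => k + 1) else n

theorem prd_of_not {inp : M → Bool} {s : JSeq M} {n : ℕ} {m : M} {p : Option ℕ}
    (h : s[n]? = some (m, p)) (hm : inp m = false) : prd inp s n = n := by
  simp [prd, h, hm]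

theorem prd_none {inp : M → Bool} {s : JSeq M} {n : ℕ} {m : M}
    (h : s[n]? = some (m, none)) (hm : inp m = true) : prd inp s n = 0 := by
  simp [prd, h, hm]

theorem prd_some {inp : M → Bool} {s : JSeq M} {n k : ℕ} {m : M}
    (h : s[n]? = some (m, some k)) (hm : inp m = true) : prd inp s n = k + 1 := by
  simp [prd, h, hm]

theorem prd_congr {inp : M → Bool} {s t : JSeq M} {n : ℕ} (h : s[n]? = t[n]?) :
    prd inp s n = prd inp t n := by
  simp [prd, h]

theorem prd_le {inp : M → Bool} {s : JSeq M} (hs : s.Backward) (n : ℕ) : prd inp s n ≤ n := by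
  unfold prd
  split
  · omega
  · rename_i m p h
    split
    · cases p with
      | none => simp
      | some k => exact hs n m k h
    · rfl

/-- The positions of the view of the prefix of length `n`. -/
def vchain (inp : M → Bool) (s : JSeq M) (n : ℕ) : List ℕ := chain (prd inp s) n

/-- The view of the prefix of length `n`. -/
def vseq (inp : M → Bool) (s : JSeq M) (n : ℕ) : JSeq M := s.sub (vchain inp s n)

@[simp] theorem vchain_zero (inp : M → Bool) (s : JSeq M) : vchain inp s 0 = [] := chain_zero _

@[simp] theorem vseq_zero (inp : M → Bool) (s : JSeq M) : vseq inp s 0 = [] := by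
  simp [vseq, JSeq.sub]

theorem vchain_lt {inp : M → Bool} {s : JSeq M} {n : ℕ} (hn : n ≤ s.length) :
    ∀ i ∈ vchain inp s n, i < s.length := by
  intro i hi
  have := lt_of_mem_chain hi
  omega

theorem vchain_sorted (inp : M → Bool) (s : JSeq M) (n : ℕ) :
    (vchain inp s n).Pairwise (· < ·) := chain_sorted _ _

theorem vchain_take {inp : M → Bool} {s : JSeq M} {n k : ℕ} (h : n ≤ k) :
    vchain inp (s.take k) n = vchain inp s n := by
  apply chain_congr
  intro j hj
  apply prd_congr
  rw [List.getElem?_take_of_lt (by omega)]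

theorem vchain_append {inp : M → Bool} {s t : JSeq M} {n : ℕ} (h : n ≤ s.length) :
    vchain inp (s ++ t) n = vchain inp s n := by
  apply chain_congr
  intro j hj
  apply prd_congr
  rw [List.getElem?_append_left (by omega)]

theorem vseq_take {inp : M → Bool} {s : JSeq M} {n k : ℕ} (h : n ≤ k) :
    vseq inp (s.take k) n = vseq inp s n := by
  rw [vseq, vchain_take h, JSeq.sub_take, vseq]
  intro i hi
  have := lt_of_mem_chain hi
  omega

theorem vseq_append {inp : M → Bool} {s t : JSeq M} {n : ℕ} (h : n ≤ s.length) :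
    vseq inp (s ++ t) n = vseq inp s n := by
  rw [vseq, vchain_append h, JSeq.sub_append_left, vseq]
  exact vchain_lt h

theorem vchain_succ {inp : M → Bool} {s : JSeq M} (hs : s.Backward) (n : ℕ) :
    vchain inp s (n + 1) = vchain inp s (prd inp s n) ++ [n] := chain_succ (prd_le hs n)

theorem vseq_succ {inp : M → Bool} {s : JSeq M} (hs : s.Backward) {n : ℕ} {m : M} {p : Option ℕ}
    (h : s[n]? = some (m, p)) :
    vseq inp s (n + 1) = vseq inp s (prd inp s n) ++
      [(m, p.bind fun k => (vchain inp s (prd inp s n)).idxOf? k)] := by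
  rw [vseq, vchain_succ hs, JSeq.sub_concat hs _ h, vseq]
  intro i hi
  have := lt_of_mem_chain hi
  have := prd_le (inp := inp) hs n
  omega

theorem length_vseq {inp : M → Bool} {s : JSeq M} {n : ℕ} (h : n ≤ s.length) :
    (vseq inp s n).length = (vchain inp s n).length := JSeq.length_sub (vchain_lt h)

theorem vseq_eq_nil {inp : M → Bool} {s : JSeq M} {n : ℕ} (h : n ≤ s.length) :
    vseq inp s n = [] ↔ n = 0 := by
  constructor
  · intro h1
    rcases Nat.eq_zero_or_pos n with h0 | h0
    · exact h0
    · obtain ⟨k, rfl⟩ : ∃ k, n = k + 1 := ⟨n - 1, by omega⟩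
      have h2 := length_vseq (inp := inp) h
      have h3 := length_chain_succ_pos (prd inp s) k
      rw [h1] at h2
      simp only [List.length_nil, vchain] at h2
      omega
  · rintro rfl
    simp

theorem vchain_map_labels {inp : N → Bool} {f : M → N} {s : JSeq M} (n : ℕ) :
    vchain inp (s.map (Prod.map f id)) n = vchain (inp ∘ f) s n := by
  apply chain_congr
  intro j _
  unfold prd
  rw [List.getElem?_map]
  cases s[j]? <;> simp

theorem vseq_map_labels {inp : N → Bool} {f : M → N} {s : JSeq M} (n : ℕ) :
    vseq inp (s.map (Prod.map f id)) n = (vseq (inp ∘ f) s n).map (Prod.map f id) := by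
  rw [vseq, vchain_map_labels, JSeq.map_sub, vseq]

/-- Views computed inside a subsequence that is closed under the relevant predecessors. -/
theorem vchain_sub {inp : M → Bool} {s : JSeq M} (hs : s.Backward) {L : List ℕ}
    (hL : L.Pairwise (· < ·)) (hr : ∀ i ∈ L, i < s.length) (Q : ℕ → Prop)
    (hc : ∀ n ∈ L, Q n → ∀ m p, s[n]? = some (m, p) →
      (inp m = true → ∀ k, p = some k → k ∈ L ∧ Q k) ∧
      (inp m = false → ∀ k, n = k + 1 → k ∈ L ∧ Q k))
    {j n : ℕ} (hj : L[j]? = some n) (hQ : Q n) :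
    vchain inp s (n + 1) = (vchain inp (s.sub L) (j + 1)).map (L.getD · 0) := by
  refine chain_eq_map L _ _ Q ?_ j n hj hQ
  clear hQ hj n j
  intro j n hj hQ
  have hn := List.mem_of_getElem? hj
  obtain ⟨⟨m, p⟩, hx⟩ : ∃ x, s[n]? = some x := ⟨_, List.getElem?_eq_getElem (hr n hn)⟩
  have hw := JSeq.getElem?_sub_of hr hj hx
  obtain ⟨h1, h2⟩ := hc n hn hQ m p hx
  cases hm : inp m with
  | true =>
    cases p with
    | none =>
      left
      exact ⟨prd_none hx hm, prd_none hw hm⟩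
    | some k =>
      obtain ⟨hk, hQk⟩ := h1 hm k rfl
      obtain ⟨i, hi⟩ := exists_getElem?_of_mem hk
      have hkn := hs n m k hx
      right
      refine ⟨i, k, idx_lt_of_sorted hL hi hj hkn, hkn, hi, hQk, prd_some hx hm, ?_⟩
      apply prd_some (m := m) _ hm
      rw [hw]
      simpa using (idxOf?_eq_some_of_nodup (nodup_of_sorted hL)).2 hi
  | false =>
    rw [prd_of_not hx hm, prd_of_not hw hm]
    cases n with
    | zero =>
      left
      refine ⟨rfl, ?_⟩
      -- A sorted list that contains position `0` has it at index `0`.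
      by_contra h0
      obtain ⟨hlt, _⟩ := List.getElem?_eq_some_iff.1 hj
      have h3 : L[0]? = some L[0] := List.getElem?_eq_getElem (by omega)
      have := lt_of_sorted hL h3 hj (by omega)
      omega
    | succ k =>
      obtain ⟨hk, hQk⟩ := h2 hm k rfl
      obtain ⟨i, hi⟩ := exists_getElem?_of_mem hk
      right
      have := adjacent_of_sorted hL hi hj
      exact ⟨i, k, by omega, by omega, hi, hQk, rfl, this⟩

/-- `Q` is an invariant along the view: closure of `L` under predecessors is demanded only at
positions where `Q` holds. A view that avoids part of `L` can then be computed in `L` even if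
closure fails on the avoided part. -/
theorem vseq_sub {inp : M → Bool} {s : JSeq M} (hs : s.Backward) {L : List ℕ}
    (hL : L.Pairwise (· < ·)) (hr : ∀ i ∈ L, i < s.length) (Q : ℕ → Prop)
    (hc : ∀ n ∈ L, Q n → ∀ m p, s[n]? = some (m, p) →
      (inp m = true → ∀ k, p = some k → k ∈ L ∧ Q k) ∧
      (inp m = false → ∀ k, n = k + 1 → k ∈ L ∧ Q k))
    {j n : ℕ} (hj : L[j]? = some n) (hQ : Q n) :
    vseq inp s (n + 1) = vseq inp (s.sub L) (j + 1) := by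
  rw [vseq, vchain_sub hs hL hr Q hc hj hQ, JSeq.sub_map hr (nodup_of_sorted hL), vseq]
  intro i hi
  have := lt_of_mem_chain hi
  obtain ⟨h, _⟩ := List.getElem?_eq_some_iff.1 hj
  omega

end Sub

/-! ### Plays -/

theorem getElem?_chain_zero {pr : ℕ → ℕ} {n x : ℕ} (h : (chain pr n)[0]? = some x)
    (hx : pr x ≤ x) : pr x = 0 := by
  have h1 := getElem?_chain_prefix h
  rw [chain_succ hx] at h1
  have h2 := congrArg List.length h1
  simp only [List.length_append, List.length_singleton, List.length_take] at h2
  rcases Nat.eq_zero_or_pos (pr x) with h0 | h0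
  · exact h0
  · obtain ⟨k, hk⟩ : ∃ k, pr x = k + 1 := ⟨pr x - 1, by omega⟩
    have := length_chain_succ_pos pr k
    rw [← hk] at this
    omega

/-- Reads a view from left to right: the left neighbour of an element is the position to which the
chain stepped from it. -/
theorem getElem?_chain_succ {pr : ℕ → ℕ} {n j x : ℕ} (h : (chain pr n)[j + 1]? = some x)
    (hx : pr x ≤ x) : ∃ y, (chain pr n)[j]? = some y ∧ pr x = y + 1 := by
  have h1 := getElem?_chain_prefix h
  rw [chain_succ hx] at h1
  obtain ⟨hlt, _⟩ := List.getElem?_eq_some_iff.1 h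
  have h2 := congrArg List.length h1
  simp only [List.length_append, List.length_singleton, List.length_take] at h2
  rcases Nat.eq_zero_or_pos (pr x) with h0 | h0
  · rw [h0, chain_zero, List.length_nil] at h2
    omega
  · obtain ⟨k, hk⟩ : ∃ k, pr x = k + 1 := ⟨pr x - 1, by omega⟩
    refine ⟨k, ?_, hk⟩
    have h3 := getElem?_chain_last pr k
    rw [← hk] at h3
    have h4 : (chain pr (pr x)).length - 1 = j := by omega
    rw [h4] at h3
    have h5 : (chain pr n)[j]? = ((chain pr n).take (j + 1 + 1))[j]? := by
      rw [List.getElem?_take_of_lt (by omega)]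
    rw [h5, ← h1, List.getElem?_append_left (by omega), h3]

namespace Arena

/-- The moves of a given player. -/
def isBy (A : Arena.{u}) (π : Player) (m : A.Move) : Bool := A.player m = π

@[simp] theorem isBy_eq_true {A : Arena.{u}} {π : Player} {m : A.Move} :
    A.isBy π m = true ↔ A.player m = π := by simp [isBy]

@[simp] theorem isBy_eq_false {A : Arena.{u}} {π : Player} {m : A.Move} :
    A.isBy π m = false ↔ A.player m ≠ π := by simp [isBy]

variable {A : Arena.{u}} {s t : JSeq A.Move}

/-- Sequences in which the pointers point backwards to enabling moves. -/
structure Justified (A : Arena.{u}) (s : JSeq A.Move) : Prop where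
  initial_of_none : ∀ (i : ℕ) (m : A.Move), s[i]? = some (m, none) → A.initial m
  justified : ∀ (i : ℕ) (m : A.Move) (k : ℕ), s[i]? = some (m, some k) →
    k < i ∧ ∃ x, s[k]? = some x ∧ A.enables x.1 m

theorem IsLegal.toJustified (h : A.IsLegal s) : A.Justified s := ⟨h.1, h.2⟩

theorem Justified.backward (h : A.Justified s) : s.Backward :=
  fun i m k hi => (h.justified i m k hi).1

theorem IsLegal.backward (h : A.IsLegal s) : s.Backward := h.toJustified.backward

/-- The defining recursion adds a justifier and continues below it, whereas the chain merely steps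
to the justifier. They agree because a justifier belongs to the other player, so that the next step
of the chain goes to the position just before it. -/
theorem Justified.pviewIdx_eq (h : A.Justified s) {n : ℕ} (hn : n ≤ s.length) :
    A.pviewIdx s n = vchain (A.isBy .O) s n := by
  induction n using Nat.strong_induction_on with
  | _ n ih =>
    cases n with
    | zero => simp [pviewIdx]
    | succ n =>
      obtain ⟨⟨m, p⟩, hx⟩ : ∃ x, s[n]? = some x := ⟨_, List.getElem?_eq_getElem (by omega)⟩
      rw [vchain_succ h.backward, pviewIdx, hx]
      cases hm : A.player m with
      | P =>
        rw [prd_of_not hx (by simp [hm])]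
        simp only [hm]
        rw [ih n (by omega) (by omega)]
      | O =>
        cases p with
        | none =>
          rw [prd_none hx (by simp [hm])]
          simp [hm]
        | some k =>
          obtain ⟨hk, ⟨m', p'⟩, hx', he⟩ := h.justified n m k hx
          rw [prd_some hx (by simp [hm])]
          have hm' : A.player m' ≠ .O := by
            have := A.enables_player _ _ he
            rwa [hm] at this
          simp only [hm, hk, if_true]
          rw [vchain_succ h.backward, prd_of_not hx' (by simp [hm']), ih k (by omega) (by omega)]
          simp

/-- The same comparison for the other player. The recursion gives an empty view after an unjustified
P-move; that case does not arise, since unjustified moves are initial and so belong to O. -/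
theorem Justified.oviewIdx_eq (h : A.Justified s) {n : ℕ} (hn : n ≤ s.length) :
    A.oviewIdx s n = vchain (A.isBy .P) s n := by
  induction n using Nat.strong_induction_on with
  | _ n ih =>
    cases n with
    | zero => simp [oviewIdx]
    | succ n =>
      obtain ⟨⟨m, p⟩, hx⟩ : ∃ x, s[n]? = some x := ⟨_, List.getElem?_eq_getElem (by omega)⟩
      rw [vchain_succ h.backward, oviewIdx, hx]
      cases hm : A.player m with
      | O =>
        rw [prd_of_not hx (by simp [hm])]
        simp only [hm]
        rw [ih n (by omega) (by omega)]
      | P =>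
        cases p with
        | none =>
          have := A.initial_player m (h.initial_of_none n m hx)
          rw [hm] at this
          cases this
        | some k =>
          obtain ⟨hk, ⟨m', p'⟩, hx', he⟩ := h.justified n m k hx
          rw [prd_some hx (by simp [hm])]
          have hm' : A.player m' ≠ .P := by
            have := A.enables_player _ _ he
            rwa [hm] at this
          simp only [hm, hk, if_true]
          rw [vchain_succ h.backward, prd_of_not hx' (by simp [hm']), ih k (by omega) (by omega)]
          simp

theorem IsLegal.visible (h : A.IsLegal s) {π : Player} {i k : ℕ} {m : A.Move}
    (hx : s[i]? = some (m, some k)) (hm : A.player m ≠ π) : k ∈ vchain (A.isBy π) s i := by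
  have hi : i ≤ s.length := by
    obtain ⟨h, _⟩ := List.getElem?_eq_some_iff.1 hx; omega
  cases π with
  | O =>
    rw [← h.toJustified.pviewIdx_eq hi]
    apply h.visible_P i m k hx
    cases hp : A.player m <;> simp_all
  | P =>
    rw [← h.toJustified.oviewIdx_eq hi]
    apply h.visible_O i m k hx
    cases hp : A.player m <;> simp_all

theorem IsLegal.of_visible (h : A.Justified s)
    (halt : ∀ (i : ℕ) (x y : A.Move × Option ℕ), s[i]? = some x →
      s[i + 1]? = some y → A.player x.1 ≠ A.player y.1)
    (hv : ∀ (π : Player) (i : ℕ) (m : A.Move) (k : ℕ), s[i]? = some (m, some k) →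
      A.player m ≠ π → k ∈ vchain (A.isBy π) s i) : A.IsLegal s where
  initial_of_none := h.1
  justified := h.2
  alternating := halt
  visible_P i m k hx hm := by
    have hi : i ≤ s.length := by
      obtain ⟨h, _⟩ := List.getElem?_eq_some_iff.1 hx; omega
    rw [h.pviewIdx_eq hi]
    exact hv _ i m k hx (by simp [hm])
  visible_O i m k hx hm := by
    have hi : i ≤ s.length := by
      obtain ⟨h, _⟩ := List.getElem?_eq_some_iff.1 hx; omega
    rw [h.oviewIdx_eq hi]
    exact hv _ i m k hx (by simp [hm])

theorem isLegal_nil : A.IsLegal ([] : JSeq A.Move) := by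
  constructor <;> simp

theorem IsLegal.take (h : A.IsLegal s) (n : ℕ) : A.IsLegal (s.take n) := by
  have key : ∀ {i : ℕ} {x}, (s.take n)[i]? = some x → i < n ∧ s[i]? = some x := by
    intro i x hx
    rw [List.getElem?_take] at hx
    split at hx
    · exact ⟨by assumption, hx⟩
    · simp at hx
  apply IsLegal.of_visible
  · constructor
    · intro i m hx
      exact h.1 i m (key hx).2
    · intro i m k hx
      obtain ⟨h1, x, h2, h3⟩ := h.2 i m k (key hx).2
      refine ⟨h1, x, ?_, h3⟩
      have := (key hx).1
      rw [List.getElem?_take_of_lt (by omega), h2]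
  · intro i x y hx hy
    exact h.alternating i x y (key hx).2 (key hy).2
  · intro π i m k hx hm
    rw [vchain_take (key hx).1.le]
    exact h.visible (key hx).2 hm

theorem IsLegal.of_append (h : A.IsLegal (s ++ t)) : A.IsLegal s := by
  have := h.take s.length
  simpa using this

theorem IsLegal.prefix (h : A.IsLegal t) (hs : s <+: t) : A.IsLegal s := by
  obtain ⟨u, rfl⟩ := hs
  exact h.of_append

theorem IsLegal.concat (h : A.IsLegal s) {m : A.Move} {p : Option ℕ}
    (hi : p = none → A.initial m)
    (hj : ∀ k, p = some k → ∃ y, s[k]? = some y ∧ A.enables y.1 m)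
    (halt : ∀ i y, s.length = i + 1 → s[i]? = some y → A.player y.1 ≠ A.player m)
    (hv : ∀ π k, p = some k → A.player m ≠ π → k ∈ vchain (A.isBy π) s s.length) :
    A.IsLegal (s ++ [(m, p)]) := by
  have key : ∀ {i : ℕ} {x}, (s ++ [(m, p)])[i]? = some x →
      (i < s.length ∧ s[i]? = some x) ∨ (i = s.length ∧ x = (m, p)) := by
    intro i x hx
    rcases lt_trichotomy i s.length with h1 | h1 | h1
    · rw [List.getElem?_append_left h1] at hx
      exact Or.inl ⟨h1, hx⟩
    · subst h1
      rw [List.getElem?_append_right le_rfl] at hx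
      right
      refine ⟨rfl, ?_⟩
      simpa using hx.symm
    · rw [List.getElem?_eq_none (by simp; omega)] at hx
      cases hx
  apply IsLegal.of_visible
  · constructor
    · intro i m' hx
      rcases key hx with ⟨h1, h2⟩ | ⟨h1, h2⟩
      · exact h.1 i m' h2
      · simp only [Prod.mk.injEq] at h2
        obtain ⟨rfl, h2⟩ := h2
        exact hi h2.symm
    · intro i m' k hx
      rcases key hx with ⟨h1, h2⟩ | ⟨h1, h2⟩
      · obtain ⟨h3, x, h4, h5⟩ := h.2 i m' k h2
        refine ⟨h3, x, ?_, h5⟩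
        rw [List.getElem?_append_left (by omega), h4]
      · simp only [Prod.mk.injEq] at h2
        obtain ⟨rfl, h2⟩ := h2
        obtain ⟨y, hy, he⟩ := hj k h2.symm
        obtain ⟨hlt, _⟩ := List.getElem?_eq_some_iff.1 hy
        refine ⟨by omega, y, ?_, he⟩
        rw [List.getElem?_append_left (by omega), hy]
  · intro i x y hx hy
    rcases key hx with ⟨h1, h2⟩ | ⟨h1, h2⟩ <;> rcases key hy with ⟨h3, h4⟩ | ⟨h3, h4⟩
    · exact h.alternating i x y h2 h4
    · subst h4
      exact halt i x h3.symm h2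
    · omega
    · omega
  · intro π i m' k hx hm
    rcases key hx with ⟨h1, h2⟩ | ⟨h1, h2⟩
    · rw [vchain_append h1.le]
      exact h.visible h2 hm
    · simp only [Prod.mk.injEq] at h2
      obtain ⟨rfl, h2⟩ := h2
      subst h1
      rw [vchain_append le_rfl]
      exact hv π k h2.symm hm

theorem IsLegal.pview_eq (h : A.IsLegal s) : A.pview s = vseq (A.isBy .O) s s.length := by
  rw [pview, h.toJustified.pviewIdx_eq le_rfl, vseq]

theorem IsLegal.oview_eq (h : A.IsLegal s) : A.oview s = vseq (A.isBy .P) s s.length := by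
  rw [oview, h.toJustified.oviewIdx_eq le_rfl, vseq]

theorem IsLegal.pview_take (h : A.IsLegal s) {n : ℕ} (hn : n ≤ s.length) :
    A.pview (s.take n) = vseq (A.isBy .O) s n := by
  rw [(h.take n).pview_eq, List.length_take, min_eq_left hn, vseq_take le_rfl]

theorem IsLegal.oview_take (h : A.IsLegal s) {n : ℕ} (hn : n ≤ s.length) :
    A.oview (s.take n) = vseq (A.isBy .P) s n := by
  rw [(h.take n).oview_eq, List.length_take, min_eq_left hn, vseq_take le_rfl]

/-- The first move cannot point backwards, so it is initial and belongs to O; alternation does the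
rest. Parity of positions stands for the player from here on. -/
theorem IsLegal.player_even (h : A.IsLegal s) {i : ℕ} {x : A.Move × Option ℕ}
    (hx : s[i]? = some x) : A.player x.1 = if Even i then .O else .P := by
  induction i generalizing x with
  | zero =>
    obtain ⟨m, p⟩ := x
    cases p with
    | none => simpa using A.initial_player m (h.1 0 m hx)
    | some k => exact absurd (h.2 0 m k hx).1 (by omega)
  | succ i ih =>
    have hlt : i + 1 < s.length := (List.getElem?_eq_some_iff.1 hx).1
    have h1 : s[i]? = some s[i] := List.getElem?_eq_getElem (by omega)
    have h2 := ih h1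
    have h3 := h.alternating i _ _ h1 hx
    rw [h2] at h3
    by_cases he : Even i
    · rw [if_pos he] at h3
      rw [if_neg (by rw [Nat.even_add_one]; simpa using he)]
      cases hp : A.player x.1 <;> simp_all
    · rw [if_neg he] at h3
      rw [if_pos (by rw [Nat.even_add_one]; exact he)]
      cases hp : A.player x.1 <;> simp_all

theorem IsLegal.even_of_O (h : A.IsLegal s) {i : ℕ} {x : A.Move × Option ℕ}
    (hx : s[i]? = some x) : A.player x.1 = .O ↔ Even i := by
  rw [h.player_even hx]
  split <;> simp_all

theorem IsLegal.odd_of_P (h : A.IsLegal s) {i : ℕ} {x : A.Move × Option ℕ}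
    (hx : s[i]? = some x) : A.player x.1 = .P ↔ Odd i := by
  rw [h.player_even hx, ← Nat.not_even_iff_odd]
  split <;> simp_all

theorem IsLegal.exists_ptr_of_P (h : A.IsLegal s) {i : ℕ} {m : A.Move} {p : Option ℕ}
    (hx : s[i]? = some (m, p)) (hm : A.player m = .P) : ∃ k, p = some k := by
  cases p with
  | some k => exact ⟨k, rfl⟩
  | none =>
    have := A.initial_player m (h.1 i m hx)
    rw [hm] at this
    cases this

/-- Views are closed under pointers. -/
theorem IsLegal.view_closed (h : A.IsLegal s) {π : Player} {n x k : ℕ} {m : A.Move}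
    (hx : x ∈ vchain (A.isBy π) s n) (hm : s[x]? = some (m, some k)) :
    k ∈ vchain (A.isBy π) s n := by
  have hk := h.backward x m k hm
  by_cases hp : A.player m = π
  · exact chain_pred_mem hx (prd_some hm (by simp [hp])) hk
  · apply mem_chain_trans hx
    change k ∈ vchain _ s (x + 1)
    rw [vchain_succ h.backward, prd_of_not hm (by simp [hp])]
    exact List.mem_append_left _ (h.visible hm hp)

theorem IsLegal.vseq_last (h : A.IsLegal s) {inp : A.Move → Bool} {n : ℕ} {m : A.Move}
    {p : Option ℕ} (hx : s[n]? = some (m, p)) (hm : inp m = false) :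
    vseq inp s (n + 1) = vseq inp s n ++ [(m, p.bind fun k => (vchain inp s n).idxOf? k)] := by
  rw [vseq_succ h.backward hx, prd_of_not hx hm]

/-- An occurrence is determined by its view and the sequence before it. -/
theorem IsLegal.eq_of_vseq_eq {π : Player} {x y : A.Move × Option ℕ}
    (hx : A.IsLegal (s ++ [x])) (hy : A.IsLegal (s ++ [y])) (hp : A.player x.1 ≠ π)
    (h : vseq (A.isBy π) (s ++ [x]) (s.length + 1) = vseq (A.isBy π) (s ++ [y]) (s.length + 1)) :
    x = y := by
  obtain ⟨m, p⟩ := x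
  obtain ⟨m', p'⟩ := y
  have h1 : (s ++ [(m, p)])[s.length]? = some (m, p) := by simp
  have h2 : (s ++ [(m', p')])[s.length]? = some (m', p') := by simp
  have h3 : A.player m' ≠ π := by
    have e1 := hx.player_even h1
    have e2 := hy.player_even h2
    simp only at e1 e2 hp
    rw [e2, ← e1]
    exact hp
  rw [hx.vseq_last h1 (by simpa using hp), hy.vseq_last h2 (by simpa using h3),
    vseq_append le_rfl, vseq_append le_rfl, vchain_append le_rfl, vchain_append le_rfl] at h
  have h4 := List.append_cancel_left h
  simp only [List.cons.injEq, Prod.mk.injEq, and_true] at h4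
  obtain ⟨rfl, h4⟩ := h4
  congr 1
  have hv : ∀ k, p = some k → k ∈ vchain (A.isBy π) s s.length := by
    rintro k rfl
    have := hx.visible h1 hp
    rwa [vchain_append le_rfl] at this
  have hv' : ∀ k, p' = some k → k ∈ vchain (A.isBy π) s s.length := by
    rintro k rfl
    have := hy.visible h2 h3
    rwa [vchain_append le_rfl] at this
  have hn := nodup_of_sorted (vchain_sorted (A.isBy π) s s.length)
  cases p with
  | none =>
    cases p' with
    | none => rfl
    | some k' => 
      simp only [Option.bind_none, Option.bind_some] at h4
      exact absurd (hv' k' rfl) (List.idxOf?_eq_none_iff.1 h4.symm)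
  | some k =>
    obtain ⟨i, hi⟩ := exists_getElem?_of_mem (hv k rfl)
    rw [Option.bind_some, (idxOf?_eq_some_of_nodup hn).2 hi] at h4
    cases p' with
    | none => simp at h4
    | some k' =>
      rw [Option.bind_some] at h4
      have := (idxOf?_eq_some_of_nodup hn).1 h4.symm
      rw [hi] at this
      simpa using this

/-- Subsequences of plays. -/
theorem IsLegal.sub (h : A.IsLegal s) {L : List ℕ} (hL : L.Pairwise (· < ·))
    (hr : ∀ i ∈ L, i < s.length)
    (hc : ∀ n ∈ L, ∀ m k, s[n]? = some (m, some k) → k ∈ L)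
    (halt : ∀ i n n' x x', L[i]? = some n → L[i + 1]? = some n' → s[n]? = some x →
      s[n']? = some x' → A.player x.1 ≠ A.player x'.1)
    (hv : ∀ (π : Player) (j n : ℕ) (m : A.Move) (k : ℕ), L[j]? = some n →
      s[n]? = some (m, some k) → A.player m ≠ π →
      ∃ i ∈ vchain (A.isBy π) (s.sub L) j, L[i]? = some k) : A.IsLegal (s.sub L) := by
  have hn := nodup_of_sorted hL
  apply IsLegal.of_visible
  · constructor
    · intro i m hx
      obtain ⟨n, p, h1, h2, h3⟩ := JSeq.exists_of_getElem?_sub hr hx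
      cases p with
      | none => exact h.1 n m h2
      | some k =>
        simp only [Option.bind_some] at h3
        exact absurd (hc n (List.mem_of_getElem? h1) m k h2)
          (List.idxOf?_eq_none_iff.1 h3.symm)
    · intro i m k hx
      obtain ⟨n, p, h1, h2, h3⟩ := JSeq.exists_of_getElem?_sub hr hx
      cases p with
      | none => simp at h3
      | some k' =>
        simp only [Option.bind_some] at h3
        have h4 := (idxOf?_eq_some_of_nodup hn).1 h3.symm
        obtain ⟨h5, ⟨m', p'⟩, h6, h7⟩ := h.2 n m k' h2
        exact ⟨idx_lt_of_sorted hL h4 h1 h5, _, JSeq.getElem?_sub_of hr h4 h6, h7⟩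
  · rintro i ⟨m, p⟩ ⟨m', p'⟩ hx hy
    obtain ⟨n, q, h1, h2, -⟩ := JSeq.exists_of_getElem?_sub hr hx
    obtain ⟨n', q', h3, h4, -⟩ := JSeq.exists_of_getElem?_sub hr hy
    exact halt i n n' (m, q) (m', q') h1 h3 h2 h4
  · intro π i m k hx hm
    obtain ⟨n, p, h1, h2, h3⟩ := JSeq.exists_of_getElem?_sub hr hx
    cases p with
    | none => simp at h3
    | some k' =>
      simp only [Option.bind_some] at h3
      have h4 := (idxOf?_eq_some_of_nodup hn).1 h3.symm
      obtain ⟨j, h5, h6⟩ := hv π i n m k' h1 h2 hm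
      rwa [idx_eq_of_sorted hL h4 h6]

/-- A view is its own view. -/
theorem IsLegal.vchain_vseq (h : A.IsLegal s) {π : Player} {n j : ℕ} (hn : n ≤ s.length)
    (hj : j ≤ (vseq (A.isBy π) s n).length) :
    vchain (A.isBy π) (vseq (A.isBy π) s n) j = List.range j := by
  apply chain_eq_range
  intro i hi
  have hr := vchain_lt (inp := A.isBy π) hn
  have hs := vchain_sorted (A.isBy π) s n
  rw [length_vseq hn] at hj
  have h1 : (vchain (A.isBy π) s n)[i]? = some (vchain (A.isBy π) s n)[i] :=
    List.getElem?_eq_getElem (by omega)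
  generalize (vchain (A.isBy π) s n)[i] = x at h1
  obtain ⟨⟨m, p⟩, hx⟩ : ∃ y, s[x]? = some y :=
    ⟨_, List.getElem?_eq_getElem (hr x (List.mem_of_getElem? h1))⟩
  have hw := JSeq.getElem?_sub_of hr h1 hx
  change (vseq (A.isBy π) s n)[i]? = _ at hw
  by_cases hm : A.player m = π
  · cases p with
    | none =>
      rw [prd_none hw (by simp [hm])]
      cases i with
      | zero => rfl
      | succ i =>
        obtain ⟨y, -, hy⟩ := getElem?_chain_succ h1 (prd_le h.backward x)
        rw [prd_none hx (by simp [hm])] at hy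
        omega
    | some k =>
      cases i with
      | zero =>
        have := getElem?_chain_zero h1 (prd_le h.backward x)
        rw [prd_some hx (by simp [hm])] at this
        omega
      | succ i =>
        obtain ⟨y, hy, hy'⟩ := getElem?_chain_succ h1 (prd_le h.backward x)
        rw [prd_some hx (by simp [hm])] at hy'
        obtain rfl : k = y := by omega
        rw [Option.bind_some, (idxOf?_eq_some_of_nodup (nodup_of_sorted hs)).2 hy] at hw
        rw [prd_some hw (by simp [hm])]
  · rw [prd_of_not hw (by simp [hm])]

/-- A view of a play is a play. -/
theorem IsLegal.vseq_isLegal (h : A.IsLegal s) {π : Player} {n : ℕ} (hn : n ≤ s.length) :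
    A.IsLegal (vseq (A.isBy π) s n) := by
  have hr := vchain_lt (inp := A.isBy π) hn
  have hs := vchain_sorted (A.isBy π) s n
  have hl := length_vseq (inp := A.isBy π) hn
  refine h.sub hs hr (fun x hx m k hm => h.view_closed hx hm) ?_ ?_
  · rintro i x x' ⟨m, p⟩ ⟨m', p'⟩ hx hx' hm hm'
    obtain ⟨y, hy, hy'⟩ := getElem?_chain_succ hx' (prd_le h.backward x')
    obtain rfl : x = y := by
      have := hx.symm.trans hy
      simpa using this
    -- Neighbours in a view are either joined by a pointer, and enabling changes the player, or
    -- adjacent in the play.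
    by_cases hp : A.player m' = π
    · cases p' with
      | none =>
        rw [prd_none hm' (by simp [hp])] at hy'
        omega
      | some k =>
        rw [prd_some hm' (by simp [hp])] at hy'
        obtain rfl : k = x := by omega
        obtain ⟨-, z, hz, he⟩ := h.2 x' m' k hm'
        rw [hm] at hz
        obtain rfl : (m, p) = z := by simpa using hz
        exact A.enables_player _ _ he
    · rw [prd_of_not hm' (by simp [hp])] at hy'
      subst hy'
      exact h.alternating x _ _ hm hm'
  · intro π' j x m k hj hx hm
    have hlt : j < (vchain (A.isBy π) s n).length := (List.getElem?_eq_some_iff.1 hj).1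
    have hk := h.view_closed (List.mem_of_getElem? hj) hx
    obtain ⟨i, hi⟩ := exists_getElem?_of_mem hk
    have hij := idx_lt_of_sorted hs hi hj (h.backward x m k hx)
    refine ⟨i, ?_, hi⟩
    -- In a view for `π`, a justified move of `π` comes right after its justifier, which is the last
    -- element of any view at that point. For a move of the other player the view that matters is
    -- the one for `π`, and that is the whole prefix.
    by_cases hp : A.player m = π
    · cases j with
      | zero => omega
      | succ j =>
        obtain ⟨y, hy, hy'⟩ := getElem?_chain_succ hj (prd_le h.backward x)
        rw [prd_some hx (by simp [hp])] at hy'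
        obtain rfl : k = y := by omega
        obtain rfl := idx_eq_of_sorted hs hi hy
        exact mem_chain_self _ _
    · obtain rfl : π = π' := by
        cases π <;> cases π' <;> cases hq : A.player m <;> simp_all
      change i ∈ vchain _ (vseq (A.isBy π) s n) j
      rw [h.vchain_vseq hn (by omega)]
      simpa using hij

theorem IsLegal.vseq_vseq (h : A.IsLegal s) {π : Player} {n : ℕ} (hn : n ≤ s.length) :
    vseq (A.isBy π) (vseq (A.isBy π) s n) (vseq (A.isBy π) s n).length =
      vseq (A.isBy π) s n := by
  conv_lhs => rw [vseq]
  rw [h.vchain_vseq hn le_rfl, JSeq.sub_range (h.vseq_isLegal hn).backward le_rfl, List.take_length]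

end Arena
namespace Arena
variable {A : Arena.{u}} {s t : JSeq A.Move}

/-! ### Strategies -/

theorem exists_concat_of_even {α : Type*} {l : List α} (h : Even l.length) (h0 : l ≠ []) :
    ∃ l' a b, l = l' ++ [a, b] ∧ Even l'.length := by
  rcases List.eq_nil_or_concat l with rfl | ⟨l1, b, rfl⟩
  · exact absurd rfl h0
  · rcases List.eq_nil_or_concat l1 with rfl | ⟨l2, a, rfl⟩
    · simp at h
    · refine ⟨l2, a, b, by simp, ?_⟩
      simp only [List.concat_eq_append, List.length_append, List.length_singleton] at h
      rw [Nat.even_add_one, Nat.even_add_one, not_not] at h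
      exact h

theorem IsStrategy.take_mem {pos σ : Set (JSeq A.Move)} (hσ : A.IsStrategy pos σ)
    (hs : s ∈ σ) {n : ℕ} (hn : Even n) : s.take n ∈ σ := by
  by_cases hle : s.length ≤ n
  · rwa [List.take_of_length_le hle]
  · push Not at hle
    have hs' := hσ.even s hs
    obtain ⟨a, ha⟩ := hn
    obtain ⟨b, hb⟩ := hs'
    induction hk : b - a generalizing s b with
    | zero => omega
    | succ k ih =>
      obtain ⟨s', x, y, rfl, he⟩ := exists_concat_of_even (l := s) ⟨b, hb⟩
        (by rintro rfl; simp at hle)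
      have h1 := hσ.closed _ _ _ hs
      simp only [List.length_append, List.length_cons, List.length_nil] at hb hle
      rw [List.take_append_of_le_length (by omega)]
      by_cases hlt : n < s'.length
      · exact ih h1 hlt (b - 1) (by omega) (by omega)
      · rwa [List.take_of_length_le (by omega)]

theorem IsStrategy.nil_mem {pos σ : Set (JSeq A.Move)} (hσ : A.IsStrategy pos σ) : [] ∈ σ := by
  obtain ⟨s, hs⟩ := hσ.nonempty
  simpa using hσ.take_mem hs (n := 0) (by simp)

theorem IsLegal.pview_concat {a b : A.Move × Option ℕ} (h : A.IsLegal (s ++ [a, b]))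
    (he : Even s.length) : ∃ y, A.pview (s ++ [a, b]) = A.pview (s ++ [a]) ++ [y] := by
  obtain ⟨m, p⟩ := b
  have h1 : (s ++ [a, (m, p)])[s.length + 1]? = some (m, p) := by simp
  have h2 : A.player m = .P := (h.odd_of_P h1).2 he.add_one
  have h3 : A.IsLegal (s ++ [a]) := h.prefix ⟨[(m, p)], by simp⟩
  have h4 := h.vseq_last (inp := A.isBy .O) h1 (by simp [h2])
  rw [h.pview_eq, h3.pview_eq]
  refine ⟨(m, p.bind fun k =>
    (vchain (A.isBy .O) (s ++ [a, (m, p)]) (s.length + 1)).idxOf? k), ?_⟩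
  rw [show (s ++ [a, (m, p)]).length = s.length + 1 + 1 by simp, h4]
  congr 1
  rw [show s ++ [a, (m, p)] = (s ++ [a]) ++ [(m, p)] by simp, vseq_append (by simp)]
  simp

theorem IsLegal.eq_of_pview_eq {a b c : A.Move × Option ℕ} (hb : A.IsLegal (s ++ [a, b]))
    (hc : A.IsLegal (s ++ [a, c])) (he : Even s.length)
    (h : A.pview (s ++ [a, b]) = A.pview (s ++ [a, c])) : b = c := by
  have h1 : (s ++ [a, b])[s.length + 1]? = some b := by simp
  have h2 : A.player b.1 = .P := (hb.odd_of_P h1).2 he.add_one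
  rw [hb.pview_eq, hc.pview_eq] at h
  have e1 : ∀ x, s ++ [a, x] = (s ++ [a]) ++ [x] := fun x => by rw [List.append_assoc]; rfl
  have e2 : ∀ x : A.Move × Option ℕ, (s ++ [a, x]).length = (s ++ [a]).length + 1 := by simp
  rw [e2, e2, e1, e1] at h
  rw [e1] at hb hc
  exact hb.eq_of_vseq_eq hc (π := .O) (by simp [h2]) h

/-- Innocent strategies give equal responses to equal views. -/
theorem IsInnocent.pview_det {pos σ : Set (JSeq A.Move)} (hσ : A.IsInnocent pos σ)
    {a b a' b' : A.Move × Option ℕ} (hpos : t ++ [a'] ∈ pos)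
    (hs : s ++ [a, b] ∈ σ) (ht : t ++ [a', b'] ∈ σ)
    (h : A.pview (s ++ [a]) = A.pview (t ++ [a'])) :
    A.pview (s ++ [a, b]) = A.pview (t ++ [a', b']) := by
  obtain ⟨c, hc, hc'⟩ := hσ.innocent s a b t a' hs (hσ.closed _ _ _ ht) hpos h.symm
  rw [← hc', hσ.deterministic _ _ _ _ hc ht]

theorem prefix_take_pair {α : Type*} {l : List α} {n : ℕ} {a b : α} (ha : l[n]? = some a)
    (hb : l[n + 1]? = some b) : l.take (n + 1 + 1) = l.take n ++ [a, b] := by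
  rw [List.take_add_one, List.take_add_one, ha, hb]
  simp

/-- A play belongs to an innocent strategy as soon as its views are views of the strategy. -/
theorem IsInnocent.mem_of_views {σ : Set (JSeq A.Move)} (hσ : A.IsInnocent A.plays σ)
    (hs : A.IsLegal s) (he : Even s.length)
    (hv : ∀ n, Odd n → n < s.length → A.pview (s.take (n + 1)) ∈ A.pview '' σ) : s ∈ σ := by
  suffices h : ∀ k, 2 * k ≤ s.length → s.take (2 * k) ∈ σ by
    obtain ⟨k, hk⟩ := he
    have := h k (by omega)
    rwa [List.take_of_length_le (by omega)] at this
  intro k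
  induction k with
  | zero => intro _; simpa using hσ.toIsStrategy.nil_mem
  | succ k ih =>
    intro hk
    have h1 := ih (by omega)
    obtain ⟨a, ha⟩ : ∃ a, s[2 * k]? = some a := ⟨_, List.getElem?_eq_getElem (by omega)⟩
    obtain ⟨b, hb⟩ : ∃ b, s[2 * k + 1]? = some b := ⟨_, List.getElem?_eq_getElem (by omega)⟩
    have h2 : s.take (2 * (k + 1)) = s.take (2 * k) ++ [a, b] := prefix_take_pair ha hb
    have hl : (s.take (2 * k)).length = 2 * k := by
      rw [List.length_take]; omega
    have hel : Even (s.take (2 * k)).length := by rw [hl]; exact even_two_mul k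
    obtain ⟨t, ht, hte⟩ := hv (2 * k + 1) ⟨k, rfl⟩ (by omega)
    change A.pview t = A.pview (s.take (2 * (k + 1))) at hte
    rw [h2] at hte ⊢
    have hleg : A.IsLegal (s.take (2 * k) ++ [a, b]) := h2 ▸ hs.take _
    obtain ⟨y, hy⟩ := hleg.pview_concat hel
    have ht0 : t ≠ [] := by
      rintro rfl
      rw [hy, isLegal_nil.pview_eq] at hte
      simp at hte
    obtain ⟨t', a', b', rfl, het⟩ := exists_concat_of_even (hσ.even t ht) ht0
    have hlt : A.IsLegal (t' ++ [a', b']) := hσ.mem_pos _ ht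
    obtain ⟨y', hy'⟩ := hlt.pview_concat het
    rw [hy, hy'] at hte
    have hte' := List.append_inj' hte rfl
    -- Innocence supplies a response with the right view; the view and the play before it determine
    -- the response, so it is `b`.
    obtain ⟨c, hc, hc'⟩ := hσ.innocent t' a' b' _ a ht h1
      (hleg.prefix ⟨[b], by simp⟩) hte'.1.symm
    have hcb := IsLegal.eq_of_pview_eq (hσ.mem_pos _ hc) hleg hel
      (by rw [hc', hy, hy', hte])
    rwa [← hcb]

end Arena

/-! ### Restriction -/

section Restr
variable {M : Type u} {N : Type v}

/-- The positions of the occurrences on which `f` is defined. -/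
def keep (f : M → Option N) (s : JSeq M) : List ℕ :=
  (List.range s.length).filter fun i => ((s[i]?).bind fun x => f x.1).isSome

/-- Restriction to the occurrences on which `f` is defined. -/
def restr (f : M → Option N) (s : JSeq M) : JSeq N :=
  (s.sub (keep f s)).filterMap fun x => (f x.1).map fun m => (m, x.2)

theorem keep_lt {f : M → Option N} {s : JSeq M} : ∀ i ∈ keep f s, i < s.length := by
  intro i hi
  simpa using (List.mem_filter.1 hi).1

theorem keep_concat (f : M → Option N) (s : JSeq M) (x : M × Option ℕ) :
    keep f (s ++ [x]) = keep f s ++ if (f x.1).isSome then [s.length] else [] := by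
  unfold keep
  rw [List.length_append, List.length_singleton, List.range_succ, List.filter_append]
  congr 1
  · apply List.filter_congr
    intro i hi
    rw [List.getElem?_append_left (by simpa using hi)]
  · simp [List.filter_cons]

theorem restr_concat_none {f : M → Option N} {s : JSeq M} {x : M × Option ℕ} (h : f x.1 = none) :
    restr f (s ++ [x]) = restr f s := by
  unfold restr
  rw [keep_concat, h]
  simp only [Option.isSome_none, Bool.false_eq_true, if_false, List.append_nil]
  rw [JSeq.sub_append_left keep_lt]

theorem restr_concat_some {f : M → Option N} {s : JSeq M} {m : M} {n : N} {p : Option ℕ}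
    (hs : JSeq.Backward (s ++ [(m, p)])) (h : f m = some n) :
    restr f (s ++ [(m, p)]) =
      restr f s ++ [(n, p.bind fun k => (keep f s).idxOf? k)] := by
  unfold restr
  rw [keep_concat, h]
  simp only [Option.isSome_some, if_true]
  rw [JSeq.sub_concat hs keep_lt (List.getElem?_concat_length ..),
    JSeq.sub_append_left keep_lt, List.filterMap_append]
  simp [h]

theorem JSeq.Backward.of_append {s t : JSeq M} (h : JSeq.Backward (s ++ t)) : s.Backward := by
  have := h.take s.length
  simpa using this

theorem restr_map_fst {f : M → Option N} {s : JSeq M} (hs : s.Backward) :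
    (restr f s).map Prod.fst = s.filterMap fun x => f x.1 := by
  induction s using List.reverseRecOn with
  | nil => rfl
  | append_singleton s x ih =>
    obtain ⟨m, p⟩ := x
    cases h : f m with
    | none => rw [restr_concat_none h, ih hs.of_append, List.filterMap_append]; simp [h]
    | some n =>
      rw [restr_concat_some hs h, List.map_append, ih hs.of_append, List.filterMap_append]
      simp [h]

end Restr

namespace Arena
variable {A : Arena.{u}} {s t : JSeq A.Move}

/-! ### The arena of tests -/

/-- A move of `A`, as a move of `A → Σ`. -/
def inA (A : Arena.{u}) (m : A.Move) : A.testArena.Move := Sum.inl m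

/-- The question of `Σ`. -/
def qMove (A : Arena.{u}) : A.testArena.Move := Sum.inr SigmaMove.q

/-- The answer of `Σ`. -/
def aMove (A : Arena.{u}) : A.testArena.Move := Sum.inr SigmaMove.a

theorem testMove_cases (m : A.testArena.Move) :
    (∃ a, m = A.inA a) ∨ m = A.qMove ∨ m = A.aMove := by
  rcases m with m | m | m
  · exact Or.inl ⟨m, rfl⟩
  · exact Or.inr (Or.inl rfl)
  · exact Or.inr (Or.inr rfl)

theorem inA_injective : Function.Injective A.inA := fun _ _ h => Sum.inl.inj h

theorem inA_ne_aMove (m : A.Move) : A.inA m ≠ A.aMove := fun h => by cases h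

theorem player_inA (m : A.Move) : A.testArena.player (A.inA m) = (A.player m).flip := rfl

theorem player_qMove : A.testArena.player A.qMove = .O := rfl

theorem player_aMove : A.testArena.player A.aMove = .P := rfl

theorem Player.flip_flip (p : Player) : p.flip.flip = p := by cases p <;> rfl

theorem Player.flip_inj {p q : Player} : p.flip = q.flip ↔ p = q := by
  cases p <;> cases q <;> simp [Player.flip]

/-- Pointers of `s`, as pointers of `q s`. -/
def shiftPtr : Option ℕ → ℕ
  | none => 0
  | some k => k + 1

theorem shiftPtr_injective : Function.Injective shiftPtr := by
  intro p p' h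
  cases p <;> cases p' <;> simp_all [shiftPtr]

theorem embedOcc_mk (m : A.Move) (p : Option ℕ) :
    A.embedOcc (m, p) = (A.inA m, some (shiftPtr p)) := by
  cases p <;> rfl

theorem embedOcc_injective : Function.Injective A.embedOcc := by
  rintro ⟨m, p⟩ ⟨m', p'⟩ h
  rw [embedOcc_mk, embedOcc_mk, Prod.mk.injEq, Option.some.injEq] at h
  rw [inA_injective h.1, shiftPtr_injective h.2]

theorem exists_embedOcc (m : A.Move) (k : ℕ) : ∃ x, A.embedOcc x = (A.inA m, some k) := by
  cases k with
  | zero => exact ⟨(m, none), rfl⟩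
  | succ k => exact ⟨(m, some k), rfl⟩

/-- The final answer of a test. -/
def ansOcc (A : Arena.{u}) : A.testArena.Move × Option ℕ := (A.aMove, some 0)

theorem embedOcc_ne_ansOcc (x : A.Move × Option ℕ) : A.embedOcc x ≠ A.ansOcc := by
  intro h
  rw [embedOcc_mk, ansOcc, Prod.mk.injEq] at h
  exact inA_ne_aMove _ h.1

theorem embed_eq (s : JSeq A.Move) : A.embed s = (A.qMove, none) :: s.map A.embedOcc := rfl

theorem embed_injective : Function.Injective A.embed := by
  intro s t h
  rw [embed_eq, embed_eq, List.cons.injEq] at h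
  exact List.map_injective_iff.2 embedOcc_injective h.2

@[simp] theorem length_embed (s : JSeq A.Move) : (A.embed s).length = s.length + 1 := by
  simp [embed_eq]

theorem embed_append (s t : JSeq A.Move) :
    A.embed (s ++ t) = A.embed s ++ t.map A.embedOcc := by simp [embed_eq]

theorem getElem?_embed_zero (s : JSeq A.Move) :
    (A.embed s)[0]? = some (A.qMove, none) := rfl

theorem getElem?_embed_succ (s : JSeq A.Move) (n : ℕ) :
    (A.embed s)[n + 1]? = (s[n]?).map A.embedOcc := by simp [embed_eq]

theorem embed_take (s : JSeq A.Move) (n : ℕ) :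
    (A.embed s).take (n + 1) = A.embed (s.take n) := by simp [embed_eq]

theorem isBy_inA (π : Player) (m : A.Move) :
    A.testArena.isBy π (A.inA m) = A.isBy π.flip m := by
  unfold isBy
  rw [player_inA]
  cases π <;> cases A.player m <;> rfl

/-- Since the players of `A` are exchanged, the view of `q s` for one player is `q` followed by the
view of `s` for the other. At an unjustified move the view of `s` stops, while in `q s` it goes on
to `q`. -/
theorem vchain_embed (π : Player) {n : ℕ} (hn : n ≤ s.length) :
    vchain (A.testArena.isBy π) (A.embed s) (n + 1) =
      0 :: (vchain (A.isBy π.flip) s n).map (· + 1) := by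
  apply chain_shift
  intro j hj
  obtain ⟨⟨m, p⟩, hx⟩ : ∃ x, s[j]? = some x := ⟨_, List.getElem?_eq_getElem (by omega)⟩
  have hx' : (A.embed s)[j + 1]? = some (A.inA m, some (shiftPtr p)) := by
    rw [getElem?_embed_succ, hx, Option.map_some, embedOcc_mk]
  cases hm : A.isBy π.flip m with
  | true =>
    have hm' := (isBy_inA π m).trans hm
    cases p with
    | none => rw [prd_some hx' hm', prd_none hx hm]; rfl
    | some k => rw [prd_some hx' hm', prd_some hx hm]; rfl
  | false =>
    rw [prd_of_not hx' ((isBy_inA π m).trans hm), prd_of_not hx hm]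

theorem idxOf?_map_succ (L : List ℕ) (k : ℕ) :
    (L.map (· + 1)).idxOf? (k + 1) = L.idxOf? k := by
  induction L with
  | nil => simp
  | cons a L ih =>
    rw [List.map_cons, List.idxOf?_cons, List.idxOf?_cons, ih]
    simp

theorem idxOf?_zero_cons_map_succ {L : List ℕ} {p : Option ℕ} (h : ∀ k, p = some k → k ∈ L) :
    (0 :: L.map (· + 1)).idxOf? (shiftPtr p) = some (shiftPtr (p.bind fun k => L.idxOf? k)) := by
  cases p with
  | none => simp [shiftPtr, List.idxOf?_cons]
  | some k =>
    obtain ⟨i, hi⟩ := Option.isSome_iff_exists.1 (List.isSome_idxOf?.2 (h k rfl))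
    simp [shiftPtr, List.idxOf?_cons, idxOf?_map_succ, hi]

/-- Closure under pointers is essential: an occurrence whose pointer is dropped on the side of `s`
would be made to point at `q` by `embed`, but would have no pointer in the subsequence of `q s`. -/
theorem embed_sub {L : List ℕ} (hr : ∀ i ∈ L, i < s.length)
    (hc : ∀ n ∈ L, ∀ m k, s[n]? = some (m, some k) → k ∈ L) :
    JSeq.sub (A.embed s) (0 :: L.map (· + 1)) = A.embed (s.sub L) := by
  have hr' : ∀ i ∈ 0 :: L.map (· + 1), i < (A.embed s).length := by
    intro i hi
    rw [length_embed]
    rcases List.mem_cons.1 hi with rfl | hi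
    · omega
    · obtain ⟨j, hj, rfl⟩ := List.mem_map.1 hi
      have := hr j hj
      omega
  apply List.ext_getElem?
  intro j
  cases j with
  | zero =>
    rw [JSeq.getElem?_sub_of hr' (n := 0) rfl (getElem?_embed_zero s), getElem?_embed_zero]
    rfl
  | succ j =>
    rw [getElem?_embed_succ]
    cases hj : L[j]? with
    | none => 
      rw [JSeq.getElem?_sub hr, JSeq.getElem?_sub hr', hj]
      simp [hj]
    | some n =>
      have hn := List.mem_of_getElem? hj
      obtain ⟨⟨m, p⟩, hx⟩ : ∃ x, s[n]? = some x := ⟨_, List.getElem?_eq_getElem (hr n hn)⟩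
      have hx' : (A.embed s)[n + 1]? = some (A.inA m, some (shiftPtr p)) := by
        rw [getElem?_embed_succ, hx, Option.map_some, embedOcc_mk]
      rw [JSeq.getElem?_sub_of hr' (n := n + 1) (by simp [hj]) hx',
        JSeq.getElem?_sub_of hr hj hx, Option.map_some, embedOcc_mk, Option.bind_some,
        idxOf?_zero_cons_map_succ]
      rintro k rfl
      exact hc n hn m k hx

theorem vseq_embed (hs : A.IsLegal s) (π : Player) {n : ℕ} (hn : n ≤ s.length) :
    vseq (A.testArena.isBy π) (A.embed s) (n + 1) = A.embed (vseq (A.isBy π.flip) s n) := by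
  rw [vseq, vchain_embed π hn, embed_sub (vchain_lt hn), vseq]
  intro x hx m k hm
  exact hs.view_closed hx hm

theorem isLegal_embed (hs : A.IsLegal s) : A.testArena.IsLegal (A.embed s) := by
  have key : ∀ i x, (A.embed s)[i + 1]? = some x →
      ∃ m p, s[i]? = some (m, p) ∧ x = (A.inA m, some (shiftPtr p)) := by
    intro i x hx
    rw [getElem?_embed_succ, Option.map_eq_some_iff] at hx
    obtain ⟨⟨m, p⟩, h1, h2⟩ := hx
    exact ⟨m, p, h1, by rw [← h2, embedOcc_mk]⟩
  have key0 : ∀ x, (A.embed s)[0]? = some x → x = (A.qMove, none) := by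
    intro x hx
    rw [getElem?_embed_zero] at hx
    exact (Option.some.inj hx).symm
  apply IsLegal.of_visible
  · constructor
    · intro i m hx
      cases i with
      | zero =>
        rw [(Prod.mk.inj (key0 _ hx)).1]
        exact rfl
      | succ i =>
        obtain ⟨m', p, -, h⟩ := key _ _ hx
        cases (Prod.mk.inj h).2
    · intro i m k hx
      cases i with
      | zero => cases (Prod.mk.inj (key0 _ hx)).2
      | succ i =>
        obtain ⟨m', p, hm, h⟩ := key _ _ hx
        obtain ⟨rfl, h'⟩ := Prod.mk.inj h
        obtain rfl := Option.some.inj h'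
        cases p with
        | none => exact ⟨Nat.succ_pos i, _, getElem?_embed_zero s, rfl, hs.1 _ _ hm⟩
        | some k' =>
          obtain ⟨h1, x, h2, h3⟩ := hs.2 _ _ _ hm
          refine ⟨Nat.succ_lt_succ h1, A.embedOcc x, ?_, h3⟩
          change (A.embed s)[k' + 1]? = _
          rw [getElem?_embed_succ, h2]
          rfl
  · intro i x y hx hy
    obtain ⟨m', p', hm', rfl⟩ := key _ _ hy
    cases i with
    | zero =>
      rw [key0 _ hx]
      have := hs.player_even hm'
      simp only [Even.zero, if_true] at this
      simp only [player_qMove, player_inA, this]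
      simp [Player.flip]
    | succ i =>
      obtain ⟨m, p, hm, rfl⟩ := key _ _ hx
      simp only [player_inA, Ne, Player.flip_inj]
      exact hs.alternating i _ _ hm hm'
  · intro π i m k hx hm
    cases i with
    | zero => cases (Prod.mk.inj (key0 _ hx)).2
    | succ i =>
      obtain ⟨m', p, hm', h⟩ := key _ _ hx
      obtain ⟨rfl, h'⟩ := Prod.mk.inj h
      obtain rfl := Option.some.inj h'
      have hi : i ≤ s.length := by
        obtain ⟨h, _⟩ := List.getElem?_eq_some_iff.1 hm'; omega
      rw [vchain_embed π hi]
      cases p with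
      | none => simp [shiftPtr]
      | some k' =>
        have : k' ∈ vchain (A.isBy π.flip) s i := by
          apply hs.visible hm'
          intro h
          apply hm
          rw [player_inA, h, Player.flip_flip]
        simp [shiftPtr, this]

theorem isLegal_embed_ans (hs : A.IsLegal s) (he : Even s.length) :
    A.testArena.IsLegal (A.embed s ++ [A.ansOcc]) := by
  apply (isLegal_embed hs).concat
  · intro h; cases h
  · intro k hk
    obtain rfl := Option.some.inj hk
    exact ⟨_, getElem?_embed_zero s, rfl, rfl⟩
  · intro i y hi hy
    have := (isLegal_embed hs).player_even hy
    rw [length_embed] at hi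
    obtain rfl : i = s.length := by omega
    rw [if_pos he] at this
    rw [this, player_aMove]
    simp
  · intro π k hk _
    obtain rfl := Option.some.inj hk
    rw [length_embed, vchain_embed π le_rfl]
    simp

/-- The moves of `A` among those of `A → Σ`. -/
def leftOf (A : Arena.{u}) : A.testArena.Move → Option A.Move := Sum.getLeft?

/-- The moves of `Σ` among those of `A → Σ`. -/
def rightOf (A : Arena.{u}) : A.testArena.Move → Option SigmaMove := Sum.getRight?

@[simp] theorem leftOf_inA (m : A.Move) : A.leftOf (A.inA m) = some m := rfl
@[simp] theorem leftOf_aMove : A.leftOf A.aMove = none := rfl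
@[simp] theorem rightOf_inA (m : A.Move) : A.rightOf (A.inA m) = none := rfl
@[simp] theorem rightOf_aMove : A.rightOf A.aMove = some .a := rfl

theorem restrictLeft_eq (u : JSeq A.testArena.Move) :
    restrictLeft (B := sigmaArena) u = restr A.leftOf u := rfl

theorem restrictRight_eq (u : JSeq A.testArena.Move) :
    restrictRight (B := sigmaArena) u = restr A.rightOf u := rfl

theorem embed_concat (s : JSeq A.Move) (m : A.Move) (p : Option ℕ) :
    A.embed (s ++ [(m, p)]) = A.embed s ++ [(A.inA m, some (shiftPtr p))] := by
  rw [embed_append, List.map_singleton, embedOcc_mk]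

theorem backward_embed (hs : s.Backward) : (A.embed s).Backward := by
  intro i m k hx
  cases i with
  | zero => cases hx
  | succ i =>
    rw [getElem?_embed_succ, Option.map_eq_some_iff] at hx
    obtain ⟨⟨m', p⟩, h1, h2⟩ := hx
    rw [embedOcc_mk] at h2
    obtain ⟨-, h2⟩ := Prod.mk.inj h2
    obtain rfl := Option.some.inj h2
    cases p with
    | none => simp [shiftPtr]
    | some k =>
      have := hs i m' k h1
      simp [shiftPtr, this]

theorem keep_leftOf_embed (s : JSeq A.Move) :
    keep A.leftOf (A.embed s) = (List.range s.length).map (· + 1) := by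
  induction s using List.reverseRecOn with
  | nil => rfl
  | append_singleton s x ih =>
    obtain ⟨m, p⟩ := x
    rw [embed_concat, keep_concat, ih, List.length_append, List.length_singleton, List.range_succ]
    simp

/-- Restriction drops the pointers to `q`, which are those that `embed` gave to unjustified
occurrences, and shifts the other pointers back. -/
theorem restrictLeft_embed (hs : s.Backward) :
    restrictLeft (B := sigmaArena) (A.embed s) = s := by
  rw [restrictLeft_eq]
  induction s using List.reverseRecOn with
  | nil => rfl
  | append_singleton s x ih =>
    obtain ⟨m, p⟩ := x
    have h := backward_embed hs
    rw [embed_concat] at h ⊢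
    rw [restr_concat_some h (leftOf_inA m), ih hs.of_append, keep_leftOf_embed]
    congr 3
    cases p with
    | none => 
      rw [Option.bind_some, List.idxOf?_eq_none_iff]
      simp [shiftPtr]
    | some k =>
      have := hs s.length m k (List.getElem?_concat_length ..)
      simp only [Option.bind_some, shiftPtr]
      rw [idxOf?_map_succ, idxOf?_eq_some_of_nodup List.nodup_range,
        List.getElem?_range (by omega)]

theorem restrictLeft_embed_ans (hs : s.Backward) :
    restrictLeft (B := sigmaArena) (A.embed s ++ [A.ansOcc]) = s := by
  conv_rhs => rw [← restrictLeft_embed hs]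
  rw [restrictLeft_eq, restrictLeft_eq]
  exact restr_concat_none leftOf_aMove

theorem keep_rightOf_embed (s : JSeq A.Move) : keep A.rightOf (A.embed s) = [0] := by
  induction s using List.reverseRecOn with
  | nil => rfl
  | append_singleton s x ih =>
    obtain ⟨m, p⟩ := x
    rw [embed_concat, keep_concat, ih]
    simp

theorem restrictRight_embed (s : JSeq A.Move) :
    restrictRight (B := sigmaArena) (A.embed s) = [(SigmaMove.q, none)] := by
  rw [restrictRight_eq]
  induction s using List.reverseRecOn with
  | nil => rfl
  | append_singleton s x ih =>
    obtain ⟨m, p⟩ := x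
    rw [embed_concat, restr_concat_none (rightOf_inA m), ih]

theorem restrictRight_embed_ans (hs : s.Backward) :
    restrictRight (B := sigmaArena) (A.embed s ++ [A.ansOcc]) =
      [(SigmaMove.q, none), (SigmaMove.a, some 0)] := by
  have h : JSeq.Backward (A.embed s ++ [(A.aMove, some 0)]) := by
    intro i m k hx
    rcases lt_trichotomy i (A.embed s).length with h1 | h1 | h1
    · rw [List.getElem?_append_left h1] at hx
      exact backward_embed hs i m k hx
    · subst h1
      rw [List.getElem?_append_right le_rfl] at hx
      simp only [Nat.sub_self, List.getElem?_cons_zero, Option.some.injEq, Prod.mk.injEq] at hx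
      rw [← hx.2, length_embed]
      omega
    · rw [List.getElem?_eq_none (by simp at h1 ⊢; omega)] at hx
      cases hx
  rw [restrictRight_eq, ansOcc, restr_concat_some h rightOf_aMove, keep_rightOf_embed,
    ← restrictRight_eq, restrictRight_embed]
  rfl

theorem embed_mem_testPlays (hs : A.IsLegal s) : A.embed s ∈ A.testPlays := by
  refine ⟨isLegal_embed hs, ?_, ?_⟩
  · rw [restrictLeft_embed hs.backward]
    exact hs
  · rw [restrictRight_embed]
    exact Or.inr (Or.inl rfl)

theorem embed_ans_mem_testPlays (hs : A.IsLegal s) (he : Even s.length) :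
    A.embed s ++ [A.ansOcc] ∈ A.testPlays := by
  refine ⟨isLegal_embed_ans hs he, ?_, ?_⟩
  · rw [restrictLeft_embed_ans hs.backward]
    exact hs
  · rw [restrictRight_embed_ans hs.backward]
    exact Or.inr (Or.inr rfl)

theorem pview_embed (hs : A.IsLegal s) : A.testArena.pview (A.embed s) = A.embed (A.oview s) := by
  rw [(isLegal_embed hs).pview_eq, hs.oview_eq, length_embed, vseq_embed hs .O le_rfl]
  rfl

theorem pview_embed_ans (hs : A.IsLegal s) (he : Even s.length) :
    A.testArena.pview (A.embed s ++ [A.ansOcc]) = A.embed (A.oview s) ++ [A.ansOcc] := by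
  have h := isLegal_embed_ans hs he
  have h1 : (A.embed s ++ [A.ansOcc])[s.length + 1]? = some (A.aMove, some 0) := by
    rw [List.getElem?_append_right (by simp), length_embed, Nat.sub_self]
    rfl
  rw [h.pview_eq, ← pview_embed hs, (isLegal_embed hs).pview_eq, List.length_append, length_embed,
    List.length_singleton,
    h.vseq_last h1 (isBy_eq_false.2 (by rw [player_aMove]; simp)), vseq_append (by simp),
    vchain_append (by simp), vchain_embed .O le_rfl]
  rfl

end Arena
-- Classification of the plays of `A → Σ`.
namespace Arena
variable {A : Arena.{u}} {s t : JSeq A.Move}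

theorem eq_map_embedOcc {u : JSeq A.testArena.Move} 
    (h : ∀ x ∈ u, ∃ m k, x = (A.inA m, some k)) :
    ∃ s : JSeq A.Move, u = s.map A.embedOcc ∧ s.length = u.length := by
  induction u with
  | nil => exact ⟨[], rfl, rfl⟩
  | cons x u ih =>
    obtain ⟨s, hs, hl⟩ := ih (fun y hy => h y (List.mem_cons_of_mem _ hy))
    obtain ⟨m, k, rfl⟩ := h _ List.mem_cons_self
    obtain ⟨x, hx⟩ := exists_embedOcc m k
    exact ⟨x :: s, by rw [List.map_cons, hs, hx], by simp [hl]⟩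

/-- Serves to cut a play of `A → Σ` at the first move from `Σ` after the opening question. -/
theorem filterMap_eq_nil_or {α β : Type*} (f : α → Option β) (l : List α) :
    (l.filterMap f = [] ∧ ∀ x ∈ l, f x = none) ∨
      ∃ l₁ x l₂ y, l = l₁ ++ x :: l₂ ∧ (∀ z ∈ l₁, f z = none) ∧ f x = some y ∧
        l.filterMap f = y :: l₂.filterMap f := by
  induction l with
  | nil => left; simp
  | cons a l ih =>
    cases ha : f a with
    | some y =>
      right
      exact ⟨[], a, l, y, rfl, by simp, ha, by rw [List.filterMap_cons_some ha]⟩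
    | none =>
      rcases ih with ⟨h1, h2⟩ | ⟨l₁, x, l₂, y, rfl, h1, h2, h3⟩
      · left
        rw [List.filterMap_cons_none ha]
        refine ⟨h1, fun x hx => ?_⟩
        rcases List.mem_cons.1 hx with rfl | hx
        · exact ha
        · exact h2 x hx
      · right
        refine ⟨a :: l₁, x, l₂, y, rfl, fun z hz => ?_, h2, ?_⟩
        · rcases List.mem_cons.1 hz with rfl | hz
          · exact ha
          · exact h1 z hz
        · rw [List.filterMap_cons_none ha, h3]

theorem rightOf_eq_none {m : A.testArena.Move} (h : A.rightOf m = none) : ∃ a, m = A.inA a := by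
  rcases testMove_cases m with h1 | rfl | rfl
  · exact h1
  · cases h
  · cases h

theorem rightOf_eq_a {m : A.testArena.Move} (h : A.rightOf m = some .a) : m = A.aMove := by
  rcases testMove_cases m with ⟨a, rfl⟩ | rfl | rfl
  · cases h
  · cases h
  · rfl

theorem backward_of_embed (hs : (A.embed s).Backward) : s.Backward := by
  intro i m k hx
  have := hs (i + 1) (A.inA m) (k + 1) (by
    rw [getElem?_embed_succ, hx, Option.map_some, embedOcc_mk]; rfl)
  omega

/-- The plays of `A → Σ` are `ε`, the sequences `q s`, and the sequences `q s a` with `s` of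
even length, for plays `s` of `A`. -/
theorem testPlays_cases {u : JSeq A.testArena.Move} (hu : u ∈ A.testPlays) :
    u = [] ∨ (∃ s, A.IsLegal s ∧ u = A.embed s) ∨
      ∃ s, A.IsLegal s ∧ Even s.length ∧ u = A.embed s ++ [A.ansOcc] := by
  obtain ⟨h1, h2, h3⟩ := hu
  rw [restrictLeft_eq] at h2
  rw [restrictRight_eq] at h3
  have hR : u.filterMap (fun x => A.rightOf x.1) = [] ∨
      u.filterMap (fun x => A.rightOf x.1) = [.q] ∨
      u.filterMap (fun x => A.rightOf x.1) = [.q, .a] := by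
    have h := restr_map_fst (f := A.rightOf) h1.backward
    rcases h3 with h3 | h3 | h3 <;> rw [h3] at h
    · exact Or.inl h.symm
    · exact Or.inr (Or.inl h.symm)
    · exact Or.inr (Or.inr h.symm)
  have hptr : ∀ x ∈ u, ∀ a, x.1 = A.inA a → ∃ m k, x = (A.inA m, some k) := by
    rintro ⟨m, p⟩ hx a ha
    simp only at ha
    subst ha
    obtain ⟨i, hi⟩ := List.mem_iff_getElem?.1 hx
    cases p with
    | none => exact (h1.initial_of_none i _ hi).elim
    | some k => exact ⟨a, k, rfl⟩
  cases u with
  | nil => exact Or.inl rfl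
  | cons x u =>
    right
    obtain rfl : x = (A.qMove, none) := by
      obtain ⟨m, p⟩ := x
      cases p with
      | some k => exact absurd (h1.justified 0 m k rfl).1 (by omega)
      | none =>
        have := h1.initial_of_none 0 m rfl
        rcases testMove_cases m with ⟨a, rfl⟩ | rfl | rfl
        · exact this.elim
        · rfl
        · cases this
    have hq : ∀ v : JSeq A.testArena.Move,
        ((A.qMove, none) :: v).filterMap (fun x => A.rightOf x.1) =
          .q :: v.filterMap fun x => A.rightOf x.1 :=
      fun v => List.filterMap_cons_some rfl
    rw [hq] at hR
    rcases filterMap_eq_nil_or (fun x => A.rightOf x.1) u with ⟨-, h5⟩ |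
        ⟨u₁, x, u₂, y, rfl, h5, h6, h7⟩
    · left
      obtain ⟨s, rfl, -⟩ := eq_map_embedOcc (u := u) (fun x hx =>
        let ⟨a, ha⟩ := rightOf_eq_none (h5 x hx)
        hptr x (List.mem_cons_of_mem _ hx) a ha)
      rw [← embed_eq] at h1 h2
      rw [← restrictLeft_eq, restrictLeft_embed (backward_of_embed h1.backward)] at h2
      exact ⟨s, h2, rfl⟩
    · right
      have h8 : y = .a ∧ u₂.filterMap (fun x => A.rightOf x.1) = [] := by
        rw [h7] at hR
        rcases hR with hR | hR | hR
        · cases hR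
        · cases (List.cons.inj hR).2
        · have := (List.cons.inj hR).2
          exact ⟨(List.cons.inj this).1, (List.cons.inj this).2⟩
      obtain ⟨rfl, h8⟩ := h8
      obtain ⟨m, p⟩ := x
      obtain rfl : m = A.aMove := rightOf_eq_a h6
      obtain ⟨s, rfl, -⟩ := eq_map_embedOcc (u := u₁) (fun x hx =>
        let ⟨a, ha⟩ := rightOf_eq_none (h5 x hx)
        hptr x (List.mem_cons_of_mem _ (List.mem_append_left _ hx)) a ha)
      have e : (A.qMove, none) :: (s.map A.embedOcc ++ (A.aMove, p) :: u₂) =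
        (A.embed s ++ [(A.aMove, p)]) ++ u₂ := by rw [embed_eq]; simp
      rw [e] at h1 h2 hptr
      have h9 : (A.embed s ++ [(A.aMove, p)] ++ u₂)[s.length + 1]? = some (A.aMove, p) := by
        rw [List.getElem?_append_left (by simp), List.getElem?_append_right (by simp)]
        simp
      have hse : Even s.length := by
        have := (h1.odd_of_P h9).1 player_aMove
        rwa [Nat.odd_add_one, Nat.not_odd_iff_even] at this
      obtain rfl : p = some 0 := by
        cases p with
        | none => cases h1.initial_of_none _ _ h9
        | some k =>
          obtain ⟨hk, x, hx, he⟩ := h1.justified _ _ _ h9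
          cases k with
          | zero => rfl
          | succ k =>
            rw [List.getElem?_append_left (by simp; omega),
              List.getElem?_append_left (by simp; omega), getElem?_embed_succ,
              Option.map_eq_some_iff] at hx
            obtain ⟨⟨m, p⟩, -, rfl⟩ := hx
            exact he.elim
      have hsb : s.Backward := backward_of_embed h1.backward.of_append.of_append
      have hL := restr_map_fst (f := A.leftOf) h1.backward
      have hL' := restr_map_fst (f := A.leftOf) h1.backward.of_append.of_append
      rw [← restrictLeft_eq, restrictLeft_embed hsb] at hL'
      -- A move after the answer would be a move of `A`. Its position `s.length + 2` is even, so it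
      -- would be an O-move of `A → Σ` and a P-move of `A`; in the restriction to `A` it has the
      -- even index `s.length` and would be an O-move.
      have h10 : u₂ = [] := by
        cases u₂ with
        | nil => rfl
        | cons z u₂ =>
          exfalso
          obtain ⟨a, ha⟩ : ∃ a, z.1 = A.inA a := by
            rw [List.filterMap_eq_nil_iff] at h8
            exact rightOf_eq_none (h8 z List.mem_cons_self)
          have h11 : (A.embed s ++ [(A.aMove, some 0)] ++ z :: u₂)[s.length + 2]? = some z := by
            rw [List.getElem?_append_right (by simp)]
            simp
          have h12 := (h1.even_of_O h11).2 (by rw [Nat.even_add]; simp [hse])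
          rw [ha, player_inA] at h12
          rw [List.filterMap_append, List.filterMap_append, ← hL'] at hL
          have h13 : (restr A.leftOf (A.embed s ++ [(A.aMove, some 0)] ++ z :: u₂)).map
              Prod.fst = s.map Prod.fst ++ a :: u₂.filterMap fun x => A.leftOf x.1 := by
            have hz : (z :: u₂).filterMap (fun x => A.leftOf x.1) =
                a :: u₂.filterMap fun x => A.leftOf x.1 :=
              List.filterMap_cons_some (by rw [ha]; rfl)
            have hz' : List.filterMap (fun x => A.leftOf x.1) [(A.aMove, some 0)] = [] := rfl
            rw [hL, hz, hz', List.append_nil]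
          have h14 := congrArg (fun l => l[s.length]?) h13
          simp only [List.getElem?_map] at h14
          rw [List.getElem?_append_right (by simp)] at h14
          simp only [List.length_map, Nat.sub_self, List.getElem?_cons_zero,
            Option.map_eq_some_iff] at h14
          obtain ⟨⟨m, p⟩, h15, rfl⟩ := h14
          have h16 := (h2.even_of_O h15).2 hse
          simp only at h12 h16
          rw [h16] at h12
          cases h12
      subst h10
      rw [List.append_nil] at h2
      rw [← restrictLeft_eq] at h2
      change restrictLeft (B := sigmaArena) (A.embed s ++ [A.ansOcc]) ∈ _ at h2
      rw [restrictLeft_embed_ans hsb] at h2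
      exact ⟨s, h2, hse, by rw [e, List.append_nil]; rfl⟩

/-- Prefix closure is read off from the classification, because restrictions do not have to be
compared then. -/
theorem testPlays_of_append {u v : JSeq A.testArena.Move} (h : u ++ v ∈ A.testPlays) :
    u ∈ A.testPlays := by
  have hu : u <+: u ++ v := List.prefix_append u v
  rcases testPlays_cases h with h1 | ⟨s, hs, h1⟩ | ⟨s, hs, he, h1⟩
  · rw [(List.append_eq_nil_iff.1 h1).1]
    exact ⟨isLegal_nil, isLegal_nil, Or.inl rfl⟩
  · rw [h1] at hu
    rw [List.prefix_iff_eq_take.1 hu]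
    cases u.length with
    | zero => exact ⟨isLegal_nil, isLegal_nil, Or.inl rfl⟩
    | succ n =>
      rw [embed_take]
      exact embed_mem_testPlays (hs.take n)
  · rw [h1] at hu
    rcases List.prefix_concat_iff.1 hu with h2 | hu
    · rw [h2]
      exact embed_ans_mem_testPlays hs he
    · rw [List.prefix_iff_eq_take.1 hu]
      cases u.length with
      | zero => exact ⟨isLegal_nil, isLegal_nil, Or.inl rfl⟩
      | succ n =>
        rw [embed_take]
        exact embed_mem_testPlays (hs.take n)

/-- A strategy passes a test iff some play of the strategy leads the test to its answer. -/
theorem comp_eq_sigmaTop_iff {σ : Set (JSeq A.Move)} (hσ : A.IsStrategy A.plays σ)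
    {α : Set (JSeq A.testArena.Move)} (h0 : [] ∈ α) (hα : α ⊆ A.testPlays)
    (he : ∀ u ∈ α, Even u.length) :
    comp σ α = sigmaTop ↔ ∃ s ∈ σ, A.embed s ++ [A.ansOcc] ∈ α := by
  constructor
  · intro h
    have h1 : [(SigmaMove.q, none), (SigmaMove.a, some 0)] ∈ comp σ α := by
      rw [h]
      exact Or.inr rfl
    obtain ⟨u, hu, h2, h3⟩ := h1
    rcases testPlays_cases (hα hu) with rfl | ⟨s, hs, rfl⟩ | ⟨s, hs, -, rfl⟩
    · cases h3
    · rw [restrictRight_embed] at h3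
      cases (List.cons.inj h3).2
    · rw [restrictLeft_embed_ans hs.backward] at h2
      exact ⟨s, h2, hu⟩
  · rintro ⟨s, hs, hu⟩
    apply Set.Subset.antisymm
    · rintro w ⟨u, hu, h2, rfl⟩
      rcases testPlays_cases (hα hu) with rfl | ⟨s, hs, rfl⟩ | ⟨s, hs, -, rfl⟩
      · exact Or.inl rfl
      · rw [restrictLeft_embed hs.backward] at h2
        -- Parity excludes an interaction that stops inside `A`: `s` has even length as a play of
        -- `σ`, and odd length because `q s` is a play of the test.
        have h3 := hσ.even s h2
        have h4 := he _ hu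
        rw [length_embed, Nat.even_add_one] at h4
        exact absurd h3 h4
      · rw [restrictRight_embed_ans hs.backward]
        exact Or.inr rfl
    · rintro w (rfl | rfl)
      · exact ⟨[], h0, hσ.nil_mem, rfl⟩
      · have hb := IsLegal.backward (hσ.mem_pos s hs)
        exact ⟨_, hu, by rwa [restrictLeft_embed_ans hb], restrictRight_embed_ans hb⟩

theorem nil_mem_ofViewFunction (f : Set (JSeq A.testArena.Move × (A.testArena.Move × Option ℕ))) :
    [] ∈ A.testArena.ofViewFunction A.testPlays f := by
  refine ⟨⟨isLegal_nil, isLegal_nil, Or.inl rfl⟩, by simp, fun t a b _ h => ?_⟩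
  have := h.length_le
  simp at this

end Arena
-- Moves played from views, and the tests `α_S` as innocent strategies.
namespace Arena
variable {A : Arena.{u}} {s t : JSeq A.Move}

theorem vseq_getElem?_last {M : Type u} {inp : M → Bool} {s : JSeq M} (hs : s.Backward) {n : ℕ}
    {m : M} {p : Option ℕ} (h : s[n]? = some (m, p)) :
    ∃ q, (vseq inp s (n + 1))[(vseq inp s (n + 1)).length - 1]? = some (m, q) := by
  rw [vseq_succ hs h]
  exact ⟨p.bind fun k => (vchain inp s (prd inp s n)).idxOf? k, by simp⟩

/-- A move played from a view can be played from any play with that view. -/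
theorem IsLegal.lift (hs : A.IsLegal s) {π : Player} {m : A.Move} {p : Option ℕ}
    (hm : A.player m ≠ π) (h : A.IsLegal (vseq (A.isBy π) s s.length ++ [(m, p)])) :
    ∃ p', (∀ i, p = some i ↔ ∃ k, p' = some k ∧ (vchain (A.isBy π) s s.length)[i]? = some k) ∧
      A.IsLegal (s ++ [(m, p')]) ∧
      vseq (A.isBy π) (s ++ [(m, p')]) (s.length + 1) =
        vseq (A.isBy π) s s.length ++ [(m, p)] := by
  set L := vchain (A.isBy π) s s.length with hL
  set w := vseq (A.isBy π) s s.length with hw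
  have hr : ∀ i ∈ L, i < s.length := vchain_lt le_rfl
  have hn : L.Nodup := nodup_of_sorted (vchain_sorted _ _ _)
  have hwl : w.length = L.length := length_vseq le_rfl
  have hlast : (w ++ [(m, p)])[w.length]? = some (m, p) := by simp
  have hp : ∀ i, p = some i → ∃ k, L[i]? = some k := by
    rintro i rfl
    have := (h.justified _ _ _ hlast).1
    exact ⟨L[i]'(by omega), List.getElem?_eq_getElem _⟩
  -- The pointer is an index in the view; the list of positions of the view translates it into a
  -- position of `s`.
  refine ⟨p.bind fun i => L[i]?, ?_, ?_, ?_⟩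
  · intro i
    cases p with
    | none => simp
    | some j =>
      obtain ⟨k, hk⟩ := hp j rfl
      simp only [Option.some.injEq, Option.bind_some, hk]
      constructor
      · rintro rfl
        exact ⟨k, rfl, hk⟩
      · rintro ⟨k', rfl, hk'⟩
        exact idx_eq_of_sorted (vchain_sorted _ _ _) hk hk'
  · apply hs.concat
    · intro h1
      cases p with
      | none => exact h.initial_of_none _ _ hlast
      | some i =>
        obtain ⟨k, hk⟩ := hp i rfl
        simp [hk] at h1
    · intro k h1
      cases p with
      | none => simp at h1
      | some i =>
        rw [Option.bind_some] at h1
        obtain ⟨h2, ⟨m', q⟩, hy, he⟩ := h.justified _ _ _ hlast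
        rw [List.getElem?_append_left h2] at hy
        obtain ⟨n, p', h3, h4, -⟩ := JSeq.exists_of_getElem?_sub hr hy
        have h3' : L[i]? = some n := h3
        rw [h1] at h3'
        obtain rfl := Option.some.inj h3'
        exact ⟨_, h4, he⟩
    -- The last move of `s` is also the last move of its view, so alternation can be checked in the
    -- view.
    · rintro i ⟨m', p'⟩ hi hy
      obtain ⟨q, hq⟩ := vseq_getElem?_last (inp := A.isBy π) hs.backward hy
      rw [← hi, ← hw] at hq
      have hpos : 0 < w.length := by
        rcases Nat.eq_zero_or_pos w.length with h0 | h0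
        · rw [List.getElem?_eq_none (by omega)] at hq
          cases hq
        · exact h0
      exact h.alternating (w.length - 1) (m', q) (m, p)
        (by rw [List.getElem?_append_left (by omega), hq])
        (by rw [Nat.sub_add_cancel hpos, hlast])
    · intro π' k h1 hm'
      obtain rfl : π' = π := by
        cases π <;> cases π' <;> cases hq : A.player m <;> simp_all
      cases p with
      | none => simp at h1
      | some i => exact List.mem_of_getElem? h1
  · have hb : JSeq.Backward (s ++ [(m, p.bind fun i => L[i]?)]) := by
      intro i m' k hx
      rcases lt_trichotomy i s.length with h1 | h1 | h1
      · rw [List.getElem?_append_left h1] at hx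
        exact hs.backward i m' k hx
      · subst h1
        rw [List.getElem?_append_right le_rfl] at hx
        simp only [Nat.sub_self, List.getElem?_cons_zero, Option.some.injEq, Prod.mk.injEq] at hx
        cases p with
        | none => simp at hx
        | some i => exact hr _ (List.mem_of_getElem? hx.2)
      · rw [List.getElem?_eq_none (by simp; omega)] at hx
        cases hx
    have hx : (s ++ [(m, p.bind fun i => L[i]?)])[s.length]? =
      some (m, p.bind fun i => L[i]?) := by simp
    rw [vseq_succ hb hx, prd_of_not hx (by simpa using hm), vseq_append le_rfl,
      vchain_append le_rfl, ← hw, ← hL]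
    congr 3
    cases p with
    | none => rfl
    | some i =>
      obtain ⟨k, hk⟩ := hp i rfl
      rw [Option.bind_some, hk, Option.bind_some]
      exact (idxOf?_eq_some_of_nodup hn).2 hk

theorem IsLegal.lift_oview (hs : A.IsLegal s) {x : A.Move × Option ℕ}
    (hx : A.player x.1 = .O) (h : A.IsLegal (A.oview s ++ [x])) :
    ∃ y, A.IsLegal (s ++ [y]) ∧ A.oview (s ++ [y]) = A.oview s ++ [x] := by
  obtain ⟨m, p⟩ := x
  rw [hs.oview_eq] at h
  obtain ⟨p', -, h1, h2⟩ := hs.lift (π := .P) (by simp [show A.player m = .O from hx]) h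
  refine ⟨_, h1, ?_⟩
  rw [h1.oview_eq, hs.oview_eq, ← h2]
  simp

/-- The P-view function of `α_S`, where the test answers at the first complete view. -/
def firstViewFunction (A : Arena.{u}) (S : Set (JSeq A.Move)) :
    Set (JSeq A.testArena.Move × (A.testArena.Move × Option ℕ)) :=
  {x | ∃ s o, s ++ [o] ∈ S ∧ A.player o.1 = .O ∧ ¬ (s ∈ S ∧ A.Complete s) ∧
      x = (A.embed s, A.embedOcc o)} ∪
    {x | ∃ t ∈ S, A.Complete t ∧ x = (A.embed t, A.ansOcc)}

theorem firstViewFunction_subset (S : Set (JSeq A.Move)) :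
    A.firstViewFunction S ⊆ A.alphaViewFunction S := by
  rintro x (⟨s, o, h1, h2, -, h3⟩ | h)
  · exact Or.inl ⟨s, o, h1, h2, h3⟩
  · exact Or.inr h

/-- For `α_S` itself the only possible clash is between continuing and answering at a complete view;
this is excluded here, and O-determinism settles the case of two continuations. -/
theorem firstViewFunction_functional {S : Set (JSeq A.Move)} (hS : A.IsODeterministic S)
    {v : JSeq A.testArena.Move} {x y : A.testArena.Move × Option ℕ}
    (hx : (v, x) ∈ A.firstViewFunction S) (hy : (v, y) ∈ A.firstViewFunction S) : x = y := by
  rcases hx with ⟨s, o, h1, h2, h3, h4⟩ | ⟨t, h1, h2, h3⟩ <;>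
    rcases hy with ⟨s', o', k1, k2, k3, k4⟩ | ⟨t', k1, k2, k3⟩
  · obtain ⟨rfl, rfl⟩ := Prod.mk.inj h4
    obtain ⟨k5, rfl⟩ := Prod.mk.inj k4
    obtain rfl := embed_injective k5
    rw [hS.deterministic _ _ _ h2 k2 h1 k1]
  · obtain ⟨rfl, rfl⟩ := Prod.mk.inj h4
    obtain ⟨k5, rfl⟩ := Prod.mk.inj k3
    obtain rfl := embed_injective k5
    exact absurd ⟨k1, k2⟩ h3
  · obtain ⟨rfl, rfl⟩ := Prod.mk.inj h3
    obtain ⟨k5, rfl⟩ := Prod.mk.inj k4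
    obtain rfl := embed_injective k5
    exact absurd ⟨h1, h2⟩ k3
  · rw [(Prod.mk.inj h3).2, (Prod.mk.inj k3).2]

theorem ofViewFunction_mono {B : Arena.{v}} {pos : Set (JSeq B.Move)}
    {f g : Set (JSeq B.Move × (B.Move × Option ℕ))} (h : f ⊆ g) :
    B.ofViewFunction pos f ⊆ B.ofViewFunction pos g := by
  rintro s ⟨h1, h2, h3⟩
  refine ⟨h1, h2, fun t a b ht hs => ?_⟩
  obtain ⟨x, hx, h4⟩ := h3 t a b ht hs
  exact ⟨x, h hx, h4⟩

theorem unanswered_embed {i : ℕ} : A.testArena.Unanswered (A.embed s) (i + 1) ↔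
    A.Unanswered s i := by
  constructor
  · rintro ⟨⟨x, hx, hk⟩, h⟩
    rw [getElem?_embed_succ, Option.map_eq_some_iff] at hx
    obtain ⟨⟨m, p⟩, hx, rfl⟩ := hx
    refine ⟨⟨_, hx, hk⟩, ?_⟩
    rintro j ⟨m', p'⟩ hy hk' rfl
    exact h (j + 1) (A.embedOcc (m', some i)) (by rw [getElem?_embed_succ, hy]; rfl) hk' rfl
  · rintro ⟨⟨⟨m, p⟩, hx, hk⟩, h⟩
    refine ⟨⟨A.embedOcc (m, p), by rw [getElem?_embed_succ, hx]; rfl, hk⟩, ?_⟩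
    intro j y hy hk' hp
    cases j with
    | zero =>
      rw [getElem?_embed_zero] at hy
      obtain rfl := Option.some.inj hy
      cases hp
    | succ j =>
      rw [getElem?_embed_succ, Option.map_eq_some_iff] at hy
      obtain ⟨⟨m', p'⟩, hy, rfl⟩ := hy
      cases p' with
      | none => cases hp
      | some k =>
        rw [embedOcc_mk] at hp
        have : k + 1 = i + 1 := Option.some.inj hp
        obtain rfl : k = i := by omega
        exact h j _ hy hk' rfl

/-- In `q s` only initial moves point at `q`, and they are questions. -/
theorem unanswered_embed_zero (h : A.Justified s) : A.testArena.Unanswered (A.embed s) 0 := by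
  refine ⟨⟨_, getElem?_embed_zero s, rfl⟩, ?_⟩
  intro j y hy hk hp
  cases j with
  | zero =>
    rw [getElem?_embed_zero] at hy
    obtain rfl := Option.some.inj hy
    cases hp
  | succ j =>
    rw [getElem?_embed_succ, Option.map_eq_some_iff] at hy
    obtain ⟨⟨m, p⟩, hy, rfl⟩ := hy
    cases p with
    | none =>
      have h1 := A.initial_kind m (h.initial_of_none _ _ hy)
      have h2 : A.kind m = .A := hk
      rw [h1] at h2
      cases h2
    | some k =>
      have : k + 1 = 0 := Option.some.inj hp
      omega

theorem isPending_embed {k : ℕ} (h : A.IsPending s k) :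
    A.testArena.IsPending (A.embed s) (k + 1) := by
  refine ⟨unanswered_embed.2 h.1, fun j hj => ?_⟩
  cases j with
  | zero => omega
  | succ j => exact Nat.succ_le_succ (h.2 j (unanswered_embed.1 hj))

theorem isPending_embed_zero (h : A.Justified s) (hc : A.Complete s) :
    A.testArena.IsPending (A.embed s) 0 := by
  refine ⟨unanswered_embed_zero h, fun j hj => ?_⟩
  cases j with
  | zero => omega
  | succ j => exact absurd (unanswered_embed.1 hj) (hc j)

/-- Determinism holds because the view function is functional. For innocence, a move prescribed at
an O-view can be replayed after any play with that O-view (`lift_oview`). Bracketing comes from the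
bracketing of the members of `S`; the final answer is bracketed since `q` is the pending question
once the view is complete. -/
theorem isInnocent_first {S : Set (JSeq A.Move)} (hS : A.IsODeterministic S) :
    A.testArena.IsInnocent A.testPlays
      (A.testArena.ofViewFunction A.testPlays (A.firstViewFunction S)) where
  nonempty := ⟨_, nil_mem_ofViewFunction _⟩
  mem_pos _ hs := hs.1
  even _ hs := hs.2.1
  closed s a b hs := by
    refine ⟨testPlays_of_append hs.1, ?_, fun t c d ht hp => hs.2.2 t c d ht (hp.trans ⟨_, rfl⟩)⟩
    have := hs.2.1
    rw [List.length_append] at this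
    simpa [Nat.even_add_one] using this
  deterministic s a b c hb hc := by
    have he : Even s.length := by
      have := hb.2.1
      rw [List.length_append] at this
      simpa [Nat.even_add_one] using this
    obtain ⟨⟨v, x⟩, hx, h1, h2⟩ := hb.2.2 s a b he List.prefix_rfl
    obtain ⟨⟨v', y⟩, hy, h3, h4⟩ := hc.2.2 s a c he List.prefix_rfl
    simp only at h1 h2 h3 h4
    obtain rfl : v = v' := h1.symm.trans h3
    obtain rfl := firstViewFunction_functional hS hx hy
    exact hb.1.1.eq_of_pview_eq hc.1.1 he (h2.trans h4.symm)
  innocent s a b t a' hs ht hpos hv := by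
    have he : Even s.length := by
      have := hs.2.1
      rw [List.length_append] at this
      simpa [Nat.even_add_one] using this
    have hte := ht.2.1
    obtain ⟨⟨v, x⟩, hx, h1, h2⟩ := hs.2.2 s a b he List.prefix_rfl
    simp only at h1 h2
    -- A play of odd length has the form `q w` with `w` of even length, since a play that ends with
    -- the answer has even length.
    obtain ⟨w, hw, hwe, hwt⟩ : ∃ w, A.IsLegal w ∧ Even w.length ∧ t ++ [a'] = A.embed w := by
      rcases testPlays_cases hpos with h3 | ⟨w, hw, h3⟩ | ⟨w, hw, hwe, h3⟩
      · simp at h3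
      · have hl := congrArg List.length h3
        simp only [List.length_append, List.length_singleton, length_embed] at hl
        exact ⟨w, hw, by rwa [show w.length = t.length by omega], h3⟩
      · have hl := congrArg List.length h3
        simp only [List.length_append, List.length_singleton, length_embed] at hl
        rw [show t.length = w.length + 1 by omega, Nat.even_add_one] at hte
        exact absurd hwe hte
    have hwv : A.embed (A.oview w) = v := by
      rw [← pview_embed hw, ← hwt, hv, h1]
    have e : ∀ c : A.testArena.Move × Option ℕ, t ++ [a', c] = A.embed w ++ [c] := by
      intro c
      rw [← hwt, List.append_assoc]
      rfl
    suffices h : ∃ b', A.embed w ++ [b'] ∈ A.testPlays ∧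
        A.testArena.pview (A.embed w ++ [b']) = v ++ [x] by
      obtain ⟨b', h3, h4⟩ := h
      refine ⟨b', ⟨by rwa [e], ?_, ?_⟩, by rw [e, h4, h2]⟩
      · rw [List.length_append]
        simpa [Nat.even_add_one] using hte
      · intro r c d hr hp
        have hlen := hp.length_le
        simp only [List.length_append, List.length_cons, List.length_nil] at hlen
        by_cases hlt : r.length + 2 ≤ t.length
        · refine ht.2.2 r c d hr ?_
          exact List.prefix_of_prefix_length_le hp (List.prefix_append _ _) (by simpa using hlt)
        · have hrl : r.length = t.length := by
            by_contra hne
            have h5 : t.length = r.length + 1 := by omega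
            rw [h5, Nat.even_add_one] at hte
            exact hte hr
          have h6 := List.IsPrefix.eq_of_length hp (by simp [hrl])
          obtain ⟨rfl, h7⟩ := List.append_inj h6 hrl
          simp only [List.cons.injEq, and_true] at h7
          obtain ⟨rfl, rfl⟩ := h7
          exact ⟨_, hx, by rw [hv, h1], by rw [e, h4]⟩
    rcases hx with ⟨s', o, h3, h4, -, h5⟩ | ⟨t', h3, h4, h5⟩
    · obtain ⟨rfl, rfl⟩ := Prod.mk.inj h5
      obtain rfl := embed_injective hwv
      obtain ⟨y, hy, hy'⟩ := hw.lift_oview h4 (hS.isOView _ h3).1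
      refine ⟨A.embedOcc y, ?_, ?_⟩
      · have := embed_mem_testPlays hy
        rwa [embed_append] at this
      · have := pview_embed hy
        rw [hy', embed_append, embed_append] at this
        exact this
    · obtain ⟨rfl, rfl⟩ := Prod.mk.inj h5
      refine ⟨A.ansOcc, embed_ans_mem_testPlays hw hwe, ?_⟩
      rw [pview_embed_ans hw hwe, hwv]
  bracketed s hs := by
    intro r z hz hk
    rcases eq_or_ne s [] with rfl | h0
    · rw [isLegal_nil.pview_eq] at hz
      simp at hz
    obtain ⟨t, a, b, rfl, he⟩ := exists_concat_of_even hs.2.1 h0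
    obtain ⟨⟨v, x⟩, hx, h1, h2⟩ := hs.2.2 t a b he List.prefix_rfl
    simp only at h2
    rw [h2] at hz
    have hz' := List.append_inj' hz rfl
    obtain rfl := hz'.1
    obtain rfl : x = z := by simpa using hz'.2
    clear hz hz'
    rcases hx with ⟨s', o, h3, h4, -, h5⟩ | ⟨t', h3, h4, h5⟩
    · obtain ⟨rfl, rfl⟩ := Prod.mk.inj h5
      obtain ⟨k, hk1, hk2⟩ := hS.wellBracketed _ h3 _ List.prefix_rfl s' o rfl hk
      refine ⟨k + 1, ?_, isPending_embed hk2⟩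
      obtain ⟨m, p⟩ := o
      simp only at hk1
      subst hk1
      rfl
    · obtain ⟨rfl, rfl⟩ := Prod.mk.inj h5
      exact ⟨0, rfl, isPending_embed_zero (hS.isOView _ h3).1.toJustified h4⟩

/-- The P-view of `q s` is `q` followed by the O-view of `s`, so membership is a condition on
O-views of prefixes. The even `n` are the moments at which the test is to move. -/
theorem embed_ans_mem_iff (hs : A.IsLegal s) (he : Even s.length)
    {f : Set (JSeq A.testArena.Move × (A.testArena.Move × Option ℕ))} :
    A.embed s ++ [A.ansOcc] ∈ A.testArena.ofViewFunction A.testPlays f ↔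
      (∀ n, Even n → n < s.length → ∃ x ∈ f, A.embed (A.oview (s.take n)) = x.1 ∧
        A.embed (A.oview (s.take (n + 1))) = x.1 ++ [x.2]) ∧
      (A.embed (A.oview s), A.ansOcc) ∈ f := by
  have e : ∀ n, n < s.length → ∃ b, (s.take (n + 1)) = s.take n ++ [b] := by
    intro n hn
    exact ⟨s[n], by rw [List.take_add_one, List.getElem?_eq_getElem hn]; rfl⟩
  have e0 : ∀ r : JSeq A.Move, ∃ t a, A.embed r = t ++ [a] ∧ t.length = r.length := by
    intro r
    rcases List.eq_nil_or_concat (A.embed r) with h | ⟨t, a, h⟩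
    · have := congrArg List.length h
      simp at this
    · rw [List.concat_eq_append] at h
      have := congrArg List.length h
      simp at this
      exact ⟨t, a, h, this.symm⟩
  constructor
  · rintro ⟨-, -, h⟩
    constructor
    · intro n hn hlt
      obtain ⟨b, hb⟩ := e n hlt
      obtain ⟨t, a, hta, htl⟩ := e0 (s.take n)
      have h1 : A.embed (s.take (n + 1)) = t ++ [a, A.embedOcc b] := by
        rw [hb, embed_append, hta]
        simp
      obtain ⟨x, hx, h2, h3⟩ := h t a (A.embedOcc b)
        (by rw [htl, List.length_take, min_eq_left hlt.le]; exact hn)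
        (by
          rw [← h1, ← embed_take]
          exact (List.take_prefix _ _).trans (List.prefix_append _ _))
      rw [← hta, pview_embed (hs.take _)] at h2
      rw [← h1, pview_embed (hs.take _)] at h3
      exact ⟨x, hx, h2, h3⟩
    · obtain ⟨t, a, hta, htl⟩ := e0 s
      have h1 : A.embed s ++ [A.ansOcc] = t ++ [a, A.ansOcc] := by rw [hta]; simp
      obtain ⟨⟨v, x⟩, hx, h2, h3⟩ := h t a A.ansOcc (by rwa [htl])
        (by rw [← h1])
      rw [← hta, pview_embed hs] at h2
      rw [← h1, pview_embed_ans hs he] at h3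
      simp only at h2 h3
      subst h2
      have : A.ansOcc = x := by simpa using (List.append_inj' h3 rfl).2
      rwa [this]
  · rintro ⟨h1, h2⟩
    refine ⟨embed_ans_mem_testPlays hs he, ?_, ?_⟩
    · simpa [Nat.even_add_one] using he
    · intro t a b ht hp
      have hlen := hp.length_le
      simp only [List.length_append, List.length_cons, List.length_nil, length_embed] at hlen
      by_cases hlt : t.length < s.length
      · obtain ⟨c, hc⟩ := e _ hlt
        have h3 : t ++ [a, b] = A.embed (s.take (t.length + 1)) := by
          rw [← embed_take]
          have h4 : t ++ [a, b] <+: A.embed s :=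
            List.prefix_of_prefix_length_le hp (List.prefix_append _ _) (by simp; omega)
          have h5 := List.prefix_iff_eq_take.1 h4
          simpa using h5
        have h4 : t ++ [a] = A.embed (s.take t.length) := by
          rw [hc, embed_append] at h3
          rw [show t ++ [a, b] = (t ++ [a]) ++ [b] by simp] at h3
          exact (List.append_inj' h3 rfl).1
        rw [h3, h4, pview_embed (hs.take _), pview_embed (hs.take _)]
        exact h1 _ ht hlt
      · have h3 : t ++ [a, b] = A.embed s ++ [A.ansOcc] := by
          apply List.IsPrefix.eq_of_length hp
          simp only [List.length_append, List.length_cons, List.length_nil, length_embed]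
          have : t.length ≠ s.length + 1 := by
            intro h
            rw [h, Nat.even_add_one] at ht
            exact ht he
          omega
        have h4 : t ++ [a] = A.embed s := by
          rw [show t ++ [a, b] = (t ++ [a]) ++ [b] by simp] at h3
          exact (List.append_inj' h3 rfl).1
        rw [h3, h4, pview_embed hs, pview_embed_ans hs he]
        exact ⟨_, h2, rfl, rfl⟩

/-- The pairs that answer are ruled out, since a sequence `q w` never ends with the answer of `Σ`.
-/
theorem exists_of_mem_alphaViewFunction {S : Set (JSeq A.Move)} {v w : JSeq A.Move}
    {x : JSeq A.testArena.Move × (A.testArena.Move × Option ℕ)} (hx : x ∈ A.alphaViewFunction S)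
    (h1 : A.embed v = x.1) (h2 : A.embed w = x.1 ++ [x.2]) :
    ∃ o, w = v ++ [o] ∧ w ∈ S ∧ A.player o.1 = .O ∧ x = (A.embed v, A.embedOcc o) := by
  rcases hx with ⟨s, o, h3, h4, rfl⟩ | ⟨t, h3, h4, rfl⟩
  · obtain rfl := embed_injective h1
    have : A.embed w = A.embed (v ++ [o]) := by
      rw [h2, embed_append]
      rfl
    obtain rfl := embed_injective this
    exact ⟨o, rfl, h3, h4, rfl⟩
  · exfalso
    replace h2 : A.embed w = A.embed t ++ [A.ansOcc] := h2
    rcases List.eq_nil_or_concat w with rfl | ⟨w, o, rfl⟩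
    · have := congrArg List.length h2
      simp at this
    · rw [List.concat_eq_append, embed_append] at h2
      have := (List.append_inj' h2 rfl).2
      exact embedOcc_ne_ansOcc _ (List.cons.inj this).1

/-- A strategy that passes `α_S` passes the test that answers at the first complete view. -/
theorem exists_first {σ : Set (JSeq A.Move)} (hσ : A.IsStrategy A.plays σ)
    {S : Set (JSeq A.Move)} (h : ∃ s ∈ σ, A.embed s ++ [A.ansOcc] ∈ A.alpha S) :
    ∃ s ∈ σ, A.embed s ++ [A.ansOcc] ∈
      A.testArena.ofViewFunction A.testPlays (A.firstViewFunction S) := by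
  classical
  obtain ⟨s, hs, hu⟩ := h
  have hleg : A.IsLegal s := hσ.mem_pos s hs
  have hev := hσ.even s hs
  obtain ⟨h1, h2⟩ := (embed_ans_mem_iff hleg hev).1 hu
  have hfin : A.oview s ∈ S ∧ A.Complete (A.oview s) := by
    rcases h2 with ⟨s', o, -, -, h5⟩ | ⟨t', h3, h4, h5⟩
    · exact absurd (Prod.mk.inj h5).2.symm (embedOcc_ne_ansOcc _)
    · rw [embed_injective (Prod.mk.inj h5).1]
      exact ⟨h3, h4⟩
  -- The play is cut at its shortest even prefix whose O-view is a complete member of `S`.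
  have hex : ∃ n, Even n ∧ A.oview (s.take n) ∈ S ∧ A.Complete (A.oview (s.take n)) :=
    ⟨s.length, hev, by rwa [List.take_length]⟩
  obtain ⟨hn, hnS, hnC⟩ := Nat.find_spec hex
  have hmin := fun m => Nat.find_min hex (m := m)
  set n := Nat.find hex
  have hle : n ≤ s.length := Nat.find_min' hex ⟨hev, by rwa [List.take_length]⟩
  have hl : (s.take n).length = n := by rw [List.length_take, min_eq_left hle]
  refine ⟨s.take n, hσ.take_mem hs hn, ?_⟩
  refine (embed_ans_mem_iff (hleg.take n) (by rwa [hl])).2 ⟨?_, Or.inr ⟨_, hnS, hnC, rfl⟩⟩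
  intro m hm hmn
  rw [hl] at hmn
  rw [List.take_take, List.take_take, min_eq_left hmn.le, min_eq_left (by omega)]
  obtain ⟨x, hx, h3, h4⟩ := h1 m hm (by omega)
  obtain ⟨o, h5, h6, h7, h8⟩ := exists_of_mem_alphaViewFunction hx h3 h4
  refine ⟨x, Or.inl ⟨_, o, h5 ▸ h6, h7, ?_, h8⟩, h3, h4⟩
  -- Before the cut no view is a complete member of `S`, so the pairs used there survive in the
  -- smaller view function.
  rintro ⟨h9, h10⟩
  exact hmin m hmn ⟨hm, h9, h10⟩

/-- `comp_eq_sigmaTop_iff` does not ask the test to be deterministic, so it applies to `α_S` for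
arbitrary `S`. -/
theorem comp_alpha_iff {σ : Set (JSeq A.Move)} (hσ : A.IsStrategy A.plays σ)
    (S : Set (JSeq A.Move)) :
    comp σ (A.alpha S) = sigmaTop ↔ ∃ s ∈ σ, A.embed s ++ [A.ansOcc] ∈ A.alpha S :=
  comp_eq_sigmaTop_iff hσ (nil_mem_ofViewFunction _) (fun _ h => h.1) (fun _ h => h.2.1)

/-- Innocent tests are at least as strong as the tests `α_S`. -/
theorem LeIB.alpha {σ τ : Set (JSeq A.Move)} (hσ : A.IsStrategy A.plays σ)
    (hτ : A.IsStrategy A.plays τ) (h : A.LeIB σ τ) {S : Set (JSeq A.Move)}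
    (hS : A.IsODeterministic S) (hp : comp σ (A.alpha S) = sigmaTop) :
    comp τ (A.alpha S) = sigmaTop := by
  have h1 := fun {ρ : Set (JSeq A.Move)} (hρ : A.IsStrategy A.plays ρ) =>
    comp_eq_sigmaTop_iff hρ (nil_mem_ofViewFunction (A.firstViewFunction S))
      (fun _ h => h.1) (fun _ h => h.2.1)
  rw [comp_alpha_iff hσ] at hp
  have h2 := h _ (isInnocent_first hS) ((h1 hσ).2 (exists_first hσ hp))
  obtain ⟨s, hs, hu⟩ := (h1 hτ).1 h2
  rw [comp_alpha_iff hτ]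
  exact ⟨s, hs, ofViewFunction_mono (firstViewFunction_subset S) hu⟩

end Arena

/-! ### Positions and indices of kept occurrences. -/

section
variable {M : Type u} {N : Type v}

theorem keep_prefix (f : M → Option N) (s t : JSeq M) : keep f s <+: keep f (s ++ t) := by
  induction t using List.reverseRecOn with
  | nil => simp
  | append_singleton t x ih =>
    rw [← List.append_assoc, keep_concat]
    exact ih.trans (List.prefix_append _ _)

theorem mem_keep {f : M → Option N} {s : JSeq M} {n : ℕ} :
    n ∈ keep f s ↔ ∃ m p, s[n]? = some (m, p) ∧ (f m).isSome := by
  simp only [keep, List.mem_filter, List.mem_range]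
  constructor
  · rintro ⟨h1, h2⟩
    rw [List.getElem?_eq_getElem h1] at h2
    exact ⟨_, _, List.getElem?_eq_getElem h1, h2⟩
  · rintro ⟨m, p, h1, h2⟩
    refine ⟨(List.getElem?_eq_some_iff.1 h1).1, ?_⟩
    rw [h1]
    exact h2

theorem keep_sorted (f : M → Option N) (s : JSeq M) : (keep f s).Pairwise (· < ·) :=
  List.Pairwise.filter _ List.pairwise_lt_range

/-- The number of kept occurrences in the prefix of length `n`. -/
def cnt (f : M → Option N) (s : JSeq M) (n : ℕ) : ℕ := (keep f (s.take n)).length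

@[simp] theorem cnt_zero (f : M → Option N) (s : JSeq M) : cnt f s 0 = 0 := by
  simp [cnt, keep]

theorem cnt_succ {f : M → Option N} {s : JSeq M} {n : ℕ} {x : M × Option ℕ}
    (h : s[n]? = some x) : cnt f s (n + 1) = cnt f s n + if (f x.1).isSome then 1 else 0 := by
  unfold cnt
  rw [List.take_add_one, h, Option.toList_some, keep_concat, List.length_append]
  congr 1
  split <;> simp

theorem cnt_length (f : M → Option N) (s : JSeq M) : cnt f s s.length = (keep f s).length := by
  simp [cnt]

/-- `cnt` turns the position of a kept occurrence into its index in the restriction, and `keep`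
turns the index back into the position. -/
theorem keep_getElem?_cnt {f : M → Option N} {s : JSeq M} {n : ℕ} {x : M × Option ℕ}
    (h : s[n]? = some x) (hx : (f x.1).isSome) : (keep f s)[cnt f s n]? = some n := by
  have h1 : keep f (s.take (n + 1)) = keep f (s.take n) ++ [n] := by
    have hn : n < s.length := (List.getElem?_eq_some_iff.1 h).1
    rw [List.take_add_one, h, Option.toList_some, keep_concat, hx, if_pos rfl,
      List.length_take, min_eq_left hn.le]
  have h2 : keep f (s.take n) ++ [n] <+: keep f s := by
    rw [← h1]
    conv_rhs => rw [← List.take_append_drop (n + 1) s]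
    exact keep_prefix _ _ _
  obtain ⟨t, ht⟩ := h2
  rw [← ht, List.append_assoc]
  simp [cnt]

theorem cnt_of_keep_getElem? {f : M → Option N} {s : JSeq M} {j n : ℕ}
    (h : (keep f s)[j]? = some n) : cnt f s n = j := by
  obtain ⟨m, p, h1, h2⟩ := mem_keep.1 (List.mem_of_getElem? h)
  exact idx_eq_of_sorted (keep_sorted f s) (keep_getElem?_cnt h1 h2) h

theorem cnt_mono (f : M → Option N) (s : JSeq M) {m n : ℕ} (h : m ≤ n) :
    cnt f s m ≤ cnt f s n := by
  unfold cnt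
  have : s.take n = s.take m ++ (s.take n).drop m := by
    conv_lhs => rw [← List.take_append_drop m (s.take n), List.take_take, min_eq_left h]
  rw [this]
  exact (keep_prefix _ _ _).length_le

theorem length_restr {f : M → Option N} {s : JSeq M} (hs : s.Backward) :
    (restr f s).length = (keep f s).length := by
  have h1 := congrArg List.length (restr_map_fst (f := f) hs)
  rw [List.length_map] at h1
  rw [h1]
  clear h1 hs
  induction s using List.reverseRecOn with
  | nil => rfl
  | append_singleton s x ih =>
    rw [keep_concat, List.filterMap_append, List.length_append, List.length_append, ih]
    congr 1
    cases h : f x.1 with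
    | none => simp [h]
    | some y => simp [h]

theorem restr_prefix {f : M → Option N} {s t : JSeq M} (h : JSeq.Backward (s ++ t)) :
    restr f s <+: restr f (s ++ t) := by
  induction t using List.reverseRecOn with
  | nil => simp
  | append_singleton t x ih =>
    rw [← List.append_assoc] at h ⊢
    obtain ⟨m, p⟩ := x
    have ih := ih h.of_append
    cases hm : f m with
    | none => rwa [restr_concat_none hm]
    | some y =>
      rw [restr_concat_some h hm]
      exact ih.trans (List.prefix_append _ _)

theorem restr_take {f : M → Option N} {s : JSeq M} (hs : s.Backward) (n : ℕ) :
    restr f (s.take n) = (restr f s).take (cnt f s n) := by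
  have h : restr f (s.take n) <+: restr f s := by
    conv_rhs => rw [← List.take_append_drop n s]
    apply restr_prefix
    rwa [List.take_append_drop]
  rw [List.prefix_iff_eq_take.1 h, length_restr (hs.take n), cnt]

end

namespace Arena

/-! ### Coloured plays -/

/-- The arena of `C` copies of `A`. -/
def copies (A : Arena.{u}) (C : Type) : Arena.{u} where
  Move := A.Move × C
  player m := A.player m.1
  kind m := A.kind m.1
  initial m := A.initial m.1
  enables m n := A.enables m.1 n.1 ∧ m.2 = n.2
  initial_player m h := A.initial_player m.1 h
  initial_kind m h := A.initial_kind m.1 h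
  initial_not_enabled m h n hn := A.initial_not_enabled m.1 h n.1 hn.1
  answer_enabled n m h hk := A.answer_enabled n.1 m.1 h.1 hk
  enables_player n m h := A.enables_player n.1 m.1 h.1

variable {A : Arena.{u}} {C : Type}

/-- The underlying move of a coloured move. -/
def base (m : (A.copies C).Move) : A.Move := m.1

/-- The colour of a coloured move. -/
def col (m : (A.copies C).Move) : C := m.2

theorem copies_player (m : (A.copies C).Move) : (A.copies C).player m = A.player (base m) := rfl

theorem copies_ext {m n : (A.copies C).Move} (h : base m = base n) (h' : col m = col n) : m = n :=
  Prod.ext h h'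

/-- The sequence underlying a coloured sequence. -/
def forget (s : JSeq (A.copies C).Move) : JSeq A.Move := s.map (Prod.map base id)

theorem getElem?_forget (s : JSeq (A.copies C).Move) (n : ℕ) :
    (forget s)[n]? = (s[n]?).map (Prod.map base id) := by
  simp [forget]

@[simp] theorem length_forget (s : JSeq (A.copies C).Move) : (forget s).length = s.length := by
  simp [forget]

theorem forget_append (s t : JSeq (A.copies C).Move) :
    forget (s ++ t) = forget s ++ forget t := by
  simp [forget]

theorem forget_take (s : JSeq (A.copies C).Move) (n : ℕ) :
    forget (s.take n) = (forget s).take n := by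
  simp [forget]

theorem isBy_comp_base (π : Player) : A.isBy π ∘ base = (A.copies C).isBy π := rfl

theorem vchain_forget (π : Player) (s : JSeq (A.copies C).Move) (n : ℕ) :
    vchain (A.isBy π) (forget s) n = vchain ((A.copies C).isBy π) s n := by
  rw [forget, vchain_map_labels, isBy_comp_base]

theorem vseq_forget (π : Player) (s : JSeq (A.copies C).Move) (n : ℕ) :
    vseq (A.isBy π) (forget s) n = forget (vseq ((A.copies C).isBy π) s n) := by
  rw [forget, vseq_map_labels, isBy_comp_base, forget]

theorem exists_of_getElem?_forget {s : JSeq (A.copies C).Move} {n : ℕ} {m : A.Move}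
    {p : Option ℕ} (h : (forget s)[n]? = some (m, p)) :
    ∃ m', s[n]? = some (m', p) ∧ base m' = m := by
  rw [getElem?_forget, Option.map_eq_some_iff] at h
  obtain ⟨⟨m', p'⟩, h1, h2⟩ := h
  obtain ⟨rfl, rfl⟩ := Prod.mk.inj h2
  exact ⟨m', h1, rfl⟩

theorem isLegal_forget {s : JSeq (A.copies C).Move} (hs : (A.copies C).IsLegal s) :
    A.IsLegal (forget s) := by
  apply IsLegal.of_visible
  · constructor
    · intro i m hx
      obtain ⟨m', h1, rfl⟩ := exists_of_getElem?_forget hx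
      exact hs.initial_of_none i m' h1
    · intro i m k hx
      obtain ⟨m', h1, rfl⟩ := exists_of_getElem?_forget hx
      obtain ⟨h2, x, h3, h4⟩ := hs.justified i m' k h1
      exact ⟨h2, Prod.map base id x, by rw [getElem?_forget, h3]; rfl, h4.1⟩
  · rintro i ⟨m, p⟩ ⟨m', p'⟩ hx hy
    obtain ⟨n, h1, rfl⟩ := exists_of_getElem?_forget hx
    obtain ⟨n', h2, rfl⟩ := exists_of_getElem?_forget hy
    exact hs.alternating i _ _ h1 h2
  · intro π i m k hx hm
    obtain ⟨m', h1, rfl⟩ := exists_of_getElem?_forget hx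
    rw [vchain_forget]
    exact hs.visible h1 hm

variable {s t : JSeq (A.copies C).Move}

/-- The colour at a position. -/
def colAt (s : JSeq (A.copies C).Move) (n : ℕ) : Option C := (s[n]?).map fun x => col x.1

theorem colAt_eq {n : ℕ} {m : (A.copies C).Move} {p : Option ℕ} (h : s[n]? = some (m, p)) :
    colAt s n = some (col m) := by
  simp [colAt, h]

theorem IsLegal.colAt_ptr (hs : (A.copies C).IsLegal s) {n k : ℕ} {m : (A.copies C).Move}
    (h : s[n]? = some (m, some k)) : colAt s k = colAt s n := by
  obtain ⟨-, ⟨m', p⟩, h1, h2⟩ := hs.justified n m k h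
  rw [colAt_eq h, colAt_eq h1]
  exact congrArg some h2.2

/-- A P-view stays within one colour. -/
theorem IsLegal.colAt_pview (hs : (A.copies C).IsLegal s) {n x : ℕ} (hn : n < s.length)
    (hx : x ∈ vchain ((A.copies C).isBy .O) s (n + 1)) : colAt s x = colAt s n := by
  induction n using Nat.strong_induction_on generalizing x with
  | _ n ih =>
    rw [vchain_succ hs.backward, List.mem_append, List.mem_singleton] at hx
    rcases hx with hx | rfl
    swap
    · rfl
    obtain ⟨⟨m, p⟩, hm⟩ : ∃ y, s[n]? = some y := ⟨_, List.getElem?_eq_getElem hn⟩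
    by_cases hp : (A.copies C).player m = .O
    · cases p with
      | none => 
        rw [prd_none hm (by simp [hp]), vchain_zero] at hx
        simp at hx
      | some k =>
        rw [prd_some hm (by simp [hp])] at hx
        have hk := hs.backward n m k hm
        rw [ih k hk (by omega) hx, hs.colAt_ptr hm]
    · rw [prd_of_not hm (by simp [hp])] at hx
      have hP : (A.copies C).player m = .P := by
        cases h : (A.copies C).player m <;> simp_all
      obtain ⟨k, rfl⟩ := hs.exists_ptr_of_P hm hP
      -- The justifier lies in the P-view of the preceding prefix, which has a single colour by
      -- induction. This links the colour of that view to the colour of the P-move.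
      have hk := hs.visible hm hp
      cases n with
      | zero => simp at hk
      | succ n =>
        rw [ih n (by omega) (by omega) hx, ← hs.colAt_ptr hm,
          ih n (by omega) (by omega) hk]

/-- P-moves do not change the colour. -/
theorem IsLegal.colAt_succ_of_P (hs : (A.copies C).IsLegal s) {n : ℕ} {m : (A.copies C).Move}
    {p : Option ℕ} (hm : s[n + 1]? = some (m, p)) (hP : (A.copies C).player m = .P) :
    colAt s n = colAt s (n + 1) := by
  obtain ⟨k, rfl⟩ := hs.exists_ptr_of_P hm hP
  have hlt : n + 1 < s.length := (List.getElem?_eq_some_iff.1 hm).1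
  have := hs.visible hm (π := .O) (by simp [hP])
  rw [← hs.colAt_pview (by omega) this, hs.colAt_ptr hm]

end Arena

/-! ### F-views: the view of the environment of the thread of colour `eq`. -/

namespace Arena

variable {A : Arena.{u}} {s t : JSeq (A.copies Ordering).Move}

/-- The P-moves of colour `eq`. -/
def inpF (m : (A.copies Ordering).Move) : Bool :=
  (A.copies Ordering).isBy .P m && decide (col m = .eq)

theorem inpF_eq_true {m : (A.copies Ordering).Move} :
    inpF m = true ↔ (A.copies Ordering).player m = .P ∧ col m = .eq := by
  simp [inpF]

theorem inpF_eq_false {m : (A.copies Ordering).Move} :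
    inpF m = false ↔ ((A.copies Ordering).player m = .P → col m ≠ .eq) := by
  rw [Bool.eq_false_iff, Ne, inpF_eq_true]
  tauto

/-- The F-view jumps at fewer moves than the O-view, so it should contain it. The two claims need
each other: the P-view jumps from an O-move to a justifier that is visible in the O-view, and the
O-view jumps from a P-move of another colour to a justifier that is visible in the P-view. At
P-moves of colour `eq` the F-view and the O-view jump together. The consequence is that the F-view
records enough for O, and for P outside the thread. -/
theorem IsLegal.views_subset (hs : (A.copies Ordering).IsLegal s) {n : ℕ} (hn : n ≤ s.length) :
    vchain ((A.copies Ordering).isBy .P) s n ⊆ vchain inpF s n ∧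
      ∀ k, n = k + 1 → colAt s k ≠ some .eq →
        vchain ((A.copies Ordering).isBy .O) s n ⊆ vchain inpF s n := by
  induction n using Nat.strong_induction_on with
  | _ n ih =>
    cases n with
    | zero => simp
    | succ n =>
      have hb := hs.backward
      obtain ⟨⟨m, p⟩, hm⟩ : ∃ y, s[n]? = some y := ⟨_, List.getElem?_eq_getElem (by omega)⟩
      have hcol := colAt_eq hm
      rw [vchain_succ (inp := inpF) hb]
      have hself : n ∈ vchain inpF s (prd inpF s n) ++ [n] := by simp
      cases hP : (A.copies Ordering).player m with
      | O =>
        rw [prd_of_not (inp := inpF) hm (by simp [inpF_eq_false, hP])] at hself ⊢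
        constructor
        · rw [vchain_succ hb, prd_of_not hm (by simp [hP])]
          exact List.append_subset.2
            ⟨fun x hx => List.mem_append_left _ ((ih n (by omega) (by omega)).1 hx), by simp⟩
        · rintro _ ⟨⟩ hne
          rw [vchain_succ hb]
          refine List.append_subset.2 ⟨?_, by simp⟩
          cases p with
          | none => rw [prd_none hm (by simp [hP])]; simp
          | some k =>
            rw [prd_some hm (by simp [hP])]
            have hk := hb n m k hm
            have h1 := (ih (k + 1) (by omega) (by omega)).2 k rfl
              (by rwa [hs.colAt_ptr hm])
            have h2 := (ih n (by omega) (by omega)).1 (hs.visible hm (π := .P) (by simp [hP]))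
            intro x hx
            exact List.mem_append_left _ (mem_chain_trans h2 (h1 hx))
      | P =>
        obtain ⟨k, rfl⟩ := hs.exists_ptr_of_P hm hP
        have hk := hb n m k hm
        by_cases hc : col m = .eq
        · constructor
          · rw [prd_some (inp := inpF) hm (inpF_eq_true.2 ⟨hP, hc⟩), vchain_succ hb,
              prd_some hm (by simp [hP])]
            exact List.append_subset.2 ⟨fun x hx => List.mem_append_left _
              ((ih (k + 1) (by omega) (by omega)).1 hx), by simp⟩
          · rintro _ ⟨⟩ hne
            rw [hcol, hc] at hne
            exact absurd rfl hne
        · rw [prd_of_not (inp := inpF) hm (inpF_eq_false.2 fun _ => hc)] at hself ⊢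
          have hpv : vchain ((A.copies Ordering).isBy .O) s n ⊆ vchain inpF s n := by
            cases n with
            | zero => simp
            | succ n =>
              refine (ih (n + 1) (by omega) (by omega)).2 n rfl ?_
              rw [hs.colAt_succ_of_P hm hP, hcol]
              simpa using hc
          constructor
          · rw [vchain_succ hb, prd_some hm (by simp [hP])]
            refine List.append_subset.2 ⟨?_, by simp⟩
            have h2 := hpv (hs.visible hm (π := .O) (by simp [hP]))
            intro x hx
            exact List.mem_append_left _ (mem_chain_trans h2
              ((ih (k + 1) (by omega) (by omega)).1 hx))
          · rintro _ ⟨⟩ hne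
            rw [vchain_succ hb, prd_of_not hm (by simp [hP])]
            exact List.append_subset.2 ⟨fun x hx => List.mem_append_left _ (hpv hx), by simp⟩

/-- The F-view of a play contains the justifiers of its occurrences. -/
theorem IsLegal.inpF_closed (hs : (A.copies Ordering).IsLegal s) {n x k : ℕ}
    {m : (A.copies Ordering).Move} (hx : x ∈ vchain inpF s n)
    (hm : s[x]? = some (m, some k)) : k ∈ vchain inpF s n := by
  have hlt : x < s.length := (List.getElem?_eq_some_iff.1 hm).1
  refine mem_chain_trans hx ?_
  change k ∈ vchain inpF s (x + 1)
  by_cases h : inpF m = true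
  · rw [vchain_succ hs.backward, prd_some hm h]
    exact List.mem_append_left _ (mem_chain_self _ _)
  · rw [Bool.not_eq_true] at h
    rw [vchain_succ hs.backward, prd_of_not hm h]
    apply List.mem_append_left
    cases hP : (A.copies Ordering).player m with
    | O => exact (hs.views_subset hlt.le).1 (hs.visible hm (by simp [hP]))
    | P =>
      have h1 := hs.visible hm (π := .O) (by simp [hP])
      cases x with
      | zero => simp at h1
      | succ x =>
        refine (hs.views_subset hlt.le).2 x rfl ?_ h1
        rw [hs.colAt_succ_of_P hm hP, colAt_eq hm]
        simpa using inpF_eq_false.1 h hP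

theorem inpF_pred {n x : ℕ}
    {m : (A.copies Ordering).Move} {p : Option ℕ} (hx : x + 1 ∈ vchain inpF s n)
    (hm : s[x + 1]? = some (m, p)) (h : (A.copies Ordering).player m = .P → col m ≠ .eq) :
    x ∈ vchain inpF s n :=
  chain_pred_mem hx (prd_of_not hm (inpF_eq_false.2 h)) (by omega)

/-- O-views can be computed in F-views. -/
theorem IsLegal.oview_inpF (hs : (A.copies Ordering).IsLegal s) {n j x : ℕ} (hn : n ≤ s.length)
    (hj : (vchain inpF s n)[j]? = some x) :
    vchain ((A.copies Ordering).isBy .P) s (x + 1) =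
      (vchain ((A.copies Ordering).isBy .P) (vseq inpF s n) (j + 1)).map
        ((vchain inpF s n).getD · 0) := by
  refine vchain_sub hs.backward (vchain_sorted _ _ _) (vchain_lt hn) (fun _ => True) ?_ hj trivial
  intro y hy _ m p hm
  constructor
  · rintro - k rfl
    exact ⟨hs.inpF_closed hy hm, trivial⟩
  · rintro h k rfl
    exact ⟨inpF_pred hy hm (fun hP => absurd hP (by simpa using h)), trivial⟩

/-- P-views outside colour `eq` can be computed in F-views. -/
theorem IsLegal.pview_inpF (hs : (A.copies Ordering).IsLegal s) {n j x : ℕ} (hn : n ≤ s.length)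
    (hj : (vchain inpF s n)[j]? = some x) (hc : colAt s x ≠ some .eq) :
    vchain ((A.copies Ordering).isBy .O) s (x + 1) =
      (vchain ((A.copies Ordering).isBy .O) (vseq inpF s n) (j + 1)).map
        ((vchain inpF s n).getD · 0) := by
  refine vchain_sub hs.backward (vchain_sorted _ _ _) (vchain_lt hn)
    (fun y => colAt s y ≠ some .eq) ?_ hj hc
  intro y hy hyc m p hm
  constructor
  · rintro - k rfl
    exact ⟨hs.inpF_closed hy hm, by rwa [hs.colAt_ptr hm]⟩
  · rintro h k rfl
    have hP : (A.copies Ordering).player m = .P := by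
      rw [isBy_eq_false] at h
      cases h' : (A.copies Ordering).player m <;> simp_all
    refine ⟨inpF_pred hy hm fun _ => ?_, by rwa [hs.colAt_succ_of_P hm hP]⟩
    rw [colAt_eq hm] at hyc
    simpa using hyc

end Arena

namespace Arena

variable {A : Arena.{u}} {s t : JSeq (A.copies Ordering).Move}

/-! ### The thread of colour `eq` -/

/-- Moves of colour `eq`. -/
def thr (m : (A.copies Ordering).Move) : Option A.Move :=
  if col m = .eq then some (base m) else none

theorem thr_eq {m : (A.copies Ordering).Move} (h : col m = .eq) : thr m = some (base m) :=
  if_pos h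

theorem thr_ne {m : (A.copies Ordering).Move} (h : col m ≠ .eq) : thr m = none := if_neg h

theorem thr_isSome {m : (A.copies Ordering).Move} : (thr m).isSome ↔ col m = .eq := by
  unfold thr
  split <;> simp [*]

/-- The thread of colour `eq`. -/
def thread (s : JSeq (A.copies Ordering).Move) : JSeq A.Move := restr thr s

theorem mem_keep_thr {n : ℕ} : n ∈ keep thr s ↔ colAt s n = some .eq := by
  rw [mem_keep]
  constructor
  · rintro ⟨m, p, h1, h2⟩
    rw [colAt_eq h1, thr_isSome.1 h2]
  · intro h
    simp only [colAt, Option.map_eq_some_iff] at h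
    obtain ⟨⟨m, p⟩, h1, h2⟩ := h
    exact ⟨m, p, h1, thr_isSome.2 h2⟩

theorem thread_eq : thread s = forget (s.sub (keep thr s)) := by
  unfold thread restr forget
  rw [← List.filterMap_eq_map, List.filterMap_congr]
  rintro ⟨m, q⟩ hx
  obtain ⟨j, hj⟩ := List.mem_iff_getElem?.1 hx
  obtain ⟨n, p, h1, h2, -⟩ := JSeq.exists_of_getElem?_sub keep_lt hj
  have h3 := mem_keep_thr.1 (List.mem_of_getElem? h1)
  rw [colAt_eq h2, Option.some.injEq] at h3
  simp [thr_eq h3]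

theorem length_thread : (thread s).length = (keep thr s).length := by
  rw [thread_eq, length_forget, JSeq.length_sub keep_lt]

theorem cnt_thr_succ {n : ℕ} {m : (A.copies Ordering).Move} {p : Option ℕ}
    (h : s[n]? = some (m, p)) :
    cnt thr s (n + 1) = cnt thr s n + if col m = .eq then 1 else 0 := by
  rw [cnt_succ h]
  simp only [thr_isSome]

theorem cnt_thr_succ_eq {n : ℕ} (h : colAt s n = some .eq) :
    cnt thr s (n + 1) = cnt thr s n + 1 := by
  simp only [colAt, Option.map_eq_some_iff] at h
  obtain ⟨⟨m, p⟩, h1, h2⟩ := h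
  rw [cnt_thr_succ h1, if_pos h2]

theorem keep_thr_cnt {n : ℕ} (h : colAt s n = some .eq) : (keep thr s)[cnt thr s n]? = some n := by
  simp only [colAt, Option.map_eq_some_iff] at h
  obtain ⟨⟨m, p⟩, h1, h2⟩ := h
  exact keep_getElem?_cnt h1 (thr_isSome.2 h2)

theorem IsLegal.keep_thr_ptr (hs : (A.copies Ordering).IsLegal s) {n k : ℕ}
    {m : (A.copies Ordering).Move} (hn : n ∈ keep thr s) (h : s[n]? = some (m, some k)) :
    k ∈ keep thr s := by
  rw [mem_keep_thr] at hn ⊢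
  rw [hs.colAt_ptr h, hn]

/-- Justifiers have the colour of the move they justify, so no pointer is lost in the thread; `cnt`
renumbers it. -/
theorem IsLegal.thread_getElem? (hs : (A.copies Ordering).IsLegal s) {n : ℕ}
    {m : (A.copies Ordering).Move} {p : Option ℕ} (h : s[n]? = some (m, p)) (hm : col m = .eq) :
    (thread s)[cnt thr s n]? = some (base m, p.map (cnt thr s)) := by
  have hn : colAt s n = some .eq := by rw [colAt_eq h, hm]
  rw [thread_eq, getElem?_forget, JSeq.getElem?_sub_of keep_lt (keep_thr_cnt hn) h]
  have : (p.bind fun k => (keep thr s).idxOf? k) = p.map (cnt thr s) := by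
    cases p with
    | none => rfl
    | some k =>
      rw [Option.bind_some, Option.map_some, idxOf?_eq_some_of_nodup
        (nodup_of_sorted (keep_sorted _ _))]
      apply keep_thr_cnt
      rw [hs.colAt_ptr h, hn]
  rw [this]
  rfl

theorem exists_of_getElem?_thread {j : ℕ} {m : A.Move} {p : Option ℕ}
    (h : (thread s)[j]? = some (m, p)) :
    ∃ n m' p', (keep thr s)[j]? = some n ∧ s[n]? = some (m', p') ∧ col m' = .eq ∧
      base m' = m ∧ cnt thr s n = j := by
  rw [thread_eq] at h
  obtain ⟨m', h1, rfl⟩ := exists_of_getElem?_forget h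
  obtain ⟨n, p', h2, h3, -⟩ := JSeq.exists_of_getElem?_sub keep_lt h1
  have h4 := mem_keep_thr.1 (List.mem_of_getElem? h2)
  rw [colAt_eq h3, Option.some.injEq] at h4
  exact ⟨n, m', p', h2, h3, h4, rfl, cnt_of_keep_getElem? h2⟩

/-- Among the positions of colour `eq`, the F-view goes from a P-move to its justifier and from an
O-move, through positions of other colours one by one, to the preceding occurrence of the thread.
That is the recursion for the O-view of the thread. -/
theorem IsLegal.vchain_oview_thread (hs : (A.copies Ordering).IsLegal s) {n : ℕ}
    (hn : n ≤ s.length) :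
    (vchain (A.isBy .P) (thread s) (cnt thr s n)).map ((keep thr s).getD · 0) =
      (vchain inpF s n).filter fun k => decide (colAt s k = some .eq) := by
  induction n using Nat.strong_induction_on with
  | _ n ih =>
    cases n with
    | zero => simp
    | succ n =>
      obtain ⟨⟨m, p⟩, hm⟩ : ∃ y, s[n]? = some y := ⟨_, List.getElem?_eq_getElem (by omega)⟩
      have hb : (thread s).Backward := by
        intro j m k hj
        obtain ⟨n, m', p', h1, h2, h3, h4, rfl⟩ := exists_of_getElem?_thread hj
        rw [hs.thread_getElem? h2 h3] at hj
        simp only [Option.some.injEq, Prod.mk.injEq, Option.map_eq_some_iff] at hj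
        obtain ⟨-, k, rfl, rfl⟩ := hj
        have hk := hs.backward n m' k h2
        have hkc : colAt s k = some .eq := by rw [hs.colAt_ptr h2, colAt_eq h2, h3]
        have := cnt_mono thr s hk
        rw [Nat.succ_eq_add_one, cnt_thr_succ_eq hkc] at this
        omega
      rw [vchain_succ hs.backward, List.filter_append, cnt_thr_succ hm]
      by_cases hc : col m = .eq
      · have hce : colAt s n = some .eq := by rw [colAt_eq hm, hc]
        have hT := hs.thread_getElem? hm hc
        rw [if_pos hc, vchain_succ hb, List.map_append]
        congr 1
        · cases hP : (A.copies Ordering).player m with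
          | O =>
            rw [prd_of_not hm (inpF_eq_false.2 (by simp [hP])),
              prd_of_not hT (isBy_eq_false.2 (by rw [← copies_player, hP]; simp)),
              ih n (by omega) (by omega)]
          | P =>
            obtain ⟨k, rfl⟩ := hs.exists_ptr_of_P hm hP
            have hk := hs.backward n m k hm
            rw [prd_some hm (inpF_eq_true.2 ⟨hP, hc⟩), Option.map_some] at *
            rw [prd_some hT (isBy_eq_true.2 (by rw [← copies_player, hP])),
              ← cnt_thr_succ_eq (by rw [hs.colAt_ptr hm, hce]), ih (k + 1) (by omega) (by omega)]
        · simp [hce, List.getD, keep_thr_cnt hce]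
      · rw [if_neg hc, prd_of_not hm (inpF_eq_false.2 fun _ => hc), Nat.add_zero,
          ih n (by omega) (by omega)]
        simp [colAt_eq hm, hc]

/-- P-moves do not change the colour and pointers stay in one colour, so every step of a P-view that
starts in the thread remains in the thread. -/
theorem IsLegal.vchain_pview_thread (hs : (A.copies Ordering).IsLegal s) {j x : ℕ}
    (hj : (keep thr s)[j]? = some x) :
    vchain ((A.copies Ordering).isBy .O) s (x + 1) =
      (vchain ((A.copies Ordering).isBy .O) (s.sub (keep thr s)) (j + 1)).map
        ((keep thr s).getD · 0) ∧
    vseq ((A.copies Ordering).isBy .O) s (x + 1) =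
      vseq ((A.copies Ordering).isBy .O) (s.sub (keep thr s)) (j + 1) := by
  have key : ∀ n ∈ keep thr s, True → ∀ m p, s[n]? = some (m, p) →
      ((A.copies Ordering).isBy .O m = true → ∀ k, p = some k → k ∈ keep thr s ∧ True) ∧
      ((A.copies Ordering).isBy .O m = false → ∀ k, n = k + 1 → k ∈ keep thr s ∧ True) := by
    rintro n hn - m p hm
    constructor
    · rintro - k rfl
      exact ⟨hs.keep_thr_ptr hn hm, trivial⟩
    · rintro h k rfl
      have hP : (A.copies Ordering).player m = .P := by
        rw [isBy_eq_false] at h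
        cases h' : (A.copies Ordering).player m <;> simp_all
      rw [mem_keep_thr] at hn ⊢
      exact ⟨by rw [hs.colAt_succ_of_P hm hP, hn], trivial⟩
  exact ⟨vchain_sub hs.backward (keep_sorted _ _) keep_lt (fun _ => True) key hj trivial,
    vseq_sub hs.backward (keep_sorted _ _) keep_lt (fun _ => True) key hj trivial⟩

/-- P-views in the thread are P-views of the play. -/
theorem IsLegal.pview_thread (hs : (A.copies Ordering).IsLegal s) {j x : ℕ}
    (hj : (keep thr s)[j]? = some x) :
    vseq (A.isBy .O) (forget s) (x + 1) = vseq (A.isBy .O) (thread s) (j + 1) := by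
  rw [vseq_forget, (hs.vchain_pview_thread hj).2, thread_eq, vseq_forget]

/-- Only O can switch between threads, which gives alternation. Visibility for P holds because
P-views of the thread are P-views of the play. For O, a justifier visible in the play lies in the
F-view, and the part of the F-view of colour `eq` is the O-view of the thread. -/
theorem IsLegal.isLegal_thread (hs : (A.copies Ordering).IsLegal s) : A.IsLegal (thread s) := by
  rw [thread_eq]
  apply isLegal_forget
  have hsort := keep_sorted (thr (A := A)) s
  apply hs.sub hsort keep_lt
  · intro n hn m k hm
    exact hs.keep_thr_ptr hn hm
  · rintro i n n' ⟨m, p⟩ ⟨m', p'⟩ hn hn' hm hm'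
    have hlt := lt_of_sorted hsort hn hn' (by omega)
    have hlen := keep_lt n' (List.mem_of_getElem? hn')
    have hadj : n' = n + 1 → (A.copies Ordering).player m ≠ (A.copies Ordering).player m' := by
      rintro rfl
      exact hs.alternating n _ _ hm hm'
    have hmid : ∀ l, n < l → l < n' → colAt s l ≠ some .eq := by
      intro l h1 h2 h3
      obtain ⟨j, hj⟩ := exists_getElem?_of_mem (mem_keep_thr.2 h3)
      have := idx_lt_of_sorted hsort hn hj h1
      have := idx_lt_of_sorted hsort hj hn' h2
      omega
    have hce := mem_keep_thr.1 (List.mem_of_getElem? hn)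
    have hce' := mem_keep_thr.1 (List.mem_of_getElem? hn')
    -- A P-move of the thread directly follows a move of the thread, and after an O-move of the
    -- thread the next move of the play is a P-move of the thread. So two neighbours in the thread
    -- of which one is such a move are adjacent in the play.
    cases hP' : (A.copies Ordering).player m' with
    | P =>
      obtain ⟨l, rfl⟩ : ∃ l, n' = l + 1 := ⟨n' - 1, by omega⟩
      rw [← hP']
      apply hadj
      by_contra hne
      refine hmid l (by omega) (by omega) ?_
      rw [hs.colAt_succ_of_P hm' hP', hce']
    | O =>
      intro hP
      dsimp only at hP
      obtain ⟨⟨m₁, p₁⟩, hm₁⟩ : ∃ y, s[n + 1]? = some y :=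
        ⟨_, List.getElem?_eq_getElem (by omega)⟩
      have hP₁ : (A.copies Ordering).player m₁ = .P := by
        have := hs.alternating n _ _ hm hm₁
        dsimp only at this
        cases h' : (A.copies Ordering).player m₁ <;> simp_all
      have h1 : n + 1 = n' := by
        by_contra hne
        refine hmid (n + 1) (by omega) (by omega) ?_
        rw [← hs.colAt_succ_of_P hm₁ hP₁, hce]
      exact hadj h1.symm (by rw [hP, hP'])
  · intro π j n m k hj hm hπ
    have hlen := keep_lt n (List.mem_of_getElem? hj)
    have hce := mem_keep_thr.1 (List.mem_of_getElem? hj)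
    cases π with
    | O =>
      have hP : (A.copies Ordering).player m = .P := by
        cases h' : (A.copies Ordering).player m <;> simp_all
      have hk := hs.visible hm hπ
      cases n with
      | zero => simp at hk
      | succ n =>
        have hn : n ∈ keep thr s := by
          rw [mem_keep_thr, hs.colAt_succ_of_P hm hP, hce]
        obtain ⟨i, hi⟩ := exists_getElem?_of_mem hn
        obtain rfl := adjacent_of_sorted hsort hi hj
        rw [(hs.vchain_pview_thread hi).1, List.mem_map] at hk
        obtain ⟨l, hl, rfl⟩ := hk
        refine ⟨l, hl, ?_⟩
        have h1 := lt_of_mem_chain hl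
        have h2 := (List.getElem?_eq_some_iff.1 hj).1
        rw [List.getElem?_eq_getElem (by omega)]
        simp [List.getD, show l < (keep thr s).length by omega]
    | P =>
      have hk := (hs.views_subset hlen.le).1 (hs.visible hm hπ)
      have hk' : k ∈ (vchain inpF s n).filter fun k => decide (colAt s k = some .eq) := by
        rw [List.mem_filter]
        refine ⟨hk, ?_⟩
        rw [hs.colAt_ptr hm, hce]
        simp
      rw [← hs.vchain_oview_thread hlen.le, cnt_of_keep_getElem? hj, List.mem_map, thread_eq,
        vchain_forget] at hk'
      obtain ⟨l, hl, rfl⟩ := hk'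
      refine ⟨l, hl, ?_⟩
      have h1 := lt_of_mem_chain hl
      have h2 := (List.getElem?_eq_some_iff.1 hj).1
      rw [List.getElem?_eq_getElem (by omega)]
      simp [List.getD, show l < (keep thr s).length by omega]

theorem keep_sub_map {L : List ℕ} (hr : ∀ i ∈ L, i < s.length) :
    (keep thr (s.sub L)).map (L.getD · 0) =
      L.filter fun k => decide (colAt s k = some .eq) := by
  have h : L = (List.range L.length).map (L.getD · 0) := by
    apply List.ext_getElem?
    intro j
    rw [List.getElem?_map]
    by_cases hj : j < L.length
    · simp [hj, List.getD]
    · simp [hj]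
  conv_rhs => rw [h, List.filter_map]
  unfold keep
  rw [JSeq.length_sub hr]
  congr 1
  apply List.filter_congr
  intro j hj
  rw [List.mem_range] at hj
  obtain ⟨⟨m, p⟩, hm⟩ : ∃ y, s[L[j]]? = some y :=
    ⟨_, List.getElem?_eq_getElem (hr _ (List.getElem_mem hj))⟩
  rw [JSeq.getElem?_sub_of hr (List.getElem?_eq_getElem hj) hm]
  simp only [Option.bind_some, Function.comp, List.getD, List.getElem?_eq_getElem hj,
    Option.getD_some, colAt_eq hm, Option.some.injEq]
  rw [Bool.eq_iff_iff, thr_isSome, decide_eq_true_iff]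

/-- O-views of the thread are the threads of F-views. -/
theorem IsLegal.oview_thread (hs : (A.copies Ordering).IsLegal s) {n : ℕ} (hn : n ≤ s.length) :
    vseq (A.isBy .P) (thread s) (cnt thr s n) = thread (vseq inpF s n) := by
  have hc : cnt thr s n ≤ (keep thr s).length := by
    rw [← cnt_length]
    exact cnt_mono _ _ hn
  have hr : ∀ i ∈ keep thr (vseq inpF s n), i < (vchain inpF s n).length := by
    intro i hi
    have := keep_lt i hi
    rwa [length_vseq hn] at this
  unfold vseq at hr
  have h1 : thread (vseq inpF s n) = forget (s.sub ((vchain inpF s n).filter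
      fun k => decide (colAt s k = some .eq))) := by
    rw [vseq, thread_eq, ← keep_sub_map (vchain_lt hn), JSeq.sub_map (vchain_lt hn)
      (nodup_of_sorted (vchain_sorted _ _ _)) hr]
  rw [h1, ← hs.vchain_oview_thread hn, JSeq.sub_map keep_lt (nodup_of_sorted (keep_sorted _ _)),
    vseq, thread_eq, forget, forget, JSeq.map_sub]
  intro i hi
  have := lt_of_mem_chain hi
  omega

theorem thread_take (hs : s.Backward) (n : ℕ) :
    thread (s.take n) = (thread s).take (cnt thr s n) := restr_take hs n

end Arena
namespace Arena

variable {A : Arena.{u}} {s t : JSeq A.Move}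

/-! ### Bracketing -/

/-- The stack of open questions of the prefix of length `n`. -/
def opens (A : Arena.{u}) (s : JSeq A.Move) : ℕ → List ℕ
  | 0 => []
  | n + 1 =>
    match s[n]? with
    | none => opens A s n
    | some (m, _) =>
      match A.kind m with
      | .Q => n :: opens A s n
      | .A => (opens A s n).tail

/-- Well-bracketing of the prefix of length `n`, in terms of the stack of open questions. -/
def Bracketed (A : Arena.{u}) (s : JSeq A.Move) (n : ℕ) : Prop :=
  ∀ j < n, ∀ m p, s[j]? = some (m, p) → A.kind m = .A →
    ∃ k, p = some k ∧ (A.opens s j).head? = some k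

theorem opens_succ_question {n : ℕ} {m : A.Move} {p : Option ℕ} (h : s[n]? = some (m, p))
    (hm : A.kind m = .Q) : A.opens s (n + 1) = n :: A.opens s n := by
  rw [opens, h]
  simp only [hm]

theorem opens_succ_answer {n : ℕ} {m : A.Move} {p : Option ℕ} (h : s[n]? = some (m, p))
    (hm : A.kind m = .A) : A.opens s (n + 1) = (A.opens s n).tail := by
  rw [opens, h]
  simp only [hm]

theorem Bracketed.mono {n k : ℕ} (h : A.Bracketed s n) (hk : k ≤ n) : A.Bracketed s k :=
  fun j hj => h j (by omega)

theorem opens_lt {n i : ℕ} (h : i ∈ A.opens s n) :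
    i < n ∧ ∃ m p, s[i]? = some (m, p) ∧ A.kind m = .Q := by
  induction n with
  | zero => simp [opens] at h
  | succ n ih =>
    have ih' : i ∈ A.opens s n → i < n + 1 ∧ ∃ m p, s[i]? = some (m, p) ∧ A.kind m = .Q :=
      fun h => ⟨by have := (ih h).1; omega, (ih h).2⟩
    cases hx : s[n]? with
    | none =>
      rw [opens, hx] at h
      exact ih' h
    | some x =>
      obtain ⟨m, p⟩ := x
      cases hm : A.kind m with
      | Q =>
        rw [opens_succ_question hx hm, List.mem_cons] at h
        rcases h with rfl | h
        · exact ⟨by omega, m, p, hx, hm⟩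
        · exact ih' h
      | A =>
        rw [opens_succ_answer hx hm] at h
        exact ih' (List.mem_of_mem_tail h)

theorem opens_sorted (s : JSeq A.Move) (n : ℕ) : (A.opens s n).Pairwise (· > ·) := by
  induction n with
  | zero => simp [opens]
  | succ n ih =>
    cases hx : s[n]? with
    | none => rwa [opens, hx]
    | some x =>
      obtain ⟨m, p⟩ := x
      cases hm : A.kind m with
      | Q =>
        rw [opens_succ_question hx hm, List.pairwise_cons]
        exact ⟨fun i hi => (opens_lt hi).1, ih⟩
      | A =>
        rw [opens_succ_answer hx hm]
        exact ih.tail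

theorem opens_congr {n : ℕ} (h : ∀ j < n, s[j]? = t[j]?) : A.opens s n = A.opens t n := by
  induction n with
  | zero => rfl
  | succ n ih =>
    rw [opens, opens, h n (by omega), ih fun j hj => h j (by omega)]

theorem Bracketed.congr {n : ℕ} (h : ∀ j < n, s[j]? = t[j]?) (hs : A.Bracketed s n) :
    A.Bracketed t n := by
  intro j hj m p hx hm
  rw [← h j hj] at hx
  rw [← opens_congr fun i hi => h i (by omega)]
  exact hs j hj m p hx hm

/-- Below an open question the stack is the one from which the question was asked. -/
theorem opens_eq_append {n k : ℕ} {l r : List ℕ} (h : A.opens s n = l ++ k :: r) :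
    r = A.opens s k := by
  induction n generalizing l with
  | zero => simp [opens] at h
  | succ n ih =>
    cases hx : s[n]? with
    | none =>
      rw [opens, hx] at h
      exact ih h
    | some x =>
      obtain ⟨m, p⟩ := x
      cases hm : A.kind m with
      | Q =>
        rw [opens_succ_question hx hm] at h
        cases l with
        | nil =>
          rw [List.nil_append, List.cons.injEq] at h
          obtain ⟨rfl, h⟩ := h
          exact h.symm
        | cons a l => exact ih (List.cons.inj h).2
      | A =>
        rw [opens_succ_answer hx hm] at h
        cases ho : A.opens s n with
        | nil => rw [ho] at h; simp at h
        | cons b o =>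
          rw [ho, List.tail_cons] at h
          exact ih (l := b :: l) (by rw [ho, h]; rfl)

theorem opens_of_head? {n k : ℕ} (h : (A.opens s n).head? = some k) :
    A.opens s n = k :: A.opens s k := by
  cases ho : A.opens s n with
  | nil => rw [ho] at h; cases h
  | cons b o =>
    rw [ho, List.head?_cons, Option.some.injEq] at h
    subst h
    rw [← opens_eq_append (l := []) ho]

/-- Under bracketing every answer points at the top of the stack, so popping removes precisely the
question that is answered. -/
theorem Bracketed.mem_opens {n i : ℕ} (h : A.Bracketed s n) (hn : n ≤ s.length) :
    i ∈ A.opens s n ↔ i < n ∧ (∃ m p, s[i]? = some (m, p) ∧ A.kind m = .Q) ∧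
      ∀ j < n, ∀ m p, s[j]? = some (m, p) → A.kind m = .A → p ≠ some i := by
  induction n with
  | zero => simp [opens]
  | succ n ih =>
    have ih := ih (h.mono (by omega)) (by omega)
    obtain ⟨⟨m, p⟩, hx⟩ : ∃ x, s[n]? = some x := ⟨_, List.getElem?_eq_getElem (by omega)⟩
    cases hm : A.kind m with
    | Q =>
      rw [opens_succ_question hx hm, List.mem_cons, ih]
      constructor
      · rintro (rfl | ⟨h1, h2, h3⟩)
        · refine ⟨by omega, ⟨m, p, hx, hm⟩, ?_⟩
          rintro j hj m' p' hx' hm' rfl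
          obtain ⟨k, hk, hk'⟩ := h j hj m' _ hx' hm'
          obtain rfl := Option.some.inj hk
          have := (opens_lt (List.mem_of_mem_head? hk')).1
          omega
        · refine ⟨by omega, h2, fun j hj m' p' hx' hm' => ?_⟩
          rcases Nat.lt_succ_iff_lt_or_eq.1 hj with hj | rfl
          · exact h3 j hj m' p' hx' hm'
          · rw [hx, Option.some.injEq, Prod.mk.injEq] at hx'
            rw [← hx'.1, hm] at hm'
            cases hm'
      · rintro ⟨h1, h2, h3⟩
        rcases Nat.lt_succ_iff_lt_or_eq.1 h1 with hj | rfl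
        · exact Or.inr ⟨hj, h2, fun j hj => h3 j (by omega)⟩
        · exact Or.inl rfl
    | A =>
      obtain ⟨k, rfl, hk⟩ := h n (by omega) m p hx hm
      have ho := opens_of_head? hk
      have hsort := opens_sorted s n
      rw [ho, List.pairwise_cons] at hsort
      rw [opens_succ_answer hx hm, ho, List.tail_cons]
      rw [ho, List.mem_cons] at ih
      constructor
      · intro hi
        obtain ⟨h1, h2, h3⟩ := ih.1 (Or.inr hi)
        refine ⟨by omega, h2, fun j hj m' p' hx' hm' => ?_⟩
        rcases Nat.lt_succ_iff_lt_or_eq.1 hj with hj | rfl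
        · exact h3 j hj m' p' hx' hm'
        · rw [hx, Option.some.injEq, Prod.mk.injEq] at hx'
          have := hsort.1 i hi
          rw [← hx'.2, Ne, Option.some.injEq]
          omega
      · rintro ⟨h1, ⟨m', p', h2, h2'⟩, h3⟩
        have hin : i ≠ n := by
          rintro rfl
          rw [hx, Option.some.injEq, Prod.mk.injEq] at h2
          rw [← h2.1, hm] at h2'
          cases h2'
        rcases ih.2 ⟨by omega, ⟨m', p', h2, h2'⟩, fun j hj => h3 j (by omega)⟩ with rfl | h4
        · exact absurd rfl (h3 n (by omega) m _ hx hm)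
        · exact h4

theorem Bracketed.unanswered_iff (h : A.Bracketed s s.length) {i : ℕ} :
    A.Unanswered s i ↔ i ∈ A.opens s s.length := by
  rw [h.mem_opens le_rfl]
  constructor
  · rintro ⟨⟨⟨m, p⟩, h1, h2⟩, h3⟩
    exact ⟨(List.getElem?_eq_some_iff.1 h1).1, ⟨m, p, h1, h2⟩,
      fun j _ m p hx hm => h3 j (m, p) hx hm⟩
  · rintro ⟨h1, ⟨m, p, h2, h3⟩, h4⟩
    exact ⟨⟨(m, p), h2, h3⟩, fun j y hy hm =>
      h4 j (List.getElem?_eq_some_iff.1 hy).1 y.1 y.2 hy hm⟩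

theorem Bracketed.complete_iff (h : A.Bracketed s s.length) :
    A.Complete s ↔ A.opens s s.length = [] := by
  simp only [Complete, h.unanswered_iff, List.eq_nil_iff_forall_not_mem]

theorem Bracketed.isPending_iff (h : A.Bracketed s s.length) {i : ℕ} :
    A.IsPending s i ↔ (A.opens s s.length).head? = some i := by
  simp only [IsPending, h.unanswered_iff]
  have hsort := opens_sorted s s.length
  cases ho : A.opens s s.length with
  | nil => simp
  | cons b o =>
    rw [ho, List.pairwise_cons] at hsort
    rw [List.head?_cons, Option.some.injEq]
    constructor
    · rintro ⟨h1, h2⟩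
      have h3 := h2 b (by simp)
      rcases List.mem_cons.1 h1 with rfl | h1
      · rfl
      · have := hsort.1 i h1
        omega
    · rintro rfl
      refine ⟨by simp, fun j hj => ?_⟩
      rcases List.mem_cons.1 hj with rfl | hj
      · rfl
      · exact (hsort.1 j hj).le

theorem Bracketed.wellBracketed (h : A.Bracketed s s.length) : A.WellBracketed s := by
  rintro _ ⟨v, rfl⟩ w x rfl hx
  have h1 : ∀ j < w.length, (w ++ [x] ++ v)[j]? = w[j]? := by
    intro j hj
    rw [List.append_assoc, List.getElem?_append_left hj]
  obtain ⟨k, hk, hk'⟩ := h w.length (by simp) x.1 x.2 (by simp) hx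
  refine ⟨k, hk, ?_⟩
  have h2 : A.Bracketed w w.length := (h.mono (by simp)).congr h1
  rw [h2.isPending_iff, ← opens_congr h1, hk']

/-- The pending question can be read off from the view of the player whose move was last. -/
theorem IsLegal.bracketed_vseq (hs : A.IsLegal s) {π : Player} {n : ℕ} (hn : n ≤ s.length)
    (hb : A.Bracketed s n) {j x : ℕ} (hj : (vchain (A.isBy π) s n)[j]? = some x) :
    A.Bracketed (vseq (A.isBy π) s n) (j + 1) ∧
      ∀ m p, s[x]? = some (m, p) → A.player m = π →
        (A.opens (vseq (A.isBy π) s n) (j + 1)).head?.map ((vchain (A.isBy π) s n).getD · 0) =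
          (A.opens s (x + 1)).head? := by
  have hr := vchain_lt (inp := A.isBy π) hn
  have hsort := vchain_sorted (A.isBy π) s n
  have hD : ∀ {i y : ℕ}, (vchain (A.isBy π) s n)[i]? = some y →
      (vchain (A.isBy π) s n).getD i 0 = y := fun h => by simp [List.getD, h]
  have hget : ∀ {i y : ℕ} {m : A.Move} {p : Option ℕ}, (vchain (A.isBy π) s n)[i]? = some y → s[y]? = some (m, p) →
      (vseq (A.isBy π) s n)[i]? =
        some (m, p.bind fun k => (vchain (A.isBy π) s n).idxOf? k) :=
    fun h h' => JSeq.getElem?_sub_of hr h h'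
  have hstep : ∀ {i y : ℕ} {m : A.Move} {p : Option ℕ}, (vchain (A.isBy π) s n)[i]? = some y → s[y]? = some (m, p) →
      A.Bracketed (vseq (A.isBy π) s n) i →
      (A.kind m = .A → ∃ k, (p.bind fun k => (vchain (A.isBy π) s n).idxOf? k) = some k ∧
        (A.opens (vseq (A.isBy π) s n) i).head? = some k) →
      A.Bracketed (vseq (A.isBy π) s n) (i + 1) := by
    intro i y m p h1 h2 h3 h4 l hl m' p' hx hm
    rcases Nat.lt_succ_iff_lt_or_eq.1 hl with hl | rfl
    · exact h3 l hl m' p' hx hm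
    · rw [hget h1 h2, Option.some.injEq, Prod.mk.injEq] at hx
      obtain ⟨rfl, rfl⟩ := hx
      exact h4 hm
  induction j using Nat.strong_induction_on generalizing x with
  | _ j ih =>
    have hxm := List.mem_of_getElem? hj
    have hxn : x < n := lt_of_mem_chain hxm
    obtain ⟨⟨m, p⟩, hx⟩ : ∃ y, s[x]? = some y := ⟨_, List.getElem?_eq_getElem (hr x hxm)⟩
    have hle := prd_le (inp := A.isBy π) hs.backward x
    have hQ : A.kind m = .Q → 
        (A.opens (vseq (A.isBy π) s n) (j + 1)).head?.map ((vchain (A.isBy π) s n).getD · 0) =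
          (A.opens s (x + 1)).head? := by
      intro hm
      rw [opens_succ_question hx hm, opens_succ_question (hget hj hx) hm, List.head?_cons,
        List.head?_cons, Option.map_some, hD hj]
    by_cases hp : A.player m = π
    · cases p with
      | none =>
        have hm := A.initial_kind m (hs.initial_of_none x m hx)
        cases j with
        | zero =>
          refine ⟨hstep hj hx (fun j h => absurd h (by omega)) (by simp [hm]), ?_⟩
          intro _ _ _ _
          exact hQ hm
        | succ j =>
          obtain ⟨y, -, hy⟩ := getElem?_chain_succ hj hle
          rw [prd_none hx (by simp [hp])] at hy
          omega
      | some k =>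
        cases j with
        | zero =>
          have := getElem?_chain_zero hj hle
          rw [prd_some hx (by simp [hp])] at this
          omega
        | succ i =>
          obtain ⟨y, hi, hy⟩ := getElem?_chain_succ hj hle
          rw [prd_some hx (by simp [hp])] at hy
          obtain rfl : k = y := by omega
          have hi : (vchain (A.isBy π) s n)[i]? = some k := hi
          have hkx := hs.backward x m k hx
          have hidx : (vchain (A.isBy π) s n).idxOf? k = some i :=
            (idxOf?_eq_some_of_nodup (nodup_of_sorted hsort)).2 hi
          obtain ⟨-, ⟨m', p'⟩, hk, he⟩ := hs.justified x m k hx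
          have hm' : A.kind m = .A → A.kind m' = .Q := A.answer_enabled _ _ he
          have hp' : A.player m' ≠ π := by
            rw [← hp]
            exact A.enables_player _ _ he
          refine ⟨hstep hj hx (ih i (by omega) hi).1 fun hm => ⟨i, by simpa using hidx, ?_⟩, ?_⟩
          · rw [opens_succ_question (hget hi hk) (hm' hm), List.head?_cons]
          intro m₁ p₁ hx₁ _
          rw [hx, Option.some.injEq, Prod.mk.injEq] at hx₁
          obtain ⟨rfl, rfl⟩ := hx₁
          cases hm : A.kind m with
          | Q => exact hQ hm
          | A =>
            -- The answered question is the left neighbour in the view. Popping it restores, in the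
            -- play and in the view, the stack from just before that question. The move there is
            -- again by `π`, so the induction hypothesis compares the two tops.
            obtain ⟨_, h1, h2⟩ := hb x hxn m _ hx hm
            obtain rfl := Option.some.inj h1
            rw [opens_succ_answer hx hm, opens_of_head? h2, List.tail_cons,
              opens_succ_answer (hget hj hx) hm, opens_succ_question (hget hi hk) (hm' hm),
              List.tail_cons]
            have hle' := prd_le (inp := A.isBy π) hs.backward k
            cases i with
            | zero =>
              have := getElem?_chain_zero hi hle'
              rw [prd_of_not hk (by simpa using hp')] at this
              subst this
              rfl
            | succ i =>
              obtain ⟨y, hi', hy⟩ := getElem?_chain_succ hi hle'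
              rw [prd_of_not hk (by simpa using hp')] at hy
              subst hy
              obtain ⟨⟨m₂, p₂⟩, hx₂⟩ : ∃ z, s[y]? = some z :=
                ⟨_, List.getElem?_eq_getElem (by omega)⟩
              refine (ih i (by omega) hi').2 m₂ p₂ hx₂ ?_
              have h3 := hs.alternating y _ _ hx₂ hk
              dsimp only at h3
              cases π <;> cases h4 : A.player m₂ <;> cases h5 : A.player m' <;> simp_all
    · have hprd := prd_of_not (inp := A.isBy π) hx (by simpa using hp)
      refine ⟨?_, fun m₁ p₁ hx₁ hm₁ => ?_⟩
      swap
      · rw [hx, Option.some.injEq, Prod.mk.injEq] at hx₁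
        rw [← hx₁.1] at hm₁
        exact absurd hm₁ hp
      cases j with
      | zero =>
        have := getElem?_chain_zero hj hle
        rw [hprd] at this
        subst this
        refine hstep hj hx (fun j h => absurd h (by omega)) fun hm => ?_
        obtain ⟨k, -, hk⟩ := hb 0 hxn m p hx hm
        cases hk
      | succ i =>
        obtain ⟨y, hi, hy⟩ := getElem?_chain_succ hj hle
        rw [hprd] at hy
        subst hy
        obtain ⟨⟨m₂, p₂⟩, hx₂⟩ : ∃ z, s[y]? = some z :=
          ⟨_, List.getElem?_eq_getElem (by omega)⟩
        obtain ⟨h1, h2⟩ := ih i (by omega) hi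
        -- The preceding occurrence of the view is the preceding occurrence of the play and is by
        -- `π`. By induction the question pending in the play is then the question pending in the
        -- view.
        refine hstep hj hx h1 fun hm => ?_
        obtain ⟨k, rfl, hk⟩ := hb _ hxn m p hx hm
        have h3 := h2 m₂ p₂ hx₂ (by
          have h3 := hs.alternating y _ _ hx₂ hx
          dsimp only at h3
          cases π <;> cases h4 : A.player m₂ <;> cases h5 : A.player m <;> simp_all)
        rw [hk, Option.map_eq_some_iff] at h3
        obtain ⟨l, hl, hlk⟩ := h3
        refine ⟨l, ?_, hl⟩
        rw [Option.bind_some, idxOf?_eq_some_of_nodup (nodup_of_sorted hsort)]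
        have h4 := (opens_lt (List.mem_of_mem_head? hl)).1
        have h5 := (List.getElem?_eq_some_iff.1 hj).1
        rw [List.getElem?_eq_getElem (by omega), ← hlk]
        simp [List.getD, show l < (vchain (A.isBy π) s n).length by omega]

theorem IsLegal.bracketed_view (hs : A.IsLegal s) {π : Player} {n : ℕ} (hn : n ≤ s.length)
    (hb : A.Bracketed s n) :
    A.Bracketed (vseq (A.isBy π) s n) (vseq (A.isBy π) s n).length := by
  cases n with
  | zero => intro j hj; simp at hj
  | succ n =>
    have h1 := getElem?_chain_last (prd (A.isBy π) s) n
    have h2 := length_chain_succ_pos (prd (A.isBy π) s) n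
    have h3 := (hs.bracketed_vseq hn hb h1).1
    rw [length_vseq hn]
    rwa [Nat.sub_add_cancel h2] at h3

theorem IsLegal.opens_view (hs : A.IsLegal s) {π : Player} {n : ℕ} {m : A.Move} {p : Option ℕ}
    (hx : s[n]? = some (m, p)) (hm : A.player m = π) (hb : A.Bracketed s (n + 1)) :
    (A.opens (vseq (A.isBy π) s (n + 1)) (vseq (A.isBy π) s (n + 1)).length).head?.map
      ((vchain (A.isBy π) s (n + 1)).getD · 0) = (A.opens s (n + 1)).head? := by
  have hn : n + 1 ≤ s.length := (List.getElem?_eq_some_iff.1 hx).1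
  have h1 := getElem?_chain_last (prd (A.isBy π) s) n
  have h2 := length_chain_succ_pos (prd (A.isBy π) s) n
  have h3 := (hs.bracketed_vseq hn hb h1).2 m p hx hm
  rw [length_vseq hn]
  rwa [Nat.sub_add_cancel h2] at h3

/-- Bracketing is preserved by moves that answer the pending question of the view. -/
theorem IsLegal.bracketed_succ (hs : A.IsLegal s) {π : Player} {n : ℕ} {m : A.Move}
    {p : Option ℕ} (hx : s[n]? = some (m, p)) (hm : A.player m ≠ π) (hb : A.Bracketed s n)
    (h : A.AnswersPending (vseq (A.isBy π) s (n + 1))) : A.Bracketed s (n + 1) := by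
  intro j hj m' p' hx' hm'
  rcases Nat.lt_succ_iff_lt_or_eq.1 hj with hj | rfl
  · exact hb j hj m' p' hx' hm'
  rw [hx, Option.some.injEq, Prod.mk.injEq] at hx'
  obtain ⟨rfl, rfl⟩ := hx'
  have hlt : j < s.length := (List.getElem?_eq_some_iff.1 hx).1
  obtain ⟨i, hi, hpend⟩ := h _ _ (hs.vseq_last hx (by simpa using hm)) hm'
  rw [(hs.bracketed_view hlt.le hb).isPending_iff] at hpend
  cases p with
  | none => simp at hi
  | some k =>
    refine ⟨k, rfl, ?_⟩
    simp only [Option.bind_some] at hi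
    rw [idxOf?_eq_some_of_nodup (nodup_of_sorted (vchain_sorted _ _ _))] at hi
    cases j with
    | zero => simp at hi
    | succ j =>
      obtain ⟨⟨m₂, p₂⟩, hx₂⟩ : ∃ z, s[j]? = some z :=
        ⟨_, List.getElem?_eq_getElem (by omega)⟩
      have h3 := hs.alternating j _ _ hx₂ hx
      dsimp only at h3
      rw [← hs.opens_view hx₂ (π := π)
        (by cases π <;> cases h4 : A.player m₂ <;> cases h5 : A.player m <;> simp_all) hb, hpend,
        Option.map_some]
      simp [List.getD, hi]

end Arena

/-! ### Bracketing of the thread of colour `eq`. -/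

namespace Arena

variable {A : Arena.{u}} {s t : JSeq (A.copies Ordering).Move}

/-- The stack of open questions of the thread. -/
theorem IsLegal.bracketed_thread (hs : (A.copies Ordering).IsLegal s) {n : ℕ} (hn : n ≤ s.length)
    (hb : A.Bracketed (forget s) n) :
    A.Bracketed (thread s) (cnt thr s n) ∧
      A.opens (thread s) (cnt thr s n) =
        ((A.opens (forget s) n).filter fun k => decide (colAt s k = some .eq)).map
          (cnt thr s) := by
  induction n with
  | zero => 
    rw [cnt_zero]
    exact ⟨fun j hj => absurd hj (by omega), rfl⟩
  | succ n ih =>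
    obtain ⟨ih1, ih2⟩ := ih (by omega) (hb.mono (by omega))
    obtain ⟨⟨m, p⟩, hx⟩ : ∃ y, s[n]? = some y := ⟨_, List.getElem?_eq_getElem (by omega)⟩
    have hx' : (forget s)[n]? = some (base m, p) := by rw [getElem?_forget, hx]; rfl
    -- An answer removes a question of its own colour, so selecting a colour commutes with pushing
    -- and popping.
    have hfilter : A.kind (base m) = .A → ∃ k, p = some k ∧ colAt s k = colAt s n ∧
        A.opens (forget s) n = k :: A.opens (forget s) k := by
      intro hm
      obtain ⟨k, rfl, hk⟩ := hb n (by omega) _ _ hx' hm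
      exact ⟨k, rfl, hs.colAt_ptr hx, opens_of_head? hk⟩
    have hc := colAt_eq hx
    by_cases hcol : col m = .eq
    · have hT := hs.thread_getElem? hx hcol
      rw [cnt_thr_succ hx, if_pos hcol]
      rw [hcol] at hc
      cases hm : A.kind (base m) with
      | Q =>
        rw [opens_succ_question hx' hm, opens_succ_question hT hm, ih2]
        refine ⟨fun j hj m' p' h1 h2 => ?_, by simp [hc]⟩
        rcases Nat.lt_succ_iff_lt_or_eq.1 hj with hj | rfl
        · exact ih1 j hj m' p' h1 h2
        · rw [hT, Option.some.injEq, Prod.mk.injEq] at h1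
          rw [← h1.1, hm] at h2
          cases h2
      | A =>
        obtain ⟨k, rfl, hk, ho⟩ := hfilter hm
        rw [hc] at hk
        rw [ho, List.filter_cons, if_pos (by simp [hk]), List.map_cons] at ih2
        rw [opens_succ_answer hx' hm, opens_succ_answer hT hm, ih2, ho]
        refine ⟨fun j hj m' p' h1 h2 => ?_, rfl⟩
        rcases Nat.lt_succ_iff_lt_or_eq.1 hj with hj | rfl
        · exact ih1 j hj m' p' h1 h2
        · rw [hT, Option.some.injEq, Prod.mk.injEq] at h1
          exact ⟨cnt thr s k, by rw [← h1.2]; rfl, by rw [ih2]; rfl⟩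
    · rw [cnt_thr_succ hx, if_neg hcol, Nat.add_zero, ih2]
      refine ⟨ih1, ?_⟩
      have hc' : ¬ colAt s n = some .eq := by rw [hc]; simpa using hcol
      cases hm : A.kind (base m) with
      | Q => rw [opens_succ_question hx' hm, List.filter_cons, if_neg (by simpa using hc')]
      | A =>
        obtain ⟨k, rfl, hk, ho⟩ := hfilter hm
        rw [opens_succ_answer hx' hm, ho, List.filter_cons, if_neg (by rw [hk]; simpa using hc')]
        rfl

end Arena

/-- Only the move and the earlier view are extracted; the pointers are positions in different plays
and need not agree. -/
theorem vseq_succ_inj {M : Type u} {inp : M → Bool} {s t : JSeq M} (hs : s.Backward)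
    (ht : t.Backward) {x y : ℕ} {m m' : M} {p p' : Option ℕ} (hx : s[x]? = some (m, p))
    (hy : t[y]? = some (m', p')) (h : vseq inp s (x + 1) = vseq inp t (y + 1)) :
    m = m' ∧ vseq inp s (prd inp s x) = vseq inp t (prd inp t y) := by
  rw [vseq_succ hs hx, vseq_succ ht hy] at h
  obtain ⟨h1, h2⟩ := List.append_inj' h rfl
  simp only [List.cons.injEq, Prod.mk.injEq, and_true] at h2
  exact ⟨h2.1, h1⟩

namespace Arena

section
variable {A : Arena.{u}} {s t : JSeq A.Move}

/-! ### Tests -/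

theorem exists_concat_embed (s : JSeq A.Move) :
    ∃ w a, A.embed s = w ++ [a] ∧ (s = [] ∧ w = [] ∨ s ≠ [] ∧ w = A.embed s.dropLast) := by
  rcases List.eq_nil_or_concat s with rfl | ⟨s, x, rfl⟩
  · exact ⟨[], _, rfl, Or.inl ⟨rfl, rfl⟩⟩
  · refine ⟨A.embed s, A.embedOcc x, ?_, Or.inr (by simp)⟩
    rw [List.concat_eq_append, embed_append]
    rfl

variable {α : Set (JSeq A.testArena.Move)}

theorem test_det (hα : A.testArena.IsInnocent A.testPlays α) {b b' : A.testArena.Move × Option ℕ}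
    (h : A.embed s ++ [b] ∈ α) (h' : A.embed s ++ [b'] ∈ α) : b = b' := by
  obtain ⟨w, a, hw, -⟩ := exists_concat_embed s
  rw [hw, List.append_assoc] at h h'
  exact hα.deterministic _ _ _ _ h h'

/-- An innocent test continues alike after plays with the same O-view. -/
theorem test_mem (hα : A.testArena.IsInnocent A.testPlays α) {b b' : A.testArena.Move × Option ℕ}
    (hs : A.IsLegal s) (h : A.embed s ++ [b] ∈ α) (he : Even t.length)
    (htest : ∀ n, Odd n → n ≤ t.length → A.embed (t.take n) ∈ α) (ht : A.IsLegal t)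
    (hb' : A.testArena.IsLegal (A.embed t ++ [b'])) (h1 : A.oview s = A.oview t)
    (h2 : A.testArena.pview (A.embed s ++ [b]) = A.testArena.pview (A.embed t ++ [b'])) :
    A.embed t ++ [b'] ∈ α := by
  obtain ⟨w, a, hw, -⟩ := exists_concat_embed s
  obtain ⟨w', a', hw', hc⟩ := exists_concat_embed t
  have e1 : A.embed s ++ [b] = w ++ [a, b] := by rw [hw, List.append_assoc]; rfl
  have e2 : ∀ c, A.embed t ++ [c] = w' ++ [a', c] := by
    intro c; rw [hw', List.append_assoc]; rfl
  have hwα : w' ∈ α := by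
    rcases hc with ⟨-, rfl⟩ | ⟨h0, rfl⟩
    · exact hα.toIsStrategy.nil_mem
    · have hpos : 0 < t.length := List.length_pos_iff.2 h0
      rw [List.dropLast_eq_take]
      refine htest _ ?_ (by omega)
      obtain ⟨k, hk⟩ := he
      exact ⟨k - 1, by omega⟩
  have hev : Even w'.length := by
    have := congrArg List.length hw'
    rw [length_embed, List.length_append, List.length_singleton] at this
    rwa [show w'.length = t.length by omega]
  obtain ⟨c, hc1, hc2⟩ := hα.innocent w a b w' a' (e1 ▸ h) hwα (hw' ▸ embed_mem_testPlays ht)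
    (by rw [← hw, ← hw', pview_embed ht, pview_embed hs, h1])
  have hleg : A.testArena.IsLegal (w' ++ [a', c]) := (hα.mem_pos _ hc1).1
  rw [← e1, h2, e2] at hc2
  rw [e2] at hb' ⊢
  rwa [← IsLegal.eq_of_pview_eq hleg hb' hev hc2]

/-- A test sees `q s` only through the O-view of `s`. This is the case of a next move in `A`;
`test_mem_ans` is the case of the final answer. -/
theorem test_mem_embed (hα : A.testArena.IsInnocent A.testPlays α) {o o' : A.Move × Option ℕ}
    (hs : A.IsLegal (s ++ [o])) (h : A.embed (s ++ [o]) ∈ α) (he : Even t.length)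
    (htest : ∀ n, Odd n → n ≤ t.length → A.embed (t.take n) ∈ α) (ht : A.IsLegal (t ++ [o']))
    (h1 : A.oview s = A.oview t) (h2 : A.oview (s ++ [o]) = A.oview (t ++ [o'])) :
    A.embed (t ++ [o']) ∈ α := by
  have e : ∀ (u : JSeq A.Move) x, A.embed (u ++ [x]) = A.embed u ++ [A.embedOcc x] :=
    fun u x => embed_append u [x]
  have hp : A.testArena.pview (A.embed (s ++ [o])) = A.testArena.pview (A.embed (t ++ [o'])) := by
    rw [pview_embed hs, pview_embed ht, h2]
  have hl := isLegal_embed ht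
  rw [e] at h hl ⊢
  rw [e, e] at hp
  exact test_mem hα hs.of_append h he htest ht.of_append hl h1 hp

theorem test_mem_ans (hα : A.testArena.IsInnocent A.testPlays α)
    (hs : A.IsLegal s) (hes : Even s.length) (h : A.embed s ++ [A.ansOcc] ∈ α)
    (he : Even t.length) (htest : ∀ n, Odd n → n ≤ t.length → A.embed (t.take n) ∈ α)
    (ht : A.IsLegal t) (h1 : A.oview s = A.oview t) : A.embed t ++ [A.ansOcc] ∈ α :=
  test_mem hα hs h he htest ht (isLegal_embed_ans ht he) h1
    (by rw [pview_embed_ans hs hes, pview_embed_ans ht he, h1])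

theorem IsLegal.exists_vseq_concat {π : Player} (hs : A.IsLegal s) {n : ℕ}
    {x : A.Move × Option ℕ} (hx : s[n]? = some x) (hm : A.player x.1 ≠ π) :
    ∃ y, vseq (A.isBy π) s (n + 1) = vseq (A.isBy π) s n ++ [y] :=
  ⟨_, hs.vseq_last hx (by simpa using hm)⟩

/-- The views of an innocent strategy determine the response. -/
theorem IsInnocent.pview_image_det {σ : Set (JSeq A.Move)} (hσ : A.IsInnocent A.plays σ)
    {w : JSeq A.Move} {x y : A.Move × Option ℕ} (hx : w ++ [x] ∈ A.pview '' σ)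
    (hy : w ++ [y] ∈ A.pview '' σ) : x = y := by
  obtain ⟨u, hu, hu'⟩ := hx
  obtain ⟨v, hv, hv'⟩ := hy
  have hne : ∀ {w : JSeq A.Move} {x u}, A.pview u = w ++ [x] → u ≠ [] := by
    rintro w x u h rfl
    rw [isLegal_nil.pview_eq] at h
    simp at h
  obtain ⟨u, a, b, rfl, hue⟩ := exists_concat_of_even (hσ.even u hu) (hne hu')
  obtain ⟨v, a', b', rfl, hve⟩ := exists_concat_of_even (hσ.even v hv) (hne hv')
  obtain ⟨z, hz⟩ := (hσ.mem_pos _ hu).pview_concat hue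
  obtain ⟨z', hz'⟩ := (hσ.mem_pos _ hv).pview_concat hve
  have h1 := List.append_inj' (hz.symm.trans hu') rfl
  have h2 := List.append_inj' (hz'.symm.trans hv') rfl
  have hpos : v ++ [a'] ∈ A.plays :=
    IsLegal.prefix (hσ.mem_pos _ hv) ⟨[b'], by simp⟩
  have h3 := hσ.pview_det hpos hu hv (h1.1.trans h2.1.symm)
  rw [hu', hv'] at h3
  simpa using h3

end

variable {A : Arena.{u}} {s t : JSeq (A.copies Ordering).Move}

/-- A move can be copied to the end of a play with the same F-view. -/
theorem IsLegal.lift_inpF (hs : (A.copies Ordering).IsLegal s) (ht : (A.copies Ordering).IsLegal t)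
    {x y : ℕ} (hy : t.length = y + 1) (hF : vseq inpF s (x + 1) = vseq inpF t (y + 1))
    {m : (A.copies Ordering).Move} {q : Option ℕ} (hm : s[x + 1]? = some (m, q)) {π : Player}
    (hπ : (A.copies Ordering).player m ≠ π) (hc : π = .O → colAt s x ≠ some .eq) :
    ∃ q', (A.copies Ordering).IsLegal (t ++ [(m, q')]) ∧
      vseq ((A.copies Ordering).isBy π) s (x + 1) =
        vseq ((A.copies Ordering).isBy π) t (y + 1) ∧
      vseq ((A.copies Ordering).isBy π) s (x + 1 + 1) =
        vseq ((A.copies Ordering).isBy π) (t ++ [(m, q')]) (y + 1 + 1) ∧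
      vseq inpF s (x + 1 + 1) = vseq inpF (t ++ [(m, q')]) (y + 1 + 1) ∧
      (q = none → q' = none) := by
  have hx1 : x + 1 < s.length := (List.getElem?_eq_some_iff.1 hm).1
  obtain ⟨⟨mx, px⟩, hx⟩ : ∃ z, s[x]? = some z := ⟨_, List.getElem?_eq_getElem (by omega)⟩
  obtain ⟨⟨my, py⟩, hy'⟩ : ∃ z, t[y]? = some z := ⟨_, List.getElem?_eq_getElem (by omega)⟩
  obtain ⟨rfl, -⟩ := vseq_succ_inj hs.backward ht.backward hx hy' hF
  set L := vchain inpF s (x + 1) with hL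
  set L' := vchain inpF t (y + 1) with hL'
  have hr : ∀ i ∈ L, i < s.length := vchain_lt (by omega)
  have hr' : ∀ i ∈ L', i < t.length := vchain_lt (by omega)
  have hsort : L.Pairwise (· < ·) := vchain_sorted _ _ _
  have hsort' : L'.Pairwise (· < ·) := vchain_sorted _ _ _
  have hlen : L'.length = L.length := by
    rw [hL, hL', ← length_vseq (by omega), ← length_vseq (by omega), hF]
  have hpos : 0 < L.length := length_chain_succ_pos _ _
  have hj : L[L.length - 1]? = some x := getElem?_chain_last _ _
  have hj' : L'[L.length - 1]? = some y := by rw [← hlen]; exact getElem?_chain_last _ _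
  -- `J` lists the indices, inside the F-view, of the view for `π`. It depends on the F-view alone
  -- and is therefore common to both plays.
  obtain ⟨J, hJ, hV, hV'⟩ : ∃ J : List ℕ, (∀ i ∈ J, i < L.length) ∧
      vchain ((A.copies Ordering).isBy π) s (x + 1) = J.map (L.getD · 0) ∧
      vchain ((A.copies Ordering).isBy π) t (y + 1) = J.map (L'.getD · 0) := by
    refine ⟨vchain ((A.copies Ordering).isBy π) (vseq inpF s (x + 1)) (L.length - 1 + 1),
      fun i hi => ?_, ?_⟩
    · have := lt_of_mem_chain hi
      omega
    cases π with
    | P =>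
      refine ⟨hs.oview_inpF (by omega) hj, ?_⟩
      rw [hF]
      exact ht.oview_inpF (by omega) hj'
    | O =>
      have hc := hc rfl
      have hc' : colAt t y ≠ some .eq := by
        rwa [colAt_eq hy', ← colAt_eq hx]
      refine ⟨hs.pview_inpF (by omega) hj hc, ?_⟩
      rw [hF]
      exact ht.pview_inpF (by omega) hj' hc'
  have hview : vseq ((A.copies Ordering).isBy π) s (x + 1) =
      vseq ((A.copies Ordering).isBy π) t (y + 1) := by
    rw [vseq, vseq, hV, hV', JSeq.sub_map hr (nodup_of_sorted hsort) hJ,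
      JSeq.sub_map hr' (nodup_of_sorted hsort') (by rwa [hlen])]
    exact congrArg (fun w => JSeq.sub w J) hF
  -- A P-move of colour `eq` would follow a move of colour `eq`, which `hc` forbids; hence the
  -- F-view does not jump at the new move.
  have hinp : inpF m = false := by
    rw [inpF_eq_false]
    intro hP
    have hO : π = .O := by cases π <;> simp_all
    have h1 := hc hO
    rw [hs.colAt_succ_of_P hm hP, colAt_eq hm] at h1
    simpa using h1
  have hlast := hs.vseq_last hm (inp := (A.copies Ordering).isBy π) (by simpa using hπ)
  have hleg := hs.vseq_isLegal (π := π) (n := x + 1 + 1) (by omega)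
  rw [hlast, hview, ← hy] at hleg
  obtain ⟨q', h1, h2, h3⟩ := ht.lift hπ hleg
  rw [hy] at h1 h3
  have hm' : (t ++ [(m, q')])[y + 1]? = some (m, q') := by rw [← hy]; simp
  have hvis' : ∀ k, q' = some k →
      ∃ i : ℕ, (vchain ((A.copies Ordering).isBy π) t (y + 1))[i]? = some k := by
    rintro k rfl
    have h4 := h2.visible hm' hπ
    rw [vchain_append hy.ge] at h4
    exact exists_getElem?_of_mem h4
  have hnone : q = none → q' = none := by
    rintro rfl
    cases q' with
    | none => rfl
    | some k =>
      obtain ⟨i, hi⟩ := hvis' k rfl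
      have := (h1 i).2 ⟨k, rfl, hi⟩
      simp at this
  refine ⟨q', h2, hview, by rw [h3, hlast, hview], ?_, hnone⟩
  rw [hs.vseq_last hm hinp, h2.vseq_last hm' hinp, vseq_append hy.ge, hF, vchain_append hy.ge]
  congr 3
  cases q with
  | none => rw [hnone rfl]; rfl
  | some k =>
    -- Both justifiers are selected by the same entry of `J`, so they have the same index in the two
    -- F-views.
    obtain ⟨i, hi⟩ := exists_getElem?_of_mem (hs.visible hm hπ)
    obtain ⟨k', rfl, hk'⟩ := (h1 i).1
      ((idxOf?_eq_some_of_nodup (nodup_of_sorted (vchain_sorted _ _ _))).2 hi)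
    rw [hV, List.getElem?_map, Option.map_eq_some_iff] at hi
    rw [hV', List.getElem?_map, Option.map_eq_some_iff] at hk'
    obtain ⟨l, hl, rfl⟩ := hi
    obtain ⟨l', hl', rfl⟩ := hk'
    rw [hl, Option.some.injEq] at hl'
    subst hl'
    have hlt := hJ l (List.mem_of_getElem? hl)
    rw [Option.bind_some, Option.bind_some,
      (idxOf?_eq_some_of_nodup (nodup_of_sorted hsort) (i := l)).2,
      (idxOf?_eq_some_of_nodup (nodup_of_sorted hsort') (i := l)).2]
    · simp [List.getD, show l < L'.length by omega]
    · simp [List.getD, hlt]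

/-! ### Runs -/

/-- Runs of a test `α` against the strategies `ρ c`, where the moves are coloured by the position
of the initial move of their thread relative to `r`. -/
structure IsRun (α : Set (JSeq A.testArena.Move)) (ρ : Ordering → Set (JSeq A.Move)) (r : ℕ)
    (s : JSeq (A.copies Ordering).Move) : Prop where
  legal : (A.copies Ordering).IsLegal s
  rooted : ∀ (i : ℕ) (m : (A.copies Ordering).Move), s[i]? = some (m, none) → col m = compare i r
  test : ∀ n, Odd n → n ≤ s.length → A.embed ((forget s).take n) ∈ α
  resp : ∀ (n : ℕ) (m : (A.copies Ordering).Move) (p : Option ℕ), Odd n → s[n]? = some (m, p) →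
    vseq (A.isBy .O) (forget s) (n + 1) ∈ A.pview '' ρ (col m)

variable {α : Set (JSeq A.testArena.Move)} {ρ ρ' : Ordering → Set (JSeq A.Move)} {r : ℕ}

theorem getElem?_take_eq_some {β : Type*} {l : List β} {n i : ℕ} {x : β}
    (h : (l.take n)[i]? = some x) : i < n ∧ l[i]? = some x := by
  rw [List.getElem?_take] at h
  split at h
  · exact ⟨by assumption, h⟩
  · cases h

theorem getElem?_concat_eq_some {β : Type*} {l : List β} {i : ℕ} {x z : β}
    (h : (l ++ [z])[i]? = some x) : i < l.length ∧ l[i]? = some x ∨ i = l.length ∧ x = z := by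
  rcases lt_trichotomy i l.length with h1 | h1 | h1
  · rw [List.getElem?_append_left h1] at h
    exact Or.inl ⟨h1, h⟩
  · subst h1
    rw [List.getElem?_concat_length, Option.some.injEq] at h
    exact Or.inr ⟨rfl, h.symm⟩
  · rw [List.getElem?_eq_none (by simp; omega)] at h
    cases h

theorem IsRun.take (h : A.IsRun α ρ r s) (n : ℕ) : A.IsRun α ρ r (s.take n) where
  legal := h.legal.take n
  rooted i m hx := h.rooted i m (getElem?_take_eq_some hx).2
  test k hk hle := by
    rw [List.length_take] at hle
    rw [forget_take, List.take_take, min_eq_left (by omega)]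
    exact h.test k hk (by omega)
  resp k m p hk hx := by
    obtain ⟨h1, h2⟩ := getElem?_take_eq_some hx
    rw [forget_take, vseq_take h1]
    exact h.resp k m p hk h2

theorem IsRun.concat (h : A.IsRun α ρ r s) {m : (A.copies Ordering).Move} {p : Option ℕ}
    (hl : (A.copies Ordering).IsLegal (s ++ [(m, p)]))
    (hr : p = none → col m = compare s.length r)
    (ht : Even s.length → A.embed (forget (s ++ [(m, p)])) ∈ α)
    (hp : Odd s.length →
      vseq (A.isBy .O) (forget (s ++ [(m, p)])) (s.length + 1) ∈ A.pview '' ρ (col m)) :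
    A.IsRun α ρ r (s ++ [(m, p)]) where
  legal := hl
  rooted i m' hx := by
    rcases getElem?_concat_eq_some hx with ⟨-, h1⟩ | ⟨rfl, h1⟩
    · exact h.rooted i m' h1
    · obtain ⟨rfl, h2⟩ := Prod.mk.inj h1
      exact hr h2.symm
  test n hn hle := by
    rw [List.length_append, List.length_singleton] at hle
    rcases Nat.lt_or_ge s.length n with h1 | h1
    · obtain rfl : n = s.length + 1 := by omega
      rw [List.take_of_length_le (by simp)]
      apply ht
      simpa [Nat.odd_add_one] using hn
    · rw [forget_append, List.take_append_of_le_length (by simpa using h1)]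
      exact h.test n hn h1
  resp n m' p' hn hx := by
    rcases getElem?_concat_eq_some hx with ⟨h0, h1⟩ | ⟨rfl, h1⟩
    · rw [forget_append, vseq_append (by rw [length_forget]; exact h0)]
      exact h.resp n m' p' hn h1
    · obtain ⟨rfl, rfl⟩ := Prod.mk.inj h1
      exact hp hn

/-- Occurrences of colour `eq` come after the root. -/
theorem IsRun.le_of_eq (h : A.IsRun α ρ r s) {n : ℕ} (hn : colAt s n = some .eq) : r ≤ n := by
  induction n using Nat.strong_induction_on with
  | _ n ih =>
    have hn' := hn
    simp only [colAt, Option.map_eq_some_iff] at hn'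
    obtain ⟨⟨m, p⟩, h1, h2⟩ := hn'
    cases p with
    | none =>
      have := h.rooted n m h1
      rw [h2] at this
      exact (compare_eq_iff_eq.1 this.symm).ge
    | some k =>
      have hk := h.legal.backward n m k h1
      have := ih k hk (by rw [h.legal.colAt_ptr h1, hn])
      omega

theorem forget_injective {z z' : (A.copies Ordering).Move × Option ℕ}
    (h : Prod.map base id z = Prod.map base id z') (hc : col z.1 = col z'.1) : z = z' := by
  obtain ⟨m, p⟩ := z
  obtain ⟨m', p'⟩ := z'
  obtain ⟨h1, h2⟩ := Prod.mk.inj h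
  rw [copies_ext h1 hc]
  exact congrArg _ h2

/-- A run determines its next move. -/
theorem IsRun.det (hα : A.testArena.IsInnocent A.testPlays α)
    (hρ : ∀ c, A.IsInnocent A.plays (ρ c)) {z z' : (A.copies Ordering).Move × Option ℕ}
    (h : A.IsRun α ρ r (s ++ [z])) (h' : A.IsRun α ρ r (s ++ [z'])) : z = z' := by
  have hz : (s ++ [z])[s.length]? = some z := by simp
  have hz' : (s ++ [z'])[s.length]? = some z' := by simp
  have key : Prod.map base id z = Prod.map base id z' := by
    have e : ∀ z, forget (s ++ [z]) = forget s ++ [Prod.map base id z] :=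
      fun z => forget_append s [z]
    rcases Nat.even_or_odd s.length with he | ho
    · have h1 := h.test (s.length + 1) he.add_one (by simp)
      have h2 := h'.test (s.length + 1) he.add_one (by simp)
      rw [List.take_of_length_le (by simp), e, embed_append] at h1 h2
      exact embedOcc_injective (test_det hα h1 h2)
    · have h1 := h.resp s.length z.1 z.2 ho hz
      have h2 := h'.resp s.length z'.1 z'.2 ho hz'
      have hl := isLegal_forget h.legal
      have hl' := isLegal_forget h'.legal
      have hP : (A.copies Ordering).player z.1 = .P := (h.legal.odd_of_P hz).2 ho
      have hP' : (A.copies Ordering).player z'.1 = .P := (h'.legal.odd_of_P hz').2 ho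
      obtain ⟨k, hk⟩ : ∃ k, s.length = k + 1 := by
        obtain ⟨k, hk⟩ := ho
        exact ⟨2 * k, hk⟩
      -- P stays in the colour of the preceding move, so both responses come from the same strategy.
      have hc : col z.1 = col z'.1 := by
        have hk1 : (s ++ [z])[k + 1]? = some (z.1, z.2) := by rw [← hk, hz]
        have hk2 : (s ++ [z'])[k + 1]? = some (z'.1, z'.2) := by rw [← hk, hz']
        have e1 := h.legal.colAt_succ_of_P hk1 hP
        have e2 := h'.legal.colAt_succ_of_P hk2 hP'
        rw [colAt_eq hk1, colAt, List.getElem?_append_left (by omega)] at e1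
        rw [colAt_eq hk2, colAt, List.getElem?_append_left (by omega)] at e2
        exact Option.some.inj (e1.symm.trans e2)
      rw [e] at h1 hl
      rw [e] at h2 hl'
      have hlast : (forget s ++ [Prod.map base id z])[s.length]? = some (Prod.map base id z) := by
        rw [← length_forget s]; simp
      have hlast' : (forget s ++ [Prod.map base id z'])[s.length]? =
          some (Prod.map base id z') := by
        rw [← length_forget s]; simp
      obtain ⟨y, hy⟩ := hl.exists_vseq_concat (π := .O) hlast (by
        change (A.copies Ordering).player z.1 ≠ _
        rw [hP]; simp)
      obtain ⟨y', hy'⟩ := hl'.exists_vseq_concat (π := .O) hlast' (by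
        change (A.copies Ordering).player z'.1 ≠ _
        rw [hP']; simp)
      rw [hy, vseq_append (length_forget s).ge, hc] at h1
      rw [hy', vseq_append (length_forget s).ge] at h2
      have hyy := (hρ _).pview_image_det h1 h2
      refine hl.eq_of_vseq_eq hl' (π := .O) (by
        change (A.copies Ordering).player z.1 ≠ _
        rw [hP]; simp) ?_
      rw [length_forget, hy, hy', vseq_append (length_forget s).ge,
        vseq_append (length_forget s).ge, hyy]
  refine forget_injective key ?_
  obtain ⟨m, p⟩ := z
  obtain ⟨m', p'⟩ := z'
  obtain ⟨-, hp⟩ := Prod.mk.inj key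
  change p = p' at hp
  subst hp
  cases p with
  | none => exact (h.rooted _ _ hz).trans (h'.rooted _ _ hz').symm
  | some k =>
    have h1 := h.legal.colAt_ptr hz
    have h2 := h'.legal.colAt_ptr hz'
    have hk := h.legal.backward _ _ _ hz
    rw [colAt_eq hz, colAt, List.getElem?_append_left hk] at h1
    rw [colAt_eq hz', colAt, List.getElem?_append_left hk] at h2
    exact Option.some.inj (h1.symm.trans h2)

/-- Runs with equal F-views continue alike, unless Proponent is to move in colour `eq`. -/
theorem IsRun.exists_step (hα : A.testArena.IsInnocent A.testPlays α)
    (h : A.IsRun α ρ r s) (h' : A.IsRun α ρ' r t) (hρ : ∀ c, c ≠ .eq → ρ c = ρ' c) {x y : ℕ}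
    (hy : t.length = y + 1) (hF : vseq inpF s (x + 1) = vseq inpF t (y + 1))
    (hx : x + 1 < s.length) (hrx : r ≤ x) (hry : r ≤ y)
    (hc : Even x → colAt s x ≠ some .eq) :
    ∃ z, A.IsRun α ρ' r (t ++ [z]) ∧
      vseq inpF s (x + 1 + 1) = vseq inpF (t ++ [z]) (y + 1 + 1) := by
  obtain ⟨⟨m, q⟩, hm⟩ : ∃ z, s[x + 1]? = some z := ⟨_, List.getElem?_eq_getElem hx⟩
  obtain ⟨⟨mx, px⟩, hmx⟩ : ∃ z, s[x]? = some z := ⟨_, List.getElem?_eq_getElem (by omega)⟩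
  obtain ⟨⟨my, py⟩, hmy⟩ : ∃ z, t[y]? = some z := ⟨_, List.getElem?_eq_getElem (by omega)⟩
  obtain ⟨rfl, -⟩ := vseq_succ_inj h.legal.backward h'.legal.backward hmx hmy hF
  have hpar : Even x ↔ Even y := by
    rw [← h.legal.even_of_O hmx, ← h'.legal.even_of_O hmy]
  -- A thread that starts after position `r` has colour `gt` in either run, although the two
  -- starting positions may differ. This is where `r ≤ x` and `r ≤ y` are needed.
  have hroot : ∀ q', (q = none → q' = none) → (t ++ [(m, q')])[t.length]? = some (m, q') →
      (A.copies Ordering).IsLegal (t ++ [(m, q')]) → q' = none → col m = compare t.length r := by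
    rintro q' hq hq' hl rfl
    cases q with
    | none =>
      rw [h.rooted _ _ hm, hy, compare_gt_iff_gt.2 (show r < x + 1 by omega),
        compare_gt_iff_gt.2 (show r < y + 1 by omega)]
    | some k =>
      exfalso
      obtain ⟨-, z, -, he⟩ := h.legal.justified _ _ _ hm
      exact (A.copies Ordering).initial_not_enabled m (hl.initial_of_none _ _ hq') _ he
  rcases Nat.even_or_odd x with he | ho
  · have hP : (A.copies Ordering).player m = .P := (h.legal.odd_of_P hm).2 he.add_one
    obtain ⟨q', h1, h2, h3, h4, h5⟩ := h.legal.lift_inpF h'.legal hy hF hm (π := .O)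
      (by rw [hP]; simp) (fun _ => hc he)
    refine ⟨(m, q'), h'.concat h1 (hroot q' h5 (by simp) h1) ?_ ?_, h4⟩
    · intro h6
      rw [hy, Nat.even_add_one] at h6
      exact absurd (hpar.1 he) h6
    · intro h6
      have h7 := h.resp (x + 1) m q he.add_one hm
      rw [hρ, vseq_forget, h3, ← vseq_forget] at h7
      · rwa [hy]
      · have := hc he
        rw [h.legal.colAt_succ_of_P hm hP, colAt_eq hm] at this
        simpa using this
  · have hO : (A.copies Ordering).player m = .O := (h.legal.even_of_O hm).2 ho.add_one
    obtain ⟨q', h1, h2, h3, h4, h5⟩ := h.legal.lift_inpF h'.legal hy hF hm (π := .P)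
      (by rw [hO]; simp) (fun h => by cases h)
    refine ⟨(m, q'), h'.concat h1 (hroot q' h5 (by simp) h1) ?_ ?_, h4⟩
    · intro h6
      have h7 := h.test (x + 1 + 1) ho.add_one.add_one (by omega)
      have hls := isLegal_forget h.legal
      have hl1 := isLegal_forget h1
      have e1 : (forget s).take (x + 1 + 1) = (forget s).take (x + 1) ++ [(base m, q)] := by
        rw [List.take_add_one, getElem?_forget, hm]
        rfl
      have e2 : forget (t ++ [(m, q')]) = forget t ++ [(base m, q')] := forget_append _ _
      rw [e1] at h7
      rw [e2] at hl1 ⊢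
      refine test_mem_embed hα (by rw [← e1]; exact hls.take _) h7 (by rwa [length_forget])
        (by rw [length_forget]; exact h'.test) hl1 ?_ ?_
      · rw [hls.oview_take (by rw [length_forget]; omega), hl1.of_append.oview_eq, length_forget,
          hy, vseq_forget, vseq_forget, h2]
      · rw [← e1, hls.oview_take (by rw [length_forget]; omega), hl1.oview_eq, ← e2,
          vseq_forget, vseq_forget, h3, length_forget, List.length_append, hy]
        rfl
    · intro h6
      rw [hy, Nat.odd_add_one, Nat.not_odd_iff_even, ← hpar, ← Nat.not_odd_iff_even] at h6
      exact absurd ho h6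

end Arena
-- Determinism of the environment in terms of F-views.
namespace Arena

variable {A : Arena.{u}} {s t : JSeq (A.copies Ordering).Move}
  {α : Set (JSeq A.testArena.Move)} {ρ ρ' : Ordering → Set (JSeq A.Move)} {r : ℕ}

/-- The move copied by `IsRun.exists_step` is the move that the other run makes, because a run
determines its next move (`IsRun.det`). -/
theorem IsRun.step (hα : A.testArena.IsInnocent A.testPlays α)
    (hρ' : ∀ c, A.IsInnocent A.plays (ρ' c))
    (h : A.IsRun α ρ r s) (h' : A.IsRun α ρ' r t) (hρ : ∀ c, c ≠ .eq → ρ c = ρ' c) {x y : ℕ}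
    (hF : vseq inpF s (x + 1) = vseq inpF t (y + 1))
    (hx : x + 1 < s.length) (hy : y + 1 < t.length) (hrx : r ≤ x) (hry : r ≤ y)
    (hc : Even x → colAt s x ≠ some .eq) :
    vseq inpF s (x + 1 + 1) = vseq inpF t (y + 1 + 1) := by
  have hlen : (t.take (y + 1)).length = y + 1 := by
    rw [List.length_take]; omega
  obtain ⟨z, h1, h2⟩ := h.exists_step hα (h'.take (y + 1)) hρ hlen
    (by rw [vseq_take le_rfl, hF]) hx hrx hry hc
  have e : t.take (y + 1 + 1) = t.take (y + 1) ++ [t[y + 1]] := by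
    rw [List.take_add_one, List.getElem?_eq_getElem hy]
    rfl
  have h3 := h'.take (y + 1 + 1)
  rw [e] at h3
  rw [h2, IsRun.det hα hρ' h1 h3, ← e, vseq_take le_rfl]

/-- A run stops where another run with the same F-view has been answered. -/
theorem IsRun.final (hα : A.testArena.IsInnocent A.testPlays α)
    (h : A.IsRun α ρ r s) (h' : A.IsRun α ρ' r t) (he : Even s.length)
    (hs : A.embed (forget s) ++ [A.ansOcc] ∈ α) {x y : ℕ} (hx : s.length = x + 1)
    (hF : vseq inpF s (x + 1) = vseq inpF t (y + 1)) (hy : y < t.length) :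
    t.length = y + 1 ∧ A.embed (forget t) ++ [A.ansOcc] ∈ α := by
  obtain ⟨⟨mx, px⟩, hmx⟩ : ∃ z, s[x]? = some z := ⟨_, List.getElem?_eq_getElem (by omega)⟩
  obtain ⟨⟨my, py⟩, hmy⟩ : ∃ z, t[y]? = some z := ⟨_, List.getElem?_eq_getElem (by omega)⟩
  obtain ⟨rfl, -⟩ := vseq_succ_inj h.legal.backward h'.legal.backward hmx hmy hF
  have hpar : Even x ↔ Even y := by
    rw [← h.legal.even_of_O hmx, ← h'.legal.even_of_O hmy]
  have hye : Even (y + 1) := by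
    rw [Nat.even_add_one, ← hpar, ← Nat.even_add_one, ← hx]
    exact he
  have hls := isLegal_forget h.legal
  have hlt := isLegal_forget h'.legal
  have hlen : ((forget t).take (y + 1)).length = y + 1 := by
    rw [List.length_take, length_forget]; omega
  -- The test answers according to the O-view, and O-views are computed inside F-views.
  have hoF : vseq ((A.copies Ordering).isBy .P) s (x + 1) =
      vseq ((A.copies Ordering).isBy .P) t (y + 1) := by
    rw [vseq, vseq, h.legal.oview_inpF (by omega) (getElem?_chain_last _ _),
      h'.legal.oview_inpF (by omega) (getElem?_chain_last _ _), JSeq.sub_map, JSeq.sub_map]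
    · have e1 := length_vseq (inp := inpF) (s := s) (n := x + 1) (by omega)
      have e2 := length_vseq (inp := inpF) (s := t) (n := y + 1) (by omega)
      change JSeq.sub (vseq inpF s (x + 1)) (vchain _ (vseq inpF s (x + 1))
        ((vchain inpF s (x + 1)).length - 1 + 1)) = JSeq.sub (vseq inpF t (y + 1))
          (vchain _ (vseq inpF t (y + 1)) ((vchain inpF t (y + 1)).length - 1 + 1))
      rw [← e1, ← e2, hF]
    · exact vchain_lt (by omega)
    · exact nodup_of_sorted (vchain_sorted _ _ _)
    · intro i hi
      have := lt_of_mem_chain hi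
      have := length_chain_succ_pos (prd inpF t) y
      change i < (chain (prd inpF t) (y + 1)).length
      omega
    · exact vchain_lt (by omega)
    · exact nodup_of_sorted (vchain_sorted _ _ _)
    · intro i hi
      have := lt_of_mem_chain hi
      have := length_chain_succ_pos (prd inpF s) x
      change i < (chain (prd inpF s) (x + 1)).length
      omega
  have hov : A.oview (forget s) = A.oview ((forget t).take (y + 1)) := by
    rw [hls.oview_eq, hlt.oview_take (by rw [length_forget]; omega), length_forget, hx,
      vseq_forget, vseq_forget, hoF]
  have key : A.embed ((forget t).take (y + 1)) ++ [A.ansOcc] ∈ α := by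
    refine test_mem_ans hα hls (by rwa [length_forget]) hs (by rwa [hlen]) ?_ (hlt.take _) hov
    intro n hn hle
    rw [hlen] at hle
    rw [List.take_take, min_eq_left hle]
    exact h'.test n hn (by omega)
  rcases Nat.lt_or_ge (y + 1) t.length with h1 | h1
  -- If the second run went on, the test would both answer and make a further move after the same
  -- play.
  · exfalso
    have h2 := h'.test (y + 1 + 1) hye.add_one (by omega)
    rw [List.take_add_one, List.getElem?_eq_getElem (by rwa [length_forget]), Option.toList_some,
      embed_append] at h2
    exact embedOcc_ne_ansOcc _ (test_det hα h2 key)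
  · refine ⟨by omega, ?_⟩
    rwa [List.take_of_length_le (by rw [length_forget]; omega)] at key

/-- Runs with equal F-views reach the next occurrence of colour `eq` with equal F-views. -/
theorem IsRun.next (hα : A.testArena.IsInnocent A.testPlays α)
    (hρ : ∀ c, A.IsInnocent A.plays (ρ c))
    (h : A.IsRun α ρ r s) (he : Even s.length)
    (hs : A.embed (forget s) ++ [A.ansOcc] ∈ α) {x y x' : ℕ}
    (hF : vseq inpF s (x + 1) = vseq inpF s (y + 1)) (hrx : r ≤ x) (hry : r ≤ y)
    (hy : y < s.length) (hc : Even x → colAt s x ≠ some .eq) (hxx' : x < x')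
    (hx' : colAt s x' = some .eq) (hno : ∀ l, x < l → l < x' → colAt s l ≠ some .eq) :
    ∃ y', y < y' ∧ colAt s y' = some .eq ∧ (∀ l, y < l → l < y' → colAt s l ≠ some .eq) ∧
      vseq inpF s (x' + 1) = vseq inpF s (y' + 1) := by
  have hx's : x' < s.length := by
    by_contra hle
    rw [colAt, List.getElem?_eq_none (by omega)] at hx'
    cases hx'
  induction hd : x' - x using Nat.strong_induction_on generalizing x y with
  | _ d ih =>
    -- If `y` were the last position, the answer given there would end the run at `x` too, but `x`
    -- is followed by `x'`.
    have hys : y + 1 < s.length := by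
      by_contra hle
      have := (IsRun.final hα h h he hs (x := y) (by omega) hF.symm (by omega)).1
      omega
    have hF' := IsRun.step hα hρ h h (fun _ _ => rfl) hF (by omega) hys hrx hry hc
    have hcol : colAt s (x + 1) = colAt s (y + 1) := by
      obtain ⟨⟨m, p⟩, hm⟩ : ∃ z, s[x + 1]? = some z := ⟨_, List.getElem?_eq_getElem (by omega)⟩
      obtain ⟨⟨m', p'⟩, hm'⟩ : ∃ z, s[y + 1]? = some z := ⟨_, List.getElem?_eq_getElem hys⟩
      obtain ⟨rfl, -⟩ := vseq_succ_inj h.legal.backward h.legal.backward hm hm' hF'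
      rw [colAt_eq hm, colAt_eq hm']
    rcases Nat.lt_or_ge (x + 1) x' with h1 | h1
    · have hne := hno (x + 1) (by omega) h1
      obtain ⟨y', h2, h3, h4, h5⟩ := ih (x' - (x + 1)) (by omega) hF' (by omega) (by omega)
        hys (fun _ => hne) h1 (fun l hl hl' => hno l (by omega) hl') rfl
      refine ⟨y', by omega, h3, fun l hl hl' => ?_, h5⟩
      rcases Nat.lt_or_ge (y + 1) l with h6 | h6
      · exact h4 l h6 hl'
      · obtain rfl : l = y + 1 := by omega
        rwa [← hcol]
    · obtain rfl : x' = x + 1 := by omega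
      exact ⟨y + 1, by omega, by rw [← hcol, hx'], fun l hl hl' => absurd hl' (by omega), hF'⟩

/-- The O-view of the thread at a position of the play. -/
def tview (s : JSeq (A.copies Ordering).Move) (n : ℕ) : JSeq A.Move :=
  vseq (A.isBy .P) (thread s) (cnt thr s n)

theorem cnt_thr_le (n : ℕ) : cnt thr s n ≤ (thread s).length := by
  rw [length_thread, ← cnt_length]
  rcases Nat.le_or_ge n s.length with h | h
  · exact cnt_mono _ _ h
  · unfold cnt
    rw [List.take_of_length_le h, List.take_length]

theorem tview_eq_nil {n : ℕ} : tview s n = [] ↔ cnt thr s n = 0 := vseq_eq_nil (cnt_thr_le n)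

/-- The O-view of the thread is the thread of the F-view. -/
theorem tview_congr (hs : (A.copies Ordering).IsLegal s) (ht : (A.copies Ordering).IsLegal t)
    {x y : ℕ} (hx : x ≤ s.length) (hy : y ≤ t.length) (h : vseq inpF s x = vseq inpF t y) :
    tview s x = tview t y := by
  rw [tview, tview, hs.oview_thread hx, ht.oview_thread hy, h]

/-- The occurrence of colour `eq` before a position. -/
theorem exists_prev {n : ℕ} (hn : n ≤ s.length) (h : 0 < cnt thr s n) :
    ∃ u < n, colAt s u = some .eq ∧ (∀ l, u < l → l < n → colAt s l ≠ some .eq) ∧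
      cnt thr s (u + 1) = cnt thr s n := by
  induction n with
  | zero => simp at h
  | succ n ih =>
    obtain ⟨⟨m, p⟩, hm⟩ : ∃ z, s[n]? = some z := ⟨_, List.getElem?_eq_getElem (by omega)⟩
    by_cases hc : col m = .eq
    · exact ⟨n, by omega, by rw [colAt_eq hm, hc], fun l h1 h2 => absurd h2 (by omega), rfl⟩
    · have hcnt := cnt_thr_succ hm
      rw [if_neg hc, Nat.add_zero] at hcnt
      rw [hcnt] at h ⊢
      obtain ⟨u, h1, h2, h3, h4⟩ := ih (by omega) h
      refine ⟨u, by omega, h2, fun l hl hl' => ?_, h4⟩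
      rcases Nat.lt_succ_iff_lt_or_eq.1 hl' with h5 | rfl
      · exact h3 l hl h5
      · rw [colAt_eq hm]
        simpa using hc

theorem exists_of_colAt {n : ℕ} {c : Ordering} (h : colAt s n = some c) :
    ∃ m p, s[n]? = some (m, p) ∧ col m = c := by
  simp only [colAt, Option.map_eq_some_iff] at h
  obtain ⟨⟨m, p⟩, h1, h2⟩ := h
  exact ⟨m, p, h1, h2⟩

/-- Unfolds one step of the O-view of the thread: before an O-move it continues with the preceding
view, before a P-move with the view at the justifier. These are the two cases of the induction in
`IsRun.vseq_inpF_of_tview`. -/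
theorem IsLegal.tview_succ_inj (hs : (A.copies Ordering).IsLegal s)
    (ht : (A.copies Ordering).IsLegal t) {x y : ℕ} {m m' : (A.copies Ordering).Move}
    {p p' : Option ℕ} (hx : s[x]? = some (m, p)) (hm : col m = .eq) (hy : t[y]? = some (m', p'))
    (hm' : col m' = .eq) (h : tview s (x + 1) = tview t (y + 1)) :
    m = m' ∧ ((A.copies Ordering).player m = .O → tview s x = tview t y) ∧
      ∀ k l, (A.copies Ordering).player m = .P → p = some k → p' = some l →
        tview s (k + 1) = tview t (l + 1) := by
  have hTx := hs.thread_getElem? hx hm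
  have hTy := ht.thread_getElem? hy hm'
  unfold tview at h ⊢
  rw [cnt_thr_succ_eq (by rw [colAt_eq hx, hm]), cnt_thr_succ_eq (by rw [colAt_eq hy, hm'])] at h
  obtain ⟨h1, h2⟩ := vseq_succ_inj hs.isLegal_thread.backward ht.isLegal_thread.backward hTx hTy h
  obtain rfl := copies_ext h1 (hm.trans hm'.symm)
  refine ⟨rfl, fun hO => ?_, ?_⟩
  · rw [copies_player] at hO
    rwa [prd_of_not hTx (by simp [hO]), prd_of_not hTy (by simp [hO])] at h2
  · rintro k l hP rfl rfl
    rw [copies_player] at hP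
    rw [Option.map_some] at hTx hTy
    rw [prd_some hTx (by simp [hP]), prd_some hTy (by simp [hP])] at h2
    rwa [cnt_thr_succ_eq (by rw [hs.colAt_ptr hx, colAt_eq hx, hm]),
      cnt_thr_succ_eq (by rw [ht.colAt_ptr hy, colAt_eq hy, hm'])]

/-- Justifiers of moves of the thread belong to the thread, so its first occurrence has no
justifier, and the colouring puts it at `r`. -/
theorem IsRun.eq_root (h : A.IsRun α ρ r s) {x : ℕ} (hx : colAt s x = some .eq)
    (h0 : cnt thr s x = 0) : x = r := by
  obtain ⟨m, p, hm, hc⟩ := exists_of_colAt hx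
  cases p with
  | none =>
    have := h.rooted x m hm
    rw [hc] at this
    exact compare_eq_iff_eq.1 this.symm
  | some k =>
    have h1 := cnt_thr_succ_eq ((h.legal.colAt_ptr hm).trans hx)
    have h2 := cnt_mono thr s (Nat.succ_le_of_lt (h.legal.backward _ _ _ hm))
    rw [Nat.succ_eq_add_one] at h2
    omega

/-- F-views of equal coloured responses with equal F-views of their justifiers agree. -/
theorem vseq_inpF_ptr (hs : s.Backward) (ht : t.Backward) {x y k l : ℕ}
    {m : (A.copies Ordering).Move} (hx : s[x]? = some (m, some k)) (hy : t[y]? = some (m, some l))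
    (hm : inpF m = true) (h : vseq inpF s (k + 1) = vseq inpF t (l + 1)) :
    vseq inpF s (x + 1) = vseq inpF t (y + 1) := by
  have hxs := (List.getElem?_eq_some_iff.1 hx).1
  have hyt := (List.getElem?_eq_some_iff.1 hy).1
  have hk := hs x m k hx
  have hl := ht y m l hy
  have hlen : (vchain inpF s (k + 1)).length = (vchain inpF t (l + 1)).length := by
    rw [← length_vseq (by omega), ← length_vseq (by omega), h]
  have e1 : (vchain inpF s (k + 1)).idxOf? k = some ((vchain inpF s (k + 1)).length - 1) :=
    (idxOf?_eq_some_of_nodup (nodup_of_sorted (vchain_sorted _ _ _))).2 (getElem?_chain_last _ _)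
  have e2 : (vchain inpF t (l + 1)).idxOf? l = some ((vchain inpF t (l + 1)).length - 1) :=
    (idxOf?_eq_some_of_nodup (nodup_of_sorted (vchain_sorted _ _ _))).2 (getElem?_chain_last _ _)
  rw [vseq_succ hs hx, vseq_succ ht hy, prd_some hx hm, prd_some hy hm, h, Option.bind_some,
    Option.bind_some, e1, e2, hlen]

/-- After an O-move of the thread, P replies at once in the thread. So the occurrence of the thread
that precedes an even position is a P-move. -/
theorem IsRun.odd_of_next (h : A.IsRun α ρ r s) {u x : ℕ} (hu : colAt s u = some .eq)
    (hux : u < x) (hxs : x < s.length) (hno : ∀ l, u < l → l < x → colAt s l ≠ some .eq)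
    (hx : Even x) : Odd u := by
  rw [← Nat.not_even_iff_odd]
  intro he
  have hlt : u + 1 < x := by
    rcases Nat.lt_or_ge (u + 1) x with h1 | h1
    · exact h1
    · obtain rfl : x = u + 1 := by omega
      exact absurd he (Nat.even_add_one.1 hx)
  obtain ⟨⟨m, p⟩, hm⟩ : ∃ z, s[u + 1]? = some z := ⟨_, List.getElem?_eq_getElem (by omega)⟩
  have hP : (A.copies Ordering).player m = .P := (h.legal.odd_of_P hm).2 he.add_one
  exact hno (u + 1) (by omega) hlt (by rw [← h.legal.colAt_succ_of_P hm hP, hu])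

/-- In an answered run, the O-views of the thread determine the F-views. -/
theorem IsRun.vseq_inpF_of_tview (hα : A.testArena.IsInnocent A.testPlays α)
    (hρ : ∀ c, A.IsInnocent A.plays (ρ c))
    (h : A.IsRun α ρ r s) (he : Even s.length)
    (hs : A.embed (forget s) ++ [A.ansOcc] ∈ α) {x y : ℕ} (hx : colAt s x = some .eq)
    (hy : colAt s y = some .eq) (hT : tview s (x + 1) = tview s (y + 1)) :
    vseq inpF s (x + 1) = vseq inpF s (y + 1) := by
  induction x using Nat.strong_induction_on generalizing y with
  | _ x ih =>
    obtain ⟨m, p, hmx, hm⟩ := exists_of_colAt hx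
    obtain ⟨m', p', hmy, hm'⟩ := exists_of_colAt hy
    have hxs := (List.getElem?_eq_some_iff.1 hmx).1
    have hys := (List.getElem?_eq_some_iff.1 hmy).1
    obtain ⟨rfl, hO, hP⟩ := h.legal.tview_succ_inj h.legal hmx hm hmy hm' hT
    cases hpl : (A.copies Ordering).player m with
    | O =>
      have hO := hO hpl
      have hxe := (h.legal.even_of_O hmx).1 hpl
      have hye := (h.legal.even_of_O hmy).1 hpl
      rcases Nat.eq_zero_or_pos (cnt thr s x) with h0 | h0
      · have h1 : cnt thr s y = 0 := by
          rw [← tview_eq_nil, ← hO, tview_eq_nil, h0]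
        rw [h.eq_root hx h0, h.eq_root hy h1]
      · have h1 : 0 < cnt thr s y := by
          rw [Nat.pos_iff_ne_zero, Ne, ← tview_eq_nil, ← hO, tview_eq_nil]
          omega
        obtain ⟨a, ha1, ha2, ha3, ha4⟩ := exists_prev hxs.le h0
        obtain ⟨b, hb1, hb2, hb3, hb4⟩ := exists_prev hys.le h1
        have h2 : tview s (a + 1) = tview s (b + 1) := by
          unfold tview at hO ⊢
          rw [ha4, hb4, hO]
        have hodd := h.odd_of_next ha2 ha1 hxs ha3 hxe
        -- The preceding occurrences of the thread have equal F-views by induction. The environment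
        -- is to move there, and it acts alike until it returns to the thread.
        obtain ⟨y', h3, h4, h5, h6⟩ := IsRun.next hα hρ h he hs (ih a ha1 ha2 hb2 h2)
          (h.le_of_eq ha2) (h.le_of_eq hb2) (by omega)
          (fun h' => absurd hodd (Nat.not_odd_iff_even.2 h')) ha1 hx ha3
        obtain rfl : y' = y := by
          rcases lt_trichotomy y' y with h7 | h7 | h7
          · exact absurd h4 (hb3 y' h3 h7)
          · exact h7
          · exact absurd hy (h5 y hb1 h7)
        exact h6
    | P =>
      obtain ⟨k, rfl⟩ := h.legal.exists_ptr_of_P hmx hpl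
      obtain ⟨l, rfl⟩ := h.legal.exists_ptr_of_P hmy hpl
      -- At a P-move of the thread the F-view is that of the justifier, extended by the move.
      exact vseq_inpF_ptr h.legal.backward h.legal.backward hmx hmy (inpF_eq_true.2 ⟨hpl, hm⟩)
        (ih k (h.legal.backward _ _ _ hmx) ((h.legal.colAt_ptr hmx).trans hx)
          ((h.legal.colAt_ptr hmy).trans hy) (hP k l hpl rfl rfl))

/-- Consecutive occurrences of the thread after equal O-views of the thread. -/
theorem IsRun.next_of_tview (hα : A.testArena.IsInnocent A.testPlays α)
    (hρ : ∀ c, A.IsInnocent A.plays (ρ c))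
    (h : A.IsRun α ρ r s) (he : Even s.length)
    (hs : A.embed (forget s) ++ [A.ansOcc] ∈ α) {a b x : ℕ} (ha : colAt s a = some .eq)
    (hb : colAt s b = some .eq) (hT : tview s (a + 1) = tview s (b + 1)) (hodd : Odd a)
    (hax : a < x) (hx : colAt s x = some .eq)
    (hno : ∀ l, a < l → l < x → colAt s l ≠ some .eq) :
    ∃ y, b < y ∧ colAt s y = some .eq ∧ (∀ l, b < l → l < y → colAt s l ≠ some .eq) ∧
      tview s (x + 1) = tview s (y + 1) := by
  have hbs : b < s.length := by
    obtain ⟨m, p, h1, -⟩ := exists_of_colAt hb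
    exact (List.getElem?_eq_some_iff.1 h1).1
  have hxs : x < s.length := by
    obtain ⟨m, p, h1, -⟩ := exists_of_colAt hx
    exact (List.getElem?_eq_some_iff.1 h1).1
  obtain ⟨y, h1, h2, h3, h4⟩ := IsRun.next hα hρ h he hs
    (IsRun.vseq_inpF_of_tview hα hρ h he hs ha hb hT)
    (h.le_of_eq ha) (h.le_of_eq hb) hbs
    (fun h' => absurd hodd (Nat.not_odd_iff_even.2 h')) hax hx hno
  have hys : y < s.length := by
    obtain ⟨m, p, h1, -⟩ := exists_of_colAt h2
    exact (List.getElem?_eq_some_iff.1 h1).1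
  exact ⟨y, h1, h2, h3, tview_congr h.legal h.legal (by omega) (by omega) h4⟩

end Arena
-- The O-deterministic set given by a thread.
namespace Arena

section
variable {A : Arena.{u}} {s t : JSeq A.Move}

theorem answersPending_of_embed (hs : A.IsLegal s)
    (h : A.testArena.AnswersPending (A.embed s)) : A.AnswersPending s := by
  rintro w ⟨m, p⟩ rfl hm
  rw [embed_concat] at h
  obtain ⟨k, hk, hp⟩ := h _ _ rfl hm
  obtain rfl := Option.some.inj hk
  cases p with
  | none =>
    have h1 := A.initial_kind m (hs.initial_of_none w.length m (by simp))
    rw [h1] at hm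
    cases hm
  | some k =>
    refine ⟨k, rfl, unanswered_embed.1 hp.1, fun j hj => ?_⟩
    exact Nat.le_of_succ_le_succ (hp.2 (j + 1) (unanswered_embed.2 hj))

/-- The O-views of odd-length prefixes of `w` and of `w` itself. -/
def viewSet (A : Arena.{u}) (w : JSeq A.Move) : Set (JSeq A.Move) :=
  {v | ∃ n ≤ w.length, (Odd n ∨ n = w.length) ∧ v = vseq (A.isBy .P) w n}

/-- The O-view does not jump at an O-move, so removing a final O-move from a view leaves the view of
the prefix just before it. -/
theorem exists_of_concat_mem_viewSet {w v : JSeq A.Move} {o : A.Move × Option ℕ}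
    (hw : A.IsLegal w) (ho : A.player o.1 = .O) (h : v ++ [o] ∈ A.viewSet w) :
    ∃ k < w.length, Even k ∧ v = vseq (A.isBy .P) w k ∧
      v ++ [o] = vseq (A.isBy .P) w (k + 1) := by
  obtain ⟨n, hn, -, h1⟩ := h
  cases n with
  | zero => simp at h1
  | succ k =>
    obtain ⟨⟨m, p⟩, hx⟩ : ∃ z, w[k]? = some z := ⟨_, List.getElem?_eq_getElem (by omega)⟩
    have h2 := h1
    rw [vseq_succ hw.backward hx] at h2
    obtain ⟨h3, h4⟩ := List.append_inj' h2 rfl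
    simp only [List.cons.injEq, and_true] at h4
    rw [h4] at ho
    rw [prd_of_not hx (by simp [show A.player m = .O from ho])] at h3
    exact ⟨k, hn, (hw.even_of_O hx).1 ho, h3, h1⟩

/-- Views are closed under pointers and lose none of them. An unjustified occurrence of the view is
thus unjustified in `w`, which leaves only position `0`. -/
theorem vseq_head? {w : JSeq A.Move} (hw : A.IsLegal w) {m₀ : A.Move}
    (h0 : w[0]? = some (m₀, none))
    (hroot : ∀ (j : ℕ) (m : A.Move), w[j]? = some (m, none) → j = 0) {n : ℕ} (hn : n ≤ w.length)
    (hpos : 0 < n) {π : Player} :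
    (vseq (A.isBy π) w n)[0]? = some (m₀, none) ∧
      ∀ (i : ℕ) (m : A.Move), (vseq (A.isBy π) w n)[i]? = some (m, none) → i = 0 := by
  have hleg := hw.vseq_isLegal (π := π) hn
  have hr := vchain_lt (inp := A.isBy π) hn
  have hsort := vchain_sorted (A.isBy π) w n
  have key : ∀ (i : ℕ) (m : A.Move), (vseq (A.isBy π) w n)[i]? = some (m, none) →
      (vchain (A.isBy π) w n)[i]? = some 0 ∧ w[0]? = some (m, none) := by
    intro i m hi
    obtain ⟨j, p, h1, h2, h3⟩ := JSeq.exists_of_getElem?_sub hr hi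
    cases p with
    | none =>
      obtain rfl := hroot j m h2
      exact ⟨h1, h2⟩
    | some k =>
      have := hw.view_closed (List.mem_of_getElem? h1) h2
      rw [Option.bind_some] at h3
      exact absurd this (List.idxOf?_eq_none_iff.1 h3.symm)
  have hlen : 0 < (vseq (A.isBy π) w n).length := by
    rw [List.length_pos_iff, Ne, vseq_eq_nil hn]
    omega
  obtain ⟨⟨m, p⟩, hx⟩ : ∃ z, (vseq (A.isBy π) w n)[0]? = some z :=
    ⟨_, List.getElem?_eq_getElem hlen⟩
  obtain rfl : p = none := by
    cases p with
    | none => rfl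
    | some k =>
      have := hleg.backward 0 m k hx
      omega
  obtain ⟨h1, h2⟩ := key 0 m hx
  refine ⟨by rw [hx, ← h2, h0], fun i m' hi => ?_⟩
  exact idx_eq_of_sorted hsort (key i m' hi).1 h1

theorem singleThreaded_of (h : ∃ m, s[0]? = some (m, none))
    (h' : ∀ (i : ℕ) (m : A.Move), s[i]? = some (m, none) → i = 0) : A.SingleThreaded s := by
  obtain ⟨m, hm⟩ := h
  cases s with
  | nil => simp at hm
  | cons a s =>
    rw [List.getElem?_cons_zero, Option.some.injEq] at hm
    subst hm
    rw [SingleThreaded, List.countP_cons_of_pos (by simp), Nat.add_eq_right, List.countP_eq_zero]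
    rintro ⟨m', p⟩ hx
    obtain ⟨i, hi⟩ := List.mem_iff_getElem?.1 hx
    cases p with
    | none =>
      have := h' (i + 1) m' (by rw [List.getElem?_cons_succ, hi])
      omega
    | some k => simp

end

variable {A : Arena.{u}} {s t : JSeq (A.copies Ordering).Move}
  {α : Set (JSeq A.testArena.Move)} {ρ ρ' : Ordering → Set (JSeq A.Move)} {r : ℕ}

/-- O-moves are bracketed by the test and P-moves by the strategies, in each case in the view on
which the response is based; the pending question of that view is the pending question of the play.
-/
theorem IsRun.bracketed (hα : A.testArena.IsInnocent A.testPlays α)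
    (hρ : ∀ c, A.IsInnocent A.plays (ρ c)) (h : A.IsRun α ρ r s) {n : ℕ} (hn : n ≤ s.length) :
    A.Bracketed (forget s) n := by
  have hl := isLegal_forget h.legal
  induction n with
  | zero => intro j hj; omega
  | succ n ih =>
    obtain ⟨⟨m, p⟩, hx⟩ : ∃ z, s[n]? = some z := ⟨_, List.getElem?_eq_getElem (by omega)⟩
    have hx' : (forget s)[n]? = some (base m, p) := by rw [getElem?_forget, hx]; rfl
    rcases Nat.even_or_odd n with he | ho
    · have hO := (hl.even_of_O hx').2 he
      refine hl.bracketed_succ hx' (π := .P) (by rw [hO]; simp) (ih (by omega)) ?_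
      have h1 := hα.bracketed _ (h.test (n + 1) he.add_one hn)
      rw [pview_embed (hl.take _), hl.oview_take (by rw [length_forget]; omega)] at h1
      exact answersPending_of_embed (hl.vseq_isLegal (by rw [length_forget]; omega)) h1
    · have hP := (hl.odd_of_P hx').2 ho
      refine hl.bracketed_succ hx' (π := .O) (by rw [hP]; simp) (ih (by omega)) ?_
      obtain ⟨u, hu, hu'⟩ := h.resp n m p ho hx
      rw [← hu']
      exact (hρ _).bracketed u hu

/-- Answered runs are complete. -/
theorem IsRun.opens_eq_nil (hα : A.testArena.IsInnocent A.testPlays α)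
    (hρ : ∀ c, A.IsInnocent A.plays (ρ c)) (h : A.IsRun α ρ r s) (he : Even s.length)
    (hs : A.embed (forget s) ++ [A.ansOcc] ∈ α) : A.opens (forget s) s.length = [] := by
  have hl := isLegal_forget h.legal
  have h1 := hα.bracketed _ hs
  rw [pview_embed_ans hl (by rwa [length_forget])] at h1
  obtain ⟨k, hk, hp⟩ := h1 _ _ rfl rfl
  obtain rfl : 0 = k := Option.some.inj hk
  cases hlen : s.length with
  | zero => rfl
  | succ n =>
    have hb := h.bracketed hα hρ le_rfl
    rw [hlen] at hb
    obtain ⟨⟨m, p⟩, hx⟩ : ∃ z, (forget s)[n]? = some z :=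
      ⟨_, List.getElem?_eq_getElem (by rw [length_forget]; omega)⟩
    have hodd : Odd n := by
      rw [hlen] at he
      simpa [Nat.even_add_one] using he
    have hv := hl.bracketed_view (π := .P) (by rw [length_forget, hlen]) hb
    rw [hl.oview_eq, length_forget, hlen] at hp
    -- The final answer answers `q`, at index `0` of the view. An open question of the O-view would
    -- come later and would be pending instead.
    have h2 : A.opens (vseq (A.isBy .P) (forget s) (n + 1))
        (vseq (A.isBy .P) (forget s) (n + 1)).length = [] := by
      rw [← hv.complete_iff]
      intro i hi
      have := hp.2 _ (unanswered_embed.2 hi)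
      omega
    have h3 := hl.opens_view (π := .P) hx ((hl.odd_of_P hx).2 hodd) hb
    rw [h2, List.head?_nil, Option.map_none] at h3
    exact List.head?_eq_none_iff.1 h3.symm

/-- Colour `eq` of an unjustified move means that it sits at `r`; hence the thread has a single
initial move, as membership of its views in a set `S` requires. -/
theorem IsRun.thread_zero (h : A.IsRun α ρ r s) {m : (A.copies Ordering).Move}
    (hm : s[r]? = some (m, none)) : (thread s)[0]? = some (base m, none) ∧
      ∀ (j : ℕ) (m : A.Move), (thread s)[j]? = some (m, none) → j = 0 := by
  have hc : col m = .eq := (h.rooted r m hm).trans (compare_eq_iff_eq.2 rfl)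
  have h0 : cnt thr s r = 0 := by
    by_contra h0
    obtain ⟨u, h1, h2, -⟩ := exists_prev (s := s)
      (List.getElem?_eq_some_iff.1 hm).1.le (Nat.pos_of_ne_zero h0)
    have := h.le_of_eq h2
    omega
  refine ⟨by rw [← h0, h.legal.thread_getElem? hm hc]; rfl, fun j m' hj => ?_⟩
  obtain ⟨n, m'', p, -, h1, h2, -, rfl⟩ := exists_of_getElem?_thread hj
  rw [h.legal.thread_getElem? h1 h2, Option.some.injEq, Prod.mk.injEq] at hj
  cases p with
  | some k => simp at hj
  | none =>
    have := h.rooted n m'' h1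
    rw [h2] at this
    rw [compare_eq_iff_eq.1 this.symm, h0]

/-- Elements of the thread, as elements of the play. -/
theorem exists_keep_thr {j : ℕ} (hj : j < (thread s).length) :
    ∃ x, (keep thr s)[j]? = some x ∧ colAt s x = some .eq ∧ cnt thr s x = j ∧
      x < s.length ∧ tview s (x + 1) = vseq (A.isBy .P) (thread s) (j + 1) := by
  rw [length_thread] at hj
  have h1 : (keep thr s)[j]? = some (keep thr s)[j] := List.getElem?_eq_getElem hj
  have h2 := mem_keep_thr.1 (List.getElem_mem hj)
  have h3 := cnt_of_keep_getElem? h1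
  exact ⟨_, h1, h2, h3, keep_lt _ (List.getElem_mem hj),
    by rw [tview, cnt_thr_succ_eq h2, h3]⟩

/-- A thread of odd length would end with an O-move. The run does not stop there, by parity, and the
reply of P would lengthen the thread. -/
theorem IsRun.even_thread (h : A.IsRun α ρ r s) (he : Even s.length) : Even (thread s).length := by
  by_contra ho
  rw [Nat.not_even_iff_odd] at ho
  obtain ⟨k, hk⟩ := ho
  obtain ⟨x, h1, h2, h3, h4, -⟩ := exists_keep_thr (s := s) (j := 2 * k) (by omega)
  obtain ⟨m, p, hm, hc⟩ := exists_of_colAt h2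
  have hT := h.legal.thread_getElem? hm hc
  rw [h3] at hT
  have hO := (h.legal.isLegal_thread.even_of_O hT).2 (even_two_mul k)
  have hx := (h.legal.even_of_O hm).1 hO
  have hlt : x + 1 < s.length := by
    rcases Nat.lt_or_ge (x + 1) s.length with h5 | h5
    · exact h5
    · have : s.length = x + 1 := by omega
      rw [this] at he
      exact absurd hx (Nat.even_add_one.1 he)
  obtain ⟨⟨m', p'⟩, hm'⟩ : ∃ z, s[x + 1]? = some z := ⟨_, List.getElem?_eq_getElem hlt⟩
  have hP : (A.copies Ordering).player m' = .P := (h.legal.odd_of_P hm').2 hx.add_one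
  have h6 := cnt_thr_succ_eq ((h.legal.colAt_succ_of_P hm' hP).symm.trans h2)
  have h7 := cnt_thr_succ_eq h2
  have h8 := cnt_thr_le (s := s) (x + 1 + 1)
  omega

/-- P-views of the thread are P-views of the run, hence views of `ρ .eq`, and an innocent strategy
contains every play with such views. -/
theorem IsRun.thread_mem (h : A.IsRun α ρ r s) (hρ : A.IsInnocent A.plays (ρ .eq))
    (he : Even s.length) : thread s ∈ ρ .eq := by
  refine hρ.mem_of_views h.legal.isLegal_thread (h.even_thread he) fun n hn hlt => ?_
  obtain ⟨x, h1, h2, h3, h4, -⟩ := exists_keep_thr hlt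
  obtain ⟨m, p, hm, hc⟩ := exists_of_colAt h2
  have hT := h.legal.thread_getElem? hm hc
  rw [h3] at hT
  have hP := (h.legal.isLegal_thread.odd_of_P hT).2 hn
  rw [h.legal.isLegal_thread.pview_take (by omega), ← h.legal.pview_thread h1, ← hc]
  exact h.resp x m p ((h.legal.odd_of_P hm).1 hP) hm

/-- The views of the thread of an answered run form an O-deterministic set. -/
theorem IsRun.isODeterministic (hα : A.testArena.IsInnocent A.testPlays α)
    (hρ : ∀ c, A.IsInnocent A.plays (ρ c)) (h : A.IsRun α ρ r s) (he : Even s.length)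
    (hs : A.embed (forget s) ++ [A.ansOcc] ∈ α) {m : (A.copies Ordering).Move}
    (hm : s[r]? = some (m, none)) : A.IsODeterministic (A.viewSet (thread s)) := by
  have hw := h.legal.isLegal_thread
  obtain ⟨h0, hroot⟩ := h.thread_zero hm
  have hwpos : 0 < (thread s).length := (List.getElem?_eq_some_iff.1 h0).1
  have hhead : ∀ v ∈ A.viewSet (thread s), v[0]? = some (base m, none) ∧
      ∀ (i : ℕ) (m : A.Move), v[i]? = some (m, none) → i = 0 := by
    rintro v ⟨n, hn, hn', rfl⟩
    refine vseq_head? hw h0 hroot hn ?_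
    rcases hn' with h1 | h1
    · exact h1.pos
    · omega
  refine ⟨?_, ?_, ?_, ?_, ?_⟩
  · rintro v ⟨n, hn, -, rfl⟩
    have hl := hw.vseq_isLegal (π := .P) hn
    exact ⟨hl, by rw [hl.oview_eq, hw.vseq_vseq hn]⟩
  · rintro v ⟨n, hn, -, rfl⟩
    have hb := (h.legal.bracketed_thread le_rfl (h.bracketed hα hρ le_rfl)).1
    rw [cnt_length, ← length_thread] at hb
    exact (hw.bracketed_view hn (hb.mono hn)).wellBracketed
  · intro v o₁ o₂ ho₁ ho₂ h₁ h₂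
    obtain ⟨k₁, hk₁, -, hv₁, hvo₁⟩ := exists_of_concat_mem_viewSet hw ho₁ h₁
    obtain ⟨k₂, hk₂, he₂, hv₂, hvo₂⟩ := exists_of_concat_mem_viewSet hw ho₂ h₂
    -- Both continuations are views of prefixes of the thread, so it is enough that equal views
    -- before the O-moves lead to equal views after them.
    suffices hsuff : vseq (A.isBy .P) (thread s) (k₁ + 1) =
        vseq (A.isBy .P) (thread s) (k₂ + 1) by
      rw [← hvo₁, ← hvo₂] at hsuff
      simpa using hsuff
    have hvv := hv₁.symm.trans hv₂
    rcases Nat.eq_zero_or_pos k₁ with rfl | hpos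
    · have : k₂ = 0 := by
        rw [← vseq_eq_nil (inp := A.isBy .P) hk₂.le, ← hvv, vseq_zero]
      rw [this]
    · have hpos₂ : 0 < k₂ := by
        rw [Nat.pos_iff_ne_zero, Ne, ← vseq_eq_nil (inp := A.isBy .P) hk₂.le, ← hvv,
          vseq_eq_nil hk₁.le]
        omega
      obtain ⟨x₁, -, hx₁, hc₁, hl₁, ht₁⟩ := exists_keep_thr hk₁
      obtain ⟨x₂, -, hx₂, hc₂, hl₂, ht₂⟩ := exists_keep_thr hk₂
      rw [← ht₁, ← ht₂]
      obtain ⟨u₁, ha₁, hb₁, hd₁, he₁⟩ := exists_prev hl₁.le (by omega)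
      obtain ⟨u₂, ha₂, hb₂, hd₂, hf₂⟩ := exists_prev hl₂.le (by omega)
      obtain ⟨mx, px, hmx, hcx⟩ := exists_of_colAt hx₁
      have hTx := h.legal.thread_getElem? hmx hcx
      have he₁' : Even x₁ := by
        obtain ⟨k, hk, hke, hkv, -⟩ := exists_of_concat_mem_viewSet hw ho₁ h₁
        obtain ⟨q, hq⟩ := vseq_getElem?_last (inp := A.isBy .P) hw.backward hTx
        rw [hc₁, ← hvo₁] at hq
        rw [List.length_append, List.length_singleton, Nat.add_sub_cancel,
          List.getElem?_concat_length, Option.some.injEq] at hq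
        rw [hq] at ho₁
        exact (h.legal.even_of_O hmx).1 ho₁
      have hodd := h.odd_of_next hb₁ ha₁ hl₁ hd₁ he₁'
      -- The O-moves of the thread are made by the environment, which acts alike after equal O-views
      -- of the thread.
      obtain ⟨y, h3, h4, h5, h6⟩ := IsRun.next_of_tview hα hρ h he hs hb₁ hb₂
        (by rw [tview, tview, he₁, hf₂, hc₁, hc₂, hvv]) hodd ha₁ hx₁ hd₁
      obtain rfl : y = x₂ := by
        rcases lt_trichotomy y x₂ with h7 | h7 | h7
        · exact absurd h4 (hd₂ y h3 h7)
        · exact h7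
        · exact absurd hx₂ (h5 _ ha₂ h7)
      exact h6
  · intro v hv
    exact singleThreaded_of ⟨_, (hhead v hv).1⟩ (hhead v hv).2
  · intro v hv v' hv'
    rw [List.head?_eq_getElem?, List.head?_eq_getElem?, (hhead v hv).1, (hhead v' hv').1]

/-- The test given by the views of the thread of an answered run accepts the thread. -/
theorem IsRun.embed_thread_mem (hα : A.testArena.IsInnocent A.testPlays α)
    (hρ : ∀ c, A.IsInnocent A.plays (ρ c)) (h : A.IsRun α ρ r s) (he : Even s.length)
    (hs : A.embed (forget s) ++ [A.ansOcc] ∈ α) :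
    A.embed (thread s) ++ [A.ansOcc] ∈ A.alpha (A.viewSet (thread s)) := by
  have hw := h.legal.isLegal_thread
  have hwe := h.even_thread he
  rw [alpha, embed_ans_mem_iff hw hwe]
  constructor
  · intro n hn hlt
    obtain ⟨⟨m, p⟩, hx⟩ : ∃ z, (thread s)[n]? = some z := ⟨_, List.getElem?_eq_getElem hlt⟩
    have hO := (hw.even_of_O hx).2 hn
    obtain ⟨o, ho⟩ := hw.exists_vseq_concat (π := .P) hx (by rw [hO]; simp)
    have ho' : A.player o.1 = .O := by
      obtain ⟨q, hq⟩ := vseq_getElem?_last (inp := A.isBy .P) hw.backward hx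
      rw [ho, List.length_append, List.length_singleton, Nat.add_sub_cancel,
        List.getElem?_concat_length, Option.some.injEq] at hq
      rw [hq]
      exact hO
    refine ⟨_, Or.inl ⟨vseq (A.isBy .P) (thread s) n, o, ?_, ho', rfl⟩, ?_, ?_⟩
    · exact ⟨n + 1, hlt, Or.inl hn.add_one, ho.symm⟩
    · rw [hw.oview_take hlt.le]
    · rw [hw.oview_take hlt, ho, embed_append]
      rfl
  -- An answered run has no open question, so neither has its thread. A nonempty thread ends with a
  -- P-move, whose O-view shows the pending question; the O-view is therefore complete as well.
  · have hb := h.legal.bracketed_thread le_rfl (h.bracketed hα hρ le_rfl)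
    rw [cnt_length, ← length_thread, h.opens_eq_nil hα hρ he hs, List.filter_nil,
      List.map_nil] at hb
    refine Or.inr ⟨_, ⟨_, le_rfl, Or.inr rfl, hw.oview_eq⟩, ?_, rfl⟩
    rw [hw.oview_eq, (hw.bracketed_view le_rfl hb.1).complete_iff]
    cases hlen : (thread s).length with
    | zero => simp [opens]
    | succ n =>
      rw [hlen] at hb hwe
      obtain ⟨⟨m, p⟩, hx⟩ : ∃ z, (thread s)[n]? = some z :=
        ⟨_, List.getElem?_eq_getElem (by omega)⟩
      have hP := (hw.odd_of_P hx).2 (by simpa [Nat.even_add_one] using hwe)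
      have h1 := hw.opens_view hx hP hb.1
      rw [hb.2, List.head?_nil, Option.map_eq_none_iff] at h1
      exact List.head?_eq_none_iff.1 h1

end Arena
-- Turning an accepted play into a run.
namespace Arena

section
variable {A : Arena.{u}} {s t w : JSeq A.Move}

/-- What membership in the test given by the views of `w` says about a play. -/
theorem of_embed_ans_mem_alpha (ht : A.IsLegal t) (he : Even t.length)
    (h : A.embed t ++ [A.ansOcc] ∈ A.alpha (A.viewSet w)) :
    (∀ n, Even n → n < t.length → vseq (A.isBy .P) t (n + 1) ∈ A.viewSet w) ∧
      vseq (A.isBy .P) t t.length ∈ A.viewSet w := by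
  obtain ⟨h1, h2⟩ := (embed_ans_mem_iff ht he).1 h
  constructor
  · intro n hn hlt
    obtain ⟨x, hx, hx1, hx2⟩ := h1 n hn hlt
    obtain ⟨o, -, h3, -⟩ := exists_of_mem_alphaViewFunction hx hx1 hx2
    rwa [ht.oview_take hlt] at h3
  · rw [← ht.oview_eq]
    rcases h2 with ⟨v, o, -, -, h3⟩ | ⟨v, hv, -, h3⟩
    · exact absurd (Prod.mk.inj h3).2.symm (embedOcc_ne_ansOcc o)
    · rwa [embed_injective (Prod.mk.inj h3).1]

end

variable {A : Arena.{u}} {s : JSeq (A.copies Ordering).Move} {t : JSeq A.Move}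
  {t' : JSeq (A.copies Ordering).Move}
  {α : Set (JSeq A.testArena.Move)} {ρ ρ' : Ordering → Set (JSeq A.Move)} {r : ℕ}

/-- O-views of nonempty even-length prefixes of an accepted play come from the thread. -/
theorem exists_tview_of_even (hw : A.IsLegal (thread s))
    (ht : A.IsLegal t) (he : Even t.length)
    (h : A.embed t ++ [A.ansOcc] ∈ A.alpha (A.viewSet (thread s))) {n : ℕ} (hn : Even n)
    (hpos : 0 < n) (hle : n ≤ t.length) :
    ∃ x, colAt s x = some .eq ∧ vseq (A.isBy .P) t n = tview s (x + 1) := by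
  obtain ⟨h1, h2⟩ := of_embed_ans_mem_alpha ht he h
  obtain ⟨k, hk, hk'⟩ : ∃ k ≤ (thread s).length,
      vseq (A.isBy .P) t n = vseq (A.isBy .P) (thread s) k := by
    -- For a proper prefix the view is not itself known to lie in the set, but its extension by the
    -- next O-move does; the full play is covered by the answer of the test.
    rcases Nat.lt_or_eq_of_le hle with hlt | rfl
    · obtain ⟨⟨m, p⟩, hx⟩ : ∃ z, t[n]? = some z := ⟨_, List.getElem?_eq_getElem hlt⟩
      have hO := (ht.even_of_O hx).2 hn
      have h3 := h1 n hn hlt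
      rw [ht.vseq_last hx (by simp [show A.player m = .O from hO])] at h3
      obtain ⟨k, hk, -, hk', -⟩ := exists_of_concat_mem_viewSet hw (by exact hO) h3
      exact ⟨k, hk.le, hk'⟩
    · obtain ⟨k, hk, -, hk'⟩ := h2
      exact ⟨k, hk, hk'⟩
  cases k with
  | zero =>
    rw [vseq_zero, vseq_eq_nil hle] at hk'
    omega
  | succ k =>
    obtain ⟨x, -, hx, -, -, hT⟩ := exists_keep_thr (s := s) (j := k) (by omega)
    exact ⟨x, hx, by rw [hT, hk']⟩

/-- `t'` is a run whose thread is a prefix of `t` and whose F-views are F-views of `s`; its own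
F-view is that of `s` at position `x`. -/
structure Follows (α : Set (JSeq A.testArena.Move)) (ρ : Ordering → Set (JSeq A.Move)) (r : ℕ)
    (s : JSeq (A.copies Ordering).Move) (t : JSeq A.Move) (t' : JSeq (A.copies Ordering).Move)
    (x y : ℕ) : Prop where
  run : A.IsRun α ρ r t'
  len : t'.length = y + 1
  le_y : r ≤ y
  le_x : r ≤ x
  lt_x : x < s.length
  view : vseq inpF s (x + 1) = vseq inpF t' (y + 1)
  all : ∀ y₀, r ≤ y₀ → y₀ < t'.length →
    ∃ x₀ < s.length, r ≤ x₀ ∧ vseq inpF s (x₀ + 1) = vseq inpF t' (y₀ + 1)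
  thread : thread t' <+: t

theorem Follows.concat {x x' y : ℕ} (h : A.Follows α ρ r s t t' x y)
    {z : (A.copies Ordering).Move × Option ℕ} (hr : A.IsRun α ρ r (t' ++ [z])) (hx' : r ≤ x')
    (hx's : x' < s.length) (hv : vseq inpF s (x' + 1) = vseq inpF (t' ++ [z]) (y + 1 + 1))
    (ht : Arena.thread (t' ++ [z]) <+: t) : A.Follows α ρ r s t (t' ++ [z]) x' (y + 1) where
  run := hr
  len := by rw [List.length_append, h.len]; rfl
  le_y := by have := h.le_y; omega
  le_x := hx'
  lt_x := hx's
  view := hv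
  all y₀ h1 h2 := by
    rw [List.length_append, List.length_singleton, h.len] at h2
    rcases Nat.lt_succ_iff_lt_or_eq.1 h2 with h3 | rfl
    · obtain ⟨x₀, h4, h5, h6⟩ := h.all y₀ h1 (by rw [h.len]; exact h3)
      exact ⟨x₀, h4, h5, by rw [h6, vseq_append (by rw [h.len]; exact h3)]⟩
    · exact ⟨x', hx's, hx', hv⟩
  thread := ht

theorem cnt_append {M : Type u} {N : Type v} {f : M → Option N} {s t : JSeq M} {n : ℕ}
    (h : n ≤ s.length) : cnt f (s ++ t) n = cnt f s n := by
  unfold cnt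
  rw [List.take_append_of_le_length h]

theorem cnt_thr_length : cnt thr t' t'.length = (thread t').length := by
  rw [cnt_length, length_thread]

theorem thread_concat_eq {m : (A.copies Ordering).Move} {p : Option ℕ}
    (hb : (A.copies Ordering).IsLegal (t' ++ [(m, p)])) (hm : col m = .eq) :
    thread (t' ++ [(m, p)]) = thread t' ++ [(base m, p.map (cnt thr t'))] := by
  have h1 : (t' ++ [(m, p)])[t'.length]? = some (m, p) := by simp
  have h2 := hb.thread_getElem? h1 hm
  rw [cnt_append le_rfl, cnt_thr_length] at h2
  have h3 : thread (t' ++ [(m, p)]) =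
      thread t' ++ [(base m, p.bind fun k => (keep thr t').idxOf? k)] :=
    restr_concat_some hb.backward (thr_eq hm)
  rw [h3, List.getElem?_concat_length, Option.some.injEq, Prod.mk.injEq] at h2
  rw [h3, h2.2]
  congr 3
  cases p with
  | none => rfl
  | some k => rw [Option.map_some, Option.map_some, cnt_append (hb.backward _ _ _ h1).le]

theorem thread_concat_ne {z : (A.copies Ordering).Move × Option ℕ} (hm : col z.1 ≠ .eq) :
    thread (t' ++ [z]) = thread t' := restr_concat_none (thr_ne hm)

/-- The response in the thread is copied from `t`. -/
theorem Follows.respond (hα : A.testArena.IsInnocent A.testPlays α)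
    (hρ : ∀ c, A.IsInnocent A.plays (ρ c)) (hs : A.IsRun α ρ r s) (hse : Even s.length)
    (hans : A.embed (forget s) ++ [A.ansOcc] ∈ α)
    (hρ' : A.IsInnocent A.plays (ρ' .eq)) (ht : t ∈ ρ' .eq)
    (hacc : A.embed t ++ [A.ansOcc] ∈ A.alpha (A.viewSet (Arena.thread s))) {x y : ℕ}
    (h : A.Follows α ρ' r s t t' x y) (hy : Even y) (hc : colAt t' y = some .eq) :
    ∃ z x', A.Follows α ρ' r s t (t' ++ [z]) x' (y + 1) ∧
      (Arena.thread (t' ++ [z])).length = (Arena.thread t').length + 1 := by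
  have hl' := h.run.legal
  have hlT := hl'.isLegal_thread
  have htl : A.IsLegal t := hρ'.mem_pos _ ht
  have hte := hρ'.even _ ht
  have hylt : y < t'.length := by rw [h.len]; omega
  obtain ⟨my, py, hmy, hcy⟩ := exists_of_colAt hc
  have hTy := hl'.thread_getElem? hmy hcy
  have hOy := (hl'.even_of_O hmy).2 hy
  have hce := (hlT.even_of_O hTy).1 hOy
  have hcl : (Arena.thread t').length = cnt thr t' y + 1 := by
    rw [← cnt_thr_length, h.len, cnt_thr_succ_eq hc]
  set c := cnt thr t' y with hcdef
  have hpre := h.thread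
  -- The thread so far has odd length and `t` has even length, so `t` still has a response to offer.
  have hlt : c + 1 < t.length := by
    have h1 := hpre.length_le
    rcases Nat.lt_or_ge (c + 1) t.length with h2 | h2
    · exact h2
    · rw [show t.length = c + 1 by omega] at hte
      exact absurd hce (Nat.even_add_one.1 hte)
  have htake : Arena.thread t' = t.take (c + 1) := by
    rw [List.prefix_iff_eq_take.1 hpre, hcl]
  obtain ⟨⟨m, p⟩, hm⟩ : ∃ z, t[c + 1]? = some z := ⟨_, List.getElem?_eq_getElem hlt⟩
  have hP : A.player m = .P := (htl.odd_of_P hm).2 hce.add_one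
  obtain ⟨k, rfl⟩ := htl.exists_ptr_of_P hm hP
  have hk := htl.backward _ _ _ hm
  -- `k'` is the position in `t'` of the justifier that the response has in `t`.
  obtain ⟨k', hk1, hk2, hk3, hk4, -⟩ := exists_keep_thr (s := t') (j := k) (by omega)
  set z : (A.copies Ordering).Move := (m, Ordering.eq) with hz
  have hzb : base z = m := rfl
  have hzc : col z = .eq := rfl
  have hleg : (A.copies Ordering).IsLegal (t' ++ [(z, some k')]) := by
    apply hl'.concat
    · intro h; cases h
    · intro l hl
      obtain rfl := Option.some.inj hl
      obtain ⟨mk, pk, hmk, hck⟩ := exists_of_colAt hk2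
      have hTk := hl'.thread_getElem? hmk hck
      obtain ⟨-, v, hv1, hv2⟩ := htl.justified _ _ _ hm
      rw [htake, hk3, List.getElem?_take_of_lt hk, hv1, Option.some.injEq] at hTk
      subst hTk
      exact ⟨_, hmk, hv2, hck⟩
    · intro i v hi hv
      obtain rfl : i = y := by rw [h.len] at hi; omega
      rw [hmy, Option.some.injEq] at hv
      subst hv
      change A.player (base my) ≠ A.player m
      rw [hP, show A.player (base my) = .O from hOy]
      simp
    · intro π l hl hπ
      obtain rfl := Option.some.inj hl
      obtain rfl : π = .O := by
        have h1 : A.player m ≠ π := hπ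
        cases π <;> simp_all
      have h1 := htl.visible hm hπ
      rw [← vchain_take (k := c + 1) le_rfl, ← htake, thread_eq, vchain_forget] at h1
      rw [h.len, (hl'.vchain_pview_thread (keep_thr_cnt hc)).1, List.mem_map]
      exact ⟨k, h1, by simp [List.getD, hk1]⟩
  have hthread : Arena.thread (t' ++ [(z, some k')]) = t.take (c + 1 + 1) := by
    rw [thread_concat_eq hleg hzc, htake, Option.map_some, hk3, List.take_add_one (i := c + 1), hm]
    rfl
  have hlast : (t' ++ [(z, some k')])[y + 1]? = some (z, some k') := by
    rw [← h.len]; simp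
  have hcol : colAt (t' ++ [(z, some k')]) (y + 1) = some .eq := colAt_eq hlast
  have hcnt : cnt thr (t' ++ [(z, some k')]) (y + 1) = c + 1 := by
    rw [cnt_append h.len.ge, ← h.len, cnt_thr_length, hcl]
  have hrun : A.IsRun α ρ' r (t' ++ [(z, some k')]) := by
    apply h.run.concat hleg
    · intro h; cases h
    · intro h1
      rw [h.len] at h1
      exact absurd hy (Nat.even_add_one.1 h1)
    · intro _
      have h1 := keep_thr_cnt hcol
      rw [hcnt] at h1
      rw [h.len, hleg.pview_thread h1, hthread, vseq_take le_rfl, ← htl.pview_take hlt]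
      exact ⟨_, hρ'.toIsStrategy.take_mem ht hce.add_one.add_one, rfl⟩
  -- Acceptance of `t` makes the O-view after the response an O-view of the thread of `s`; its
  -- position `x'` is the next position to be followed, and it may lie before `x`.
  obtain ⟨x', hx', hT⟩ := exists_tview_of_even hs.legal.isLegal_thread htl hte hacc
    hce.add_one.add_one (by omega) hlt
  have hT' : tview s (x' + 1) = tview (t' ++ [(z, some k')]) (y + 1 + 1) := by
    rw [← hT, tview, cnt_thr_succ_eq hcol, hcnt, hthread, vseq_take le_rfl]
  obtain ⟨mx, px, hmx, hcx⟩ := exists_of_colAt hx'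
  have hx's := (List.getElem?_eq_some_iff.1 hmx).1
  obtain ⟨hmz, -, h2⟩ := hs.legal.tview_succ_inj hleg hmx hcx hlast hzc hT'
  rw [hmz] at hmx h2
  have hPz : (A.copies Ordering).player z = .P := hP
  obtain ⟨l, rfl⟩ := hs.legal.exists_ptr_of_P hmx hPz
  have h3 := h2 l k' hPz rfl rfl
  have hk2' : colAt (t' ++ [(z, some k')]) k' = some .eq := by
    rw [hleg.colAt_ptr hlast, hcol]
  -- It remains to compare F-views at the justifiers `l` in `s` and `k'` in `t'`. The F-view at `k'`
  -- is known to occur in `s`, at `x₀`. This is what the field `all` is kept for.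
  obtain ⟨x₀, h4, h5, h6⟩ := h.all k' (hrun.le_of_eq hk2') hk4
  rw [← vseq_append (s := t') (t := [(z, some k')]) (Nat.succ_le_of_lt hk4)] at h6
  have h7 := tview_congr hs.legal hleg (by omega) (by rw [List.length_append]; omega) h6
  have hx₀ : colAt s x₀ = some .eq := by
    obtain ⟨⟨m₀, p₀⟩, hm₀⟩ : ∃ v, s[x₀]? = some v := ⟨_, List.getElem?_eq_getElem h4⟩
    obtain ⟨mk, pk, hmk, hck⟩ := exists_of_colAt hk2'
    obtain ⟨rfl, -⟩ := vseq_succ_inj hs.legal.backward hleg.backward hm₀ hmk h6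
    rw [colAt_eq hm₀, hck]
  have hl : colAt s l = some .eq := by rw [hs.legal.colAt_ptr hmx, hx']
  -- `l` and `x₀` are positions of the same answered run with equal O-views of the thread, so their
  -- F-views agree.
  have h8 := IsRun.vseq_inpF_of_tview hα hρ hs hse hans hl hx₀ (h3.trans h7.symm)
  refine ⟨(z, some k'), x', h.concat hrun (hs.le_of_eq hx') hx's
    (vseq_inpF_ptr hs.legal.backward hleg.backward hmx hlast (inpF_eq_true.2 ⟨hPz, hzc⟩)
      (h8.trans h6)) ?_, ?_⟩
  · rw [hthread]
    exact List.take_prefix _ _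
  · rw [hthread, List.length_take, hcl]
    omega

/-- The run is continued as in `s`. -/
theorem Follows.advance (hα : A.testArena.IsInnocent A.testPlays α)
    (hρ : ∀ c, A.IsInnocent A.plays (ρ c)) (hs : A.IsRun α ρ r s) (hse : Even s.length)
    (hans : A.embed (forget s) ++ [A.ansOcc] ∈ α)
    (hdet : A.IsODeterministic (A.viewSet (Arena.thread s)))
    (hne : [] ∉ A.viewSet (Arena.thread s)) (hag : ∀ c, c ≠ .eq → ρ c = ρ' c) (htl : A.IsLegal t) (hte : Even t.length)
    (hacc : A.embed t ++ [A.ansOcc] ∈ A.alpha (A.viewSet (Arena.thread s))) {x y : ℕ}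
    (h : A.Follows α ρ' r s t t' x y) (hc : Even y → colAt t' y ≠ some .eq)
    (hx : x + 1 < s.length) :
    ∃ z, A.Follows α ρ' r s t (t' ++ [z]) (x + 1) (y + 1) := by
  have hl' := h.run.legal
  have hylt : y < t'.length := by rw [h.len]; omega
  have hc' : Even x → colAt s x ≠ some .eq := by
    obtain ⟨⟨mx, px⟩, hmx⟩ : ∃ v, s[x]? = some v := ⟨_, List.getElem?_eq_getElem h.lt_x⟩
    obtain ⟨⟨my, py⟩, hmy⟩ : ∃ v, t'[y]? = some v := ⟨_, List.getElem?_eq_getElem hylt⟩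
    obtain ⟨rfl, -⟩ := vseq_succ_inj hs.legal.backward hl'.backward hmx hmy h.view
    rw [← hs.legal.even_of_O hmx, hl'.even_of_O hmy, colAt_eq hmx, ← colAt_eq hmy]
    exact hc
  obtain ⟨⟨m, p⟩, hrun, hF⟩ := hs.exists_step hα h.run hag h.len h.view hx h.le_x h.le_y hc'
  refine ⟨(m, p), h.concat hrun (by have := h.le_x; omega) hx hF ?_⟩
  have hleg := hrun.legal
  by_cases hm : col m = .eq
  swap
  · rw [thread_concat_ne hm]
    exact h.thread
  have hlast : (t' ++ [(m, p)])[y + 1]? = some (m, p) := by rw [← h.len]; simp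
  obtain ⟨⟨mx, px⟩, hmx⟩ : ∃ v, s[x + 1]? = some v := ⟨_, List.getElem?_eq_getElem hx⟩
  obtain ⟨rfl, -⟩ := vseq_succ_inj hs.legal.backward hleg.backward hmx hlast hF
  have hxeq : colAt s (x + 1) = some .eq := by rw [colAt_eq hmx, hm]
  have hyeq : colAt (t' ++ [(mx, p)]) (y + 1) = some .eq := by rw [colAt_eq hlast, hm]
  -- A P-move of the thread would reply to an O-move of the thread at `x`, where `hc'` says that the
  -- environment is to move.
  have hO : (A.copies Ordering).player mx = .O := by
    cases hP : (A.copies Ordering).player mx with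
    | O => rfl
    | P =>
      have h1 := hs.legal.colAt_succ_of_P hmx hP
      rw [hxeq] at h1
      have h2 := (hs.legal.odd_of_P hmx).1 hP
      rw [Nat.odd_add_one, Nat.not_odd_iff_even] at h2
      exact absurd h1 (hc' h2)
  have hwl := hs.legal.isLegal_thread
  have hlT := hleg.isLegal_thread
  have hthread := thread_concat_eq hleg hm
  have hTz := hleg.thread_getElem? hlast hm
  rw [cnt_append h.len.ge, ← h.len, cnt_thr_length] at hTz
  set c := (Arena.thread t').length with hcdef
  have hce : Even c := (hlT.even_of_O hTz).1 hO
  have hpre := h.thread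
  have htake : Arena.thread t' = t.take c := List.prefix_iff_eq_take.1 hpre
  have hcle : c ≤ t.length := hpre.length_le
  have hT := tview_congr hs.legal hleg (by omega) (by rw [List.length_append, h.len]; rfl) hF
  have hT0 := tview_congr hs.legal hl' (by have := h.lt_x; omega) (by rw [h.len]) h.view
  have hT0' : tview t' (y + 1) = vseq (A.isBy .P) t c := by
    rw [tview, ← h.len, cnt_thr_length, ← hcdef, htake, vseq_take le_rfl]
  have hT' : tview (t' ++ [(mx, p)]) (y + 1 + 1) =
      vseq (A.isBy .P) (Arena.thread (t' ++ [(mx, p)])) (c + 1) := by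
    rw [tview, cnt_thr_succ_eq hyeq, cnt_append h.len.ge, ← h.len, cnt_thr_length]
  have hTz' := hlT.vseq_last (inp := A.isBy .P) hTz
    (by simp [show A.player (base mx) = .O from hO])
  rw [hthread, vseq_append le_rfl, ← hthread] at hTz'
  have hview0 : vseq (A.isBy .P) (Arena.thread t') c = vseq (A.isBy .P) t c := by
    rw [htake, vseq_take le_rfl]
  obtain ⟨h1, h2⟩ := of_embed_ans_mem_alpha htl hte hacc
  have hxs : cnt thr s (x + 1) < (Arena.thread s).length := by
    have := cnt_thr_le (s := s) (x + 1 + 1)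
    rw [cnt_thr_succ_eq hxeq] at this
    exact this
  rcases Nat.lt_or_eq_of_le hcle with hlt | heq
  · obtain ⟨⟨m', p'⟩, hm'⟩ : ∃ v, t[c]? = some v := ⟨_, List.getElem?_eq_getElem hlt⟩
    have hO' : A.player m' = .O := (htl.even_of_O hm').2 hce
    have h3 := h1 c hce hlt
    -- The view after the new O-move and the view after the next O-move of `t` both lie in the set
    -- and extend the same view. O-determinism makes the two moves equal, so the thread remains a
    -- prefix of `t`.
    have h4 : vseq (A.isBy .P) (Arena.thread (t' ++ [(mx, p)])) (c + 1) ∈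
        A.viewSet (Arena.thread s) := by
      have h5 := hs.legal.thread_getElem? hmx hm
      rw [← hT', ← hT, tview, cnt_thr_succ_eq hxeq]
      exact ⟨_, hxs, Or.inl ((hwl.even_of_O h5).1 hO).add_one, rfl⟩
    have h5 := htl.vseq_last (inp := A.isBy .P) hm' (by simp [hO'])
    have h6 : vseq (A.isBy .P) (Arena.thread (t' ++ [(mx, p)])) (c + 1) =
        vseq (A.isBy .P) t (c + 1) := by
      rw [hTz', hview0] at h4 ⊢
      rw [h5] at h3 ⊢
      rw [hdet.deterministic _ _ _ (by exact hO) (by exact hO') h4 h3]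
    have e : t.take (c + 1) = t.take c ++ [(m', p')] := by
      rw [List.take_add_one, hm']
      rfl
    have hlast : (base mx, p.map (cnt thr t')) = (m', p') := by
      have hl1 : A.IsLegal (t.take c ++ [(base mx, p.map (cnt thr t'))]) := by
        rw [← htake, ← hthread]
        exact hlT
      have hl2 : A.IsLegal (t.take c ++ [(m', p')]) := e ▸ htl.take _
      refine hl1.eq_of_vseq_eq hl2 (π := .P)
        (by simp [show A.player (base mx) = .O from hO]) ?_
      rw [← e, ← htake, ← hthread, ← hcdef, h6, vseq_take le_rfl]
    rw [hthread, hlast, htake, ← e]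
    exact List.take_prefix _ _
  -- If `t` is used up, its O-view is the O-view of the entire thread of `s`. Yet the same O-view
  -- occurs in `s` before the O-move at `x + 1`, so the last move of the thread of `s` would be
  -- followed by another one.
  · exfalso
    rw [← heq] at h2
    obtain ⟨n, hn, hn', h3⟩ := h2
    have hn0 : n ≠ 0 := by
      rintro rfl
      exact hne ⟨0, by omega, hn', (vseq_zero _ _).symm⟩
    have hc0 : c ≠ 0 := by
      intro h0
      rw [h0, vseq_zero] at h3
      exact hn0 ((vseq_eq_nil hn).1 h3.symm)
    obtain ⟨k, rfl⟩ := Nat.exists_eq_succ_of_ne_zero hn0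
    obtain ⟨j, hj⟩ := Nat.exists_eq_succ_of_ne_zero hc0
    rw [Nat.succ_eq_add_one] at *
    obtain ⟨x₁, -, hx₁, hcx₁, hl₁, hT₁⟩ := exists_keep_thr (s := s) (j := k) hn
    -- The view of `t` ends with a P-move, while the view of a prefix of odd length ends with an
    -- O-move.
    have hlast : k + 1 = (Arena.thread s).length := by
      rcases hn' with ho | h4
      swap
      · exact h4
      exfalso
      obtain ⟨⟨mk, pk⟩, hmk⟩ : ∃ v, (Arena.thread s)[k]? = some v :=
        ⟨_, List.getElem?_eq_getElem (by omega)⟩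
      obtain ⟨⟨mj, pj⟩, hmj⟩ : ∃ v, t[j]? = some v := ⟨_, List.getElem?_eq_getElem (by omega)⟩
      rw [hj] at h3 hce
      obtain ⟨rfl, -⟩ := vseq_succ_inj htl.backward hwl.backward hmj hmk h3
      have h4 := (htl.odd_of_P hmj).2 (by simpa [Nat.even_add_one] using hce)
      have h5 := (hwl.even_of_O hmk).2 (by simpa [Nat.odd_add_one] using ho)
      rw [show A.player mj = .O from h5] at h4
      cases h4
    have hcnt : 0 < cnt thr s (x + 1) := by
      rw [Nat.pos_iff_ne_zero, Ne, ← tview_eq_nil, hT0, hT0', vseq_eq_nil hcle]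
      exact hc0
    obtain ⟨a, ha1, ha2, ha3, ha4⟩ := exists_prev (s := s) (n := x + 1) (by omega) hcnt
    have hodd := hs.odd_of_next ha2 ha1 hx ha3 ((hs.legal.even_of_O hmx).1 hO)
    have hTa : tview s (a + 1) = tview s (x₁ + 1) := by
      rw [hT₁, ← h3, ← hT0', ← hT0, tview, tview, ha4]
    obtain ⟨y', hy1, hy2, -⟩ :=
      IsRun.next_of_tview hα hρ hs hse hans ha2 hx₁ hTa hodd ha1 hxeq ha3
    have h4 := cnt_thr_le (s := s) (y' + 1)
    have h5 := cnt_mono thr s (Nat.succ_le_of_lt hy1)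
    rw [Nat.succ_eq_add_one, cnt_thr_succ_eq hx₁] at h5
    rw [cnt_thr_succ_eq hy2] at h4
    omega

end Arena
-- Exchanging the strategy of one thread.
namespace Arena

section
variable {A : Arena.{u}} {s : JSeq (A.copies Ordering).Move} {t : JSeq A.Move}
  {t' : JSeq (A.copies Ordering).Move}
  {α : Set (JSeq A.testArena.Move)} {ρ ρ' : Ordering → Set (JSeq A.Move)} {r : ℕ}

theorem length_thread_le_concat (hb : (A.copies Ordering).IsLegal (s ++ t')) :
    (thread s).length ≤ (thread (s ++ t')).length :=
  (restr_prefix (f := thr) hb.backward).length_le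

/-- The run is extended by a response from `t` when P is to move in the thread and by a move copied
from `s` otherwise. When the followed position is the last one of `s` and the environment is to
move, the test answers as it does after `s`. -/
theorem Follows.exists_answered (hα : A.testArena.IsInnocent A.testPlays α)
    (hρ : ∀ c, A.IsInnocent A.plays (ρ c)) (hs : A.IsRun α ρ r s) (hse : Even s.length)
    (hans : A.embed (forget s) ++ [A.ansOcc] ∈ α)
    (hdet : A.IsODeterministic (A.viewSet (Arena.thread s)))
    (hne : [] ∉ A.viewSet (Arena.thread s)) (hag : ∀ c, c ≠ .eq → ρ c = ρ' c)
    (hρ' : A.IsInnocent A.plays (ρ' .eq)) (ht : t ∈ ρ' .eq)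
    (hacc : A.embed t ++ [A.ansOcc] ∈ A.alpha (A.viewSet (Arena.thread s))) {x y : ℕ}
    (h : A.Follows α ρ' r s t t' x y) :
    ∃ u, A.IsRun α ρ' r u ∧ A.embed (forget u) ++ [A.ansOcc] ∈ α := by
  -- A lexicographic measure: a response uses up a move of `t` and may reset `x`, whereas copying
  -- from `s` increases `x` and does not shorten the thread.
  induction hN : (t.length - (Arena.thread t').length) * (s.length + 1) + (s.length - x)
    using Nat.strong_induction_on generalizing t' x y with
  | _ N ih =>
    by_cases hc : Even y → colAt t' y ≠ some .eq
    · rcases Nat.lt_or_ge (x + 1) s.length with hx | hx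
      · obtain ⟨z, hz⟩ := h.advance hα hρ hs hse hans hdet hne hag (hρ'.mem_pos _ ht)
          (hρ'.even _ ht) hacc hc hx
        refine ih _ ?_ hz rfl
        have h1 := length_thread_le_concat hz.run.legal
        have h2 := Nat.mul_le_mul_right (s.length + 1)
          (Nat.sub_le_sub_left h1 t.length)
        omega
      · have hlen : s.length = x + 1 := by have := h.lt_x; omega
        exact ⟨t', h.run, (IsRun.final hα hs h.run hse hans hlen h.view
          (by rw [h.len]; omega)).2⟩
    · push Not at hc
      obtain ⟨z, x', hz, hz'⟩ := h.respond hα hρ hs hse hans hρ' ht hacc hc.1 hc.2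
      refine ih _ ?_ hz rfl
      have h1 := hz.thread.length_le
      rw [hz'] at h1 ⊢
      obtain ⟨d, hd⟩ : ∃ d, t.length - (Arena.thread t').length = d + 1 :=
        ⟨t.length - (Arena.thread t').length - 1, by omega⟩
      have hd' : t.length - ((Arena.thread t').length + 1) = d := by omega
      rw [← hN, hd, hd', Nat.succ_mul]
      omega

theorem nil_notMem_viewSet {w : JSeq A.Move} (hw : 0 < w.length) : [] ∉ A.viewSet w := by
  rintro ⟨n, hn, h1, h2⟩
  obtain rfl := (vseq_eq_nil hn).1 h2.symm
  rcases h1 with h1 | h1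
  · exact absurd h1.pos (by omega)
  · omega

/-- Replacing the strategy that plays the thread of `r`. -/
theorem IsRun.exchange (hα : A.testArena.IsInnocent A.testPlays α)
    (hρ : ∀ c, A.IsInnocent A.plays (ρ c)) (hs : A.IsRun α ρ r s) (hse : Even s.length)
    (hans : A.embed (forget s) ++ [A.ansOcc] ∈ α)
    (hag : ∀ c, c ≠ .eq → ρ c = ρ' c) (hρ' : A.IsInnocent A.plays (ρ' .eq))
    (himp : ∀ S : Set (JSeq A.Move), A.IsODeterministic S →
      comp (ρ .eq) (A.alpha S) = sigmaTop → comp (ρ' .eq) (A.alpha S) = sigmaTop)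
    {m : (A.copies Ordering).Move} (hm : s[r]? = some (m, none)) :
    ∃ u, A.IsRun α ρ' r u ∧ A.embed (forget u) ++ [A.ansOcc] ∈ α := by
  have hdet := hs.isODeterministic hα hρ hse hans hm
  obtain ⟨h0, hroot⟩ := hs.thread_zero hm
  have hwpos : 0 < (thread s).length := (List.getElem?_eq_some_iff.1 h0).1
  have hne := nil_notMem_viewSet hwpos
  have hw := hs.legal.isLegal_thread
  have hrlt : r < s.length := (List.getElem?_eq_some_iff.1 hm).1
  obtain ⟨t, ht, hacc⟩ := (comp_alpha_iff hρ'.toIsStrategy _).1 (himp _ hdet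
    ((comp_alpha_iff (hρ _).toIsStrategy _).2
      ⟨_, hs.thread_mem (hρ _) hse, hs.embed_thread_mem hα hρ hse hans⟩))
  have htl : A.IsLegal t := hρ'.mem_pos _ ht
  obtain ⟨h1, h2⟩ := of_embed_ans_mem_alpha htl (hρ'.even _ ht) hacc
  have htpos : 0 < t.length := by
    rcases Nat.eq_zero_or_pos t.length with h3 | h3
    · rw [h3, vseq_zero] at h2
      exact absurd h2 hne
    · exact h3
  have hlen : (s.take (r + 1)).length = r + 1 := by
    rw [List.length_take]; omega
  have hmr : (A.copies Ordering).player m = .O :=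
    (A.copies Ordering).initial_player m (hs.legal.initial_of_none _ _ hm)
  have hmc : colAt s r = some .eq := by
    rw [colAt_eq hm, hs.rooted r m hm]
    exact congrArg some (compare_eq_iff_eq.2 rfl)
  refine Follows.exists_answered (t' := s.take (r + 1)) (x := r) (y := r) hα hρ hs hse hans hdet
    hne hag hρ' ht hacc ⟨?_, hlen, le_rfl, le_rfl, hrlt, (vseq_take le_rfl).symm, ?_, ?_⟩
  -- Up to position `r` the only move of colour `eq` is the initial O-move, so no response there
  -- involves the strategy that is exchanged.
  · have h3 := hs.take (r + 1)
    refine ⟨h3.legal, h3.rooted, h3.test, fun n m' p hn hx => ?_⟩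
    have h4 := h3.resp n m' p hn hx
    obtain ⟨h5, h6⟩ := getElem?_take_eq_some hx
    rwa [hag] at h4
    intro hc
    have h7 := hs.le_of_eq (show colAt s n = some .eq by rw [colAt_eq h6, hc])
    obtain rfl : n = r := by omega
    rw [hm, Option.some.injEq, Prod.mk.injEq] at h6
    have h8 := (hs.legal.odd_of_P hm).2 hn
    rw [show (A.copies Ordering).player (m, (none : Option ℕ)).1 = .O from hmr] at h8
    cases h8
  · intro y₀ h3 h4
    rw [hlen] at h4
    obtain rfl : y₀ = r := by omega
    exact ⟨y₀, hrlt, le_rfl, (vseq_take le_rfl).symm⟩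
  · have hcr : cnt thr s r = 0 := by
      by_contra h3
      obtain ⟨u, h4, h5, -⟩ := exists_prev hrlt.le (Nat.pos_of_ne_zero h3)
      have := hs.le_of_eq h5
      omega
    rw [thread_take hs.legal.backward, cnt_thr_succ_eq hmc, hcr]
    -- All views in the set begin with the initial move of the thread. The O-view of the first move
    -- of `t` is that move alone, so `t` starts in the same way.
    have h3 : ∀ v ∈ A.viewSet (thread s), v[0]? = some (base m, none) := by
      rintro v ⟨n, hn, hn', rfl⟩
      refine (vseq_head? hw h0 hroot hn ?_).1
      rcases hn' with h1 | h1
      · exact h1.pos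
      · omega
    obtain ⟨⟨m₀, p₀⟩, hm₀⟩ : ∃ z, t[0]? = some z := ⟨_, List.getElem?_eq_getElem htpos⟩
    obtain rfl : p₀ = none := by
      cases p₀ with
      | none => rfl
      | some k => exact absurd (htl.backward _ _ _ hm₀) (by omega)
    have h4 := h3 _ (h1 0 (by simp) htpos)
    have h5 : prd (A.isBy .P) t 0 = 0 := Nat.le_zero.1 (prd_le htl.backward 0)
    rw [vseq_succ htl.backward hm₀, h5, vseq_zero] at h4
    simp only [List.nil_append, List.getElem?_cons_zero, Option.some.injEq, Prod.mk.injEq,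
      Option.bind_none, and_true] at h4
    rw [h4] at hm₀
    have h6 : (thread s).take 1 = t.take 1 := by
      rw [List.take_add_one, List.take_add_one, h0, hm₀]
      simp
    rw [Nat.zero_add, h6]
    exact List.take_prefix _ _

end

variable {A : Arena.{u}} {s : JSeq A.Move} {r : ℕ}

/-! ### Threads -/

/-- The position of the initial move of the thread of an occurrence. -/
def root {M : Type u} (s : JSeq M) (n : ℕ) : ℕ :=
  match s[n]? with
  | some (_, some k) => if k < n then root s k else n
  | _ => n
termination_by n

theorem root_none {M : Type u} {s : JSeq M} {n : ℕ} {m : M} (h : s[n]? = some (m, none)) :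
    root s n = n := by
  rw [root, h]

theorem root_some {M : Type u} {s : JSeq M} {n k : ℕ} {m : M} (h : s[n]? = some (m, some k))
    (hk : k < n) : root s n = root s k := by
  rw [root, h]
  simp [hk]

theorem root_spec {M : Type u} {s : JSeq M} (hs : s.Backward) {n : ℕ} (hn : n < s.length) :
    root s n ≤ n ∧ ∃ m, s[root s n]? = some (m, none) := by
  induction n using Nat.strong_induction_on with
  | _ n ih =>
    obtain ⟨⟨m, p⟩, hx⟩ : ∃ z, s[n]? = some z := ⟨_, List.getElem?_eq_getElem hn⟩
    cases p with
    | none => rw [root_none hx]; exact ⟨le_rfl, m, hx⟩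
    | some k =>
      have hk := hs n m k hx
      rw [root_some hx hk]
      obtain ⟨h1, h2⟩ := ih k hk (by omega)
      exact ⟨by omega, h2⟩

/-- A move with a colour. -/
def withCol (A : Arena.{u}) {C : Type} (m : A.Move) (c : C) : (A.copies C).Move := (m, c)

/-- Colour a play by the position of the threads relative to `r`. -/
def paint (s : JSeq A.Move) (r : ℕ) : JSeq (A.copies Ordering).Move :=
  s.mapIdx fun i x => (A.withCol x.1 (compare (root s i) r), x.2)

theorem getElem?_paint {n : ℕ} : (paint s r)[n]? =
    (s[n]?).map fun x => (A.withCol x.1 (compare (root s n) r), x.2) :=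
  List.getElem?_mapIdx

theorem forget_paint : forget (paint s r) = s := by
  apply List.ext_getElem?
  intro n
  rw [getElem?_forget, getElem?_paint, Option.map_map]
  exact Option.map_id'

theorem exists_of_getElem?_paint {n : ℕ} {m : (A.copies Ordering).Move} {p : Option ℕ}
    (h : (paint s r)[n]? = some (m, p)) :
    s[n]? = some (base m, p) ∧ col m = compare (root s n) r := by
  rw [getElem?_paint, Option.map_eq_some_iff] at h
  obtain ⟨⟨m', p'⟩, h1, h2⟩ := h
  obtain ⟨rfl, rfl⟩ := Prod.mk.inj h2
  exact ⟨h1, rfl⟩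

theorem isLegal_paint (hs : A.IsLegal s) : (A.copies Ordering).IsLegal (paint s r) := by
  apply IsLegal.of_visible
  · constructor
    · intro i m hx
      exact hs.initial_of_none i _ (exists_of_getElem?_paint hx).1
    · intro i m k hx
      obtain ⟨h1, h2⟩ := exists_of_getElem?_paint hx
      obtain ⟨hk, z, hz, he⟩ := hs.justified i _ k h1
      refine ⟨hk, (A.withCol z.1 (compare (root s k) r), z.2), by rw [getElem?_paint, hz]; rfl, he, ?_⟩
      change compare (root s k) r = col m
      rw [h2, root_some h1 hk]
  · rintro i ⟨m, p⟩ ⟨m', p'⟩ hx hy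
    exact hs.alternating i _ _ (exists_of_getElem?_paint hx).1 (exists_of_getElem?_paint hy).1
  · intro π i m k hx hm
    rw [← vchain_forget, forget_paint]
    exact hs.visible (exists_of_getElem?_paint hx).1 hm

variable {α : Set (JSeq A.testArena.Move)} {ρ : Ordering → Set (JSeq A.Move)}

theorem isRun_paint (hs : A.IsLegal s)
    (ht : ∀ n, Odd n → n ≤ s.length → A.embed (s.take n) ∈ α)
    (hr : ∀ n, Odd n → n < s.length →
      vseq (A.isBy .O) s (n + 1) ∈ A.pview '' ρ (compare (root s n) r)) :
    A.IsRun α ρ r (paint s r) where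
  legal := isLegal_paint hs
  rooted i m hx := by
    obtain ⟨h1, h2⟩ := exists_of_getElem?_paint hx
    rw [h2, root_none h1]
  test n hn hle := by
    rw [← length_forget, forget_paint] at hle
    rw [forget_paint]
    exact ht n hn hle
  resp n m p hn hx := by
    obtain ⟨h1, h2⟩ := exists_of_getElem?_paint hx
    rw [forget_paint, h2]
    exact hr n hn (List.getElem?_eq_some_iff.1 h1).1

/-- Colours are constant along pointers, so they are fixed by the root of the thread. The
description by colours can thus be translated back into one by starting positions. -/
theorem IsRun.col_eq {u : JSeq (A.copies Ordering).Move} (h : A.IsRun α ρ r u) {n : ℕ}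
    {m : (A.copies Ordering).Move} {p : Option ℕ} (hx : u[n]? = some (m, p)) :
    col m = compare (root (forget u) n) r := by
  induction n using Nat.strong_induction_on generalizing m p with
  | _ n ih =>
    have hx' : (forget u)[n]? = some (base m, p) := by rw [getElem?_forget, hx]; rfl
    cases p with
    | none => rw [root_none hx', h.rooted n m hx]
    | some k =>
      have hk := h.legal.backward n m k hx
      have h1 := h.legal.colAt_ptr hx
      have hlt := (List.getElem?_eq_some_iff.1 hx).1
      obtain ⟨⟨m', p'⟩, hx''⟩ : ∃ z, u[k]? = some z := ⟨_, List.getElem?_eq_getElem (by omega)⟩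
      rw [colAt_eq hx, colAt_eq hx'', Option.some.injEq] at h1
      rw [root_some hx' hk, ← h1, ih k hk hx'']

/-! ### Replacing all threads, from the last to the first. -/

variable {σ τ : Set (JSeq A.Move)}

/-- There is an answered play in which the threads starting before `r` are played by `σ` and the
others by `τ`. -/
def Mixed (α : Set (JSeq A.testArena.Move)) (σ τ : Set (JSeq A.Move)) (r : ℕ) : Prop :=
  ∃ s, A.IsLegal s ∧ A.embed s ++ [A.ansOcc] ∈ α ∧
    ∀ n, Odd n → n < s.length →
      vseq (A.isBy .O) s (n + 1) ∈ A.pview '' if root s n < r then σ else τ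

/-- The two conditions differ only for a thread that starts exactly at `r`, and that thread is
exchanged. Threads that start later may come out differently in the new play, but they are played by
`τ` before and after. -/
theorem Mixed.pred (hα : A.testArena.IsInnocent A.testPlays α)
    (hσ : A.IsInnocent A.plays σ) (hτ : A.IsInnocent A.plays τ)
    (himp : ∀ S : Set (JSeq A.Move), A.IsODeterministic S →
      comp σ (A.alpha S) = sigmaTop → comp τ (A.alpha S) = sigmaTop)
    (h : A.Mixed α σ τ (r + 1)) : A.Mixed α σ τ r := by
  obtain ⟨s, hs, hans, hresp⟩ := h
  have hse : Even s.length := by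
    have := hα.even _ hans
    rw [List.length_append, length_embed, List.length_singleton, Nat.even_add_one,
      Nat.even_add_one, not_not] at this
    exact this
  have htest : ∀ n, Odd n → n ≤ s.length → A.embed (s.take n) ∈ α := by
    intro n hn hle
    have := hα.toIsStrategy.take_mem hans hn.add_one
    rwa [List.take_append_of_le_length (by rw [length_embed]; omega), embed_take] at this
  by_cases hr : ∃ m, s[r]? = some (m, none)
  · obtain ⟨m, hm⟩ := hr
    -- `ρ` and `ρ'` agree on `lt`, which goes to `σ`, and on `gt`, which goes to `τ`; they differ at
    -- `eq`.
    set ρ : Ordering → Set (JSeq A.Move) := fun c => if c = .gt then τ else σ with hρdef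
    set ρ' : Ordering → Set (JSeq A.Move) := fun c => if c = .lt then σ else τ with hρdef'
    have hρ : ∀ c, A.IsInnocent A.plays (ρ c) := by
      intro c
      simp only [hρdef]
      split <;> assumption
    have hrun : A.IsRun α ρ r (paint s r) := by
      refine isRun_paint hs htest fun n hn hlt => ?_
      have h1 := hresp n hn hlt
      simp only [hρdef, compare_gt_iff_gt]
      rcases Nat.lt_or_ge r (root s n) with h2 | h2
      · rw [if_pos h2]
        rwa [if_neg (by omega)] at h1
      · rw [if_neg (not_lt.2 h2)]
        rwa [if_pos (by omega)] at h1
    have hpm : (paint s r)[r]? = some (A.withCol m (compare (root s r) r), none) := by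
      rw [getElem?_paint, hm]
      rfl
    obtain ⟨u, hu, hu'⟩ := hrun.exchange (ρ' := ρ') hα hρ
      (by rwa [← length_forget, forget_paint]) (by rwa [forget_paint])
      (by intro c hc; cases c <;> simp_all) hτ himp hpm
    refine ⟨forget u, isLegal_forget hu.legal, hu', fun n hn hlt => ?_⟩
    rw [length_forget] at hlt
    obtain ⟨⟨m', p⟩, hx⟩ : ∃ z, u[n]? = some z := ⟨_, List.getElem?_eq_getElem hlt⟩
    have h1 := hu.resp n m' p hn hx
    rw [hu.col_eq hx] at h1
    simpa only [hρdef', compare_lt_iff_lt] using h1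
  -- No thread starts at `r`, so the same play serves.
  · refine ⟨s, hs, hans, fun n hn hlt => ?_⟩
    have h1 := hresp n hn hlt
    have h2 : root s n ≠ r := by
      rintro rfl
      exact hr (root_spec hs.backward hlt).2
    by_cases h3 : root s n < r
    · rw [if_pos h3]
      rwa [if_pos (by omega)] at h1
    · rw [if_neg h3]
      rwa [if_neg (by omega)] at h1

/-- The tests `α_S` suffice. -/
theorem leIB_of_alpha (hσ : A.IsInnocent A.plays σ) (hτ : A.IsInnocent A.plays τ)
    (himp : ∀ S : Set (JSeq A.Move), A.IsODeterministic S →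
      comp σ (A.alpha S) = sigmaTop → comp τ (A.alpha S) = sigmaTop) : A.LeIB σ τ := by
  intro α hα hp
  have h0 := hα.toIsStrategy.nil_mem
  rw [comp_eq_sigmaTop_iff hσ.toIsStrategy h0 hα.mem_pos hα.even] at hp
  rw [comp_eq_sigmaTop_iff hτ.toIsStrategy h0 hα.mem_pos hα.even]
  obtain ⟨s, hs, hans⟩ := hp
  have hsl : A.IsLegal s := hσ.mem_pos _ hs
  -- Every thread starts before the end of `s`, so at `r = s.length` all of them are played by `σ`;
  -- at `r = 0` all are played by `τ`.
  have hstart : A.Mixed α σ τ s.length := by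
    refine ⟨s, hsl, hans, fun n hn hlt => ?_⟩
    rw [if_pos (lt_of_le_of_lt (root_spec hsl.backward hlt).1 hlt), ← hsl.pview_take hlt]
    exact ⟨_, hσ.toIsStrategy.take_mem hs hn.add_one, rfl⟩
  have hdown : ∀ r, A.Mixed α σ τ r → A.Mixed α σ τ 0 := by
    intro r
    induction r with
    | zero => exact id
    | succ r ih => exact fun h => ih (h.pred hα hσ hτ himp)
  obtain ⟨t, htl, htans, hresp⟩ := hdown _ hstart
  refine ⟨t, hτ.mem_of_views htl ?_ fun n hn hlt => ?_, htans⟩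
  · have := hα.even _ htans
    rw [List.length_append, length_embed, List.length_singleton, Nat.even_add_one,
      Nat.even_add_one, not_not] at this
    exact this
  · rw [htl.pview_take hlt]
    simpa using hresp n hn hlt

end Arena
end GameSem

theorem mainTheorem3 (A : GameSem.Arena.{u}) (σ τ : Set (GameSem.JSeq A.Move))
    (hσ : A.IsInnocent A.plays σ) (hτ : A.IsInnocent A.plays τ) :
    A.LeIB σ τ ↔
      ∀ S : Set (GameSem.JSeq A.Move), A.IsODeterministic S →
        GameSem.Arena.comp σ (A.alpha S) = GameSem.sigmaTop →
        GameSem.Arena.comp τ (A.alpha S) = GameSem.sigmaTop :=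
  ⟨fun h _ hS hp => h.alpha hσ.toIsStrategy hτ.toIsStrategy hS hp,
    GameSem.Arena.leIB_of_alpha hσ hτ⟩
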